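/- **Setting.** Let $Y$ and $Y_0,Y_1,\dots$ be $\mathbb R^d$-valued random variables on one probability space, let $\xi$ be an inner noise independent of all of them, and let $X(y)=X(y,\xi)$, $X_k(y)=X_k(y,\xi)$ and $\Delta_kX(y)=\Delta_kX(y,\xi)$, $k\ge 0$, be jointly measurable real random fields, $y\in\mathbb R^d$. Let $\pi:\mathbb R^d\to\mathbb R$ be measurable. Put $$U_1(Y)=\mathsf E[X(Y)\mid Y],\qquad U_0=\mathsf E[\max\{U_1(Y),\pi(Y)\}].$$ For $Z=Y$ and for every $Z=Y_\ell$ suppose $\mathsf E[\Delta_kX(Z)\mid Z]=\mathsf E[X_k(Z)-X_{k-1}(Z)\mid Z]$ for all $k\ge0$, with $X_{-1}:=0$. Let $q>2$, and for $0<p\le q$ let $\beta_p,\hat\beta_p\ge1$ and $\lambda_p\ge0$ with $\lambda_2=0$. Assume the following for all $\ell,k\ge0$ and all $0<p\le q$, with constants that do not depend on $\ell$ and $k$; write $k_+=\max\{k,1\}$. 1. (Moments and density) $\mathsf E|X(Y)|^q+\mathsf E|\pi(Y)|^q<\infty$, and there are $\bar\delta,\bar\rho>0$ with $\mathsf P(|U_1(Y)-\pi(Y)|<x)\le\bar\rho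 x$ for $0<x<\bar\delta$. 2. (Inner rates) For $Z=Y$, and also for $Z=Y_\ell$ uniformly in $\ell$: $\mathsf E|X_k(Z)-X(Z)|^q\le a_1k_+^{\lambda_q}2^{-qk/2}$ and $\mathsf E|\Delta_kX(Z)|^p\le a_2k_+^{\lambda_p}2^{-\beta_ppk/2}$; moreover $\mathrm{Cost}(X_k(y))\le a_02^k$ for all $y\in\mathbb R^d$. 3. (Outer approximation) $\mathrm{Cost}(Y_\ell)\le\hat a_02^\ell$, and $\mathsf E|\pi(Y)-\pi(Y_\ell)|^p\le a_32^{-\hat\beta_pp\ell/2}$, $\ \mathsf E|X_k(Y)-X_k(Y_\ell)|^p\le a_42^{-\hat\beta_pp\ell/2}$, and, if $\ell\ge1$, $\ \mathsf E|\Delta_kX(Y_\ell)-\Delta_kX(Y_{\ell-1})|^p\le a_52^{-\hat\beta_pp\ell/2}$. **Estimator.** Fix $1\le\zeta\le\beta_q$ and positive integers $N_{\ell,k}$ ($0\le k\le\ell$) with $c\max\{2^{\ell-\zeta k},1\}\le N_{\ell,k}\le c'\max\{2^{\ell-\zeta k},1\}$ for constants $c,c'>0$. For $i=0,1$ and $\ell\ge1$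 let $$C_\ell^{(i)}(y)=\sum_{k=0}^{\ell-1}\frac1{N_{\ell-1,k}}\sum_{n=1}^{N_{\ell-1,k}}\Delta_kX^{(i,n)}(y),\qquad F_\ell(y)=\tfrac12\big(C_\ell^{(0)}(y)+C_\ell^{(1)}(y)\big)+\frac1{N_{\ell,\ell}}\sum_{n=1}^{N_{\ell,\ell}}\Delta_\ell X^{(n)}(y),$$ and $F_0(y)=N_{0,0}^{-1}\sum_{n=1}^{N_{0,0}}\Delta_0X^{(n)}(y)$, where all samples use independent copies of $\xi$ (the same copies for different $y$), independent of $(Y,Y_0,Y_1,\dots)$. Set $\Delta_0=\max\{F_0(Y_0),\pi(Y_0)\}$ and, for $\ell\ge1$, $$\Delta_\ell=\max\{F_\ell(Y_\ell),\pi(Y_\ell)\}-\tfrac12\sum_{i=0}^1\max\{C_\ell^{(i)}(Y_{\ell-1}),\pi(Y_{\ell-1})\}.$$ Assume that the sample sizes retain the telescoping property, in the sense that for every $\ell\ge1$ either $N_{\ell,k}=2N_{\ell-1,k}$ for all $k<\ell$ (as for $N_{\ell,k}=N_{0,0}2^{\ell-k}$, $\zeta=1$), or at least $\mathsf E\max\{F_\ell(Y_\ell),\pi(Y_\ell)\}=\mathsf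 E\max\{C^{(0)}_{\ell+1}(Y_\ell),\pi(Y_\ell)\}$. Given $L$ and $M_0,\dots,M_L\ge1$, the nested MLMC estimator is $\widehat U=\sum_{\ell=0}^L M_\ell^{-1}\sum_{m=1}^{M_\ell}\Delta_\ell^{(m)}$ with independent copies $\Delta_\ell^{(m)}$ of $\Delta_\ell$. Its cost is the sum of the costs of all samples of $Y_\ell,Y_{\ell-1}$ and of all samples $\Delta_kX(y)$ used, at $y=Y_\ell$ and at $y=Y_{\ell-1}$, where a sample of $\Delta_kX(y)$ costs $\mathrm{Cost}(X_k(y))$. **Theorem.** There is $C>0$ such that for every $0<\varepsilon<e^{-1}$ there are $L$ and $M_0,\dots,M_L\ge1$ for which $\big(\mathsf E|\widehat U-U_0|^2\big)^{1/2}\le\varepsilon$ and, for every realisation of the samples, $$\mathrm{Cost}\le C\varepsilon^{-2}\cdot\begin{cases}1&\text{if }\beta_2>1\text{ and }\hat\beta_2>1,\\|\log\varepsilon|^3&\text{otherwise.}\end{cases}$$ -/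

import Mathlib

open MeasureTheory

open scoped ENNReal NNReal

noncomputable section

/-- The data of a nested simulation problem with outer variable in `ℝ^d`.

`Ω` carries the outer variable `Y` and its approximations `Y_ℓ`, all on one space, so that they are
coupled.  `E` is the space of the inner noise, which is independent of the outer variables: `X y e`
is the sample of `X(y)` produced by the noise `e`, so two samples with the same `e` are coupled and
samples with independent `e` are conditionally independent given `y`. -/
structure NestedModel (d : ℕ) (Ω E : Type*) where
  /-- the outer variable `Y` -/
  Y : Ω → EuclideanSpace ℝ (Fin d)
  /-- the approximations `Y_ℓ` of `Y` -/
  Yapp : ℕ → Ω → EuclideanSpace ℝ (Fin d)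
  /-- the payoff function `π` -/
  payoff : EuclideanSpace ℝ (Fin d) → ℝ
  /-- the exact inner random field `X(y)` -/
  X : EuclideanSpace ℝ (Fin d) → E → ℝ
  /-- its approximations `X_k(y)` -/
  Xapp : ℕ → EuclideanSpace ℝ (Fin d) → E → ℝ
  /-- the correction terms `Δ_k X(y)` -/
  DX : ℕ → EuclideanSpace ℝ (Fin d) → E → ℝ
  /-- the cost of a sample of `X_k(y)` -/
  costX : ℕ → EuclideanSpace ℝ (Fin d) → ℝ≥0
  /-- the cost of a sample of `Y_ℓ` -/
  costY : ℕ → ℝ≥0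

/-- `E[|f|^p]`, as an extended non-negative number (infinite when the moment is infinite). -/
def absMoment {α : Type*} [MeasurableSpace α] (μ : Measure α) (f : α → ℝ) (p : ℝ) : ℝ≥0∞ :=
  ∫⁻ z, ENNReal.ofReal (|f z| ^ p) ∂μ

/-- The sample sizes `N ℓ k`, for `k ≤ ℓ`, are of the order of `max {2^(ℓ - ζ k), 1}`. -/
def InnerSizes (ζ : ℝ) (N : ℕ → ℕ → ℕ) : Prop :=
  ∃ c > (0 : ℝ), ∃ c' > (0 : ℝ), ∀ ℓ k : ℕ, k ≤ ℓ →
    c * max ((2 : ℝ) ^ ((ℓ : ℝ) - ζ * k)) 1 ≤ N ℓ k ∧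
      (N ℓ k : ℝ) ≤ c' * max ((2 : ℝ) ^ ((ℓ : ℝ) - ζ * k)) 1

namespace NestedModel

variable {d : ℕ} {Ω E : Type*} [MeasurableSpace Ω] [MeasurableSpace E]

/-- Everything in the model is measurable, the random fields jointly in `(y, e)`. -/
structure IsMeasurable (M : NestedModel d Ω E) : Prop where
  Y : Measurable M.Y
  Yapp : ∀ ℓ, Measurable (M.Yapp ℓ)
  payoff : Measurable M.payoff
  X : Measurable (Function.uncurry M.X)
  Xapp : ∀ k, Measurable (Function.uncurry (M.Xapp k))
  DX : ∀ k, Measurable (Function.uncurry (M.DX k))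

/-- `U₁(Y) = E[X(Y) | Y]`, as a random variable on the product of the outer and inner spaces. -/
def U₁ (M : NestedModel d Ω E) (P : Measure Ω) (ν : Measure E) : Ω × E → ℝ :=
  (P.prod ν)[fun z => M.X (M.Y z.1) z.2 | MeasurableSpace.comap (fun z => M.Y z.1) inferInstance]

/-- `U₀ = E[max {U₁(Y), π(Y)}]`. -/
def U₀ (M : NestedModel d Ω E) (P : Measure Ω) (ν : Measure E) : ℝ :=
  ∫ z, max (M.U₁ P ν z) (M.payoff (M.Y z.1)) ∂(P.prod ν)

/-- `E[Δ_k X(Z) | Z] = E[X_k(Z) - X_{k-1}(Z) | Z]` for all `k`, where `X_{-1} = 0`. -/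
def IsCorrectionAt (M : NestedModel d Ω E) (P : Measure Ω) (ν : Measure E)
    (Z : Ω → EuclideanSpace ℝ (Fin d)) : Prop :=
  ∀ k : ℕ,
    (P.prod ν)[fun z => M.DX k (Z z.1) z.2 |
        MeasurableSpace.comap (fun z => Z z.1) inferInstance]
      =ᵐ[P.prod ν]
    (P.prod ν)[fun z => M.Xapp k (Z z.1) z.2 - if k = 0 then 0 else M.Xapp (k - 1) (Z z.1) z.2 |
        MeasurableSpace.comap (fun z => Z z.1) inferInstance]

/-- Moment and density condition: `X` and `π(Y)` have finite `q`-th moments, and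
`P(|U₁(Y) - π(Y)| < x)` grows at most linearly near `x = 0`. -/
def MomentDensity (M : NestedModel d Ω E) (P : Measure Ω) (ν : Measure E) (q : ℝ) : Prop :=
  absMoment (P.prod ν) (fun z => M.X (M.Y z.1) z.2) q
      + absMoment P (fun ω => M.payoff (M.Y ω)) q < ∞ ∧
  ∃ δ > (0 : ℝ), ∃ ρ > (0 : ℝ), ∀ x < δ,
    (P.prod ν) {z | |M.U₁ P ν z - M.payoff (M.Y z.1)| < x} ≤ ENNReal.ofReal (ρ * x)

/-- Inner approximation rates at the outer point `Z`:
`E|X_k(Z) - X(Z)|^q ≤ a₁ k^{λ_q} 2^{-qk/2}` and, for `0 < p ≤ q`,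
`E|Δ_k X(Z)|^p ≤ a₂ k^{λ_p} 2^{-β_p p k/2}`.  The logarithmic factor is read as `max(k, 1)^λ`, so
that it does not vanish at `k = 0`. -/
def InnerRatesAt (M : NestedModel d Ω E) (P : Measure Ω) (ν : Measure E) (q : ℝ) (β lam : ℝ → ℝ)
    (a₁ : ℝ) (a₂ : ℝ → ℝ) (Z : Ω → EuclideanSpace ℝ (Fin d)) : Prop :=
  ∀ k : ℕ,
    absMoment (P.prod ν) (fun z => M.Xapp k (Z z.1) z.2 - M.X (Z z.1) z.2) q
        ≤ ENNReal.ofReal (a₁ * (max k 1 : ℝ) ^ lam q * 2 ^ (-(q * k / 2))) ∧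
    ∀ p : ℝ, 0 < p → p ≤ q →
      absMoment (P.prod ν) (fun z => M.DX k (Z z.1) z.2) p
        ≤ ENNReal.ofReal (a₂ p * (max k 1 : ℝ) ^ lam p * 2 ^ (-(β p * p * k / 2)))

/-- Inner cost and convergence rates when the exact outer variable `Y` is used. -/
def ExactOuterRates (M : NestedModel d Ω E) (P : Measure Ω) (ν : Measure E) (q : ℝ)
    (β lam : ℝ → ℝ) : Prop :=
  (∀ p : ℝ, 0 < p → p ≤ q → 1 ≤ β p ∧ 0 ≤ lam p) ∧
  ∃ (a₀ a₁ : ℝ) (a₂ : ℝ → ℝ),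
    (∀ k : ℕ, ∀ᵐ ω ∂P, (M.costX k (M.Y ω) : ℝ) ≤ a₀ * 2 ^ k) ∧
    M.InnerRatesAt P ν q β lam a₁ a₂ M.Y

/-- Inner cost and convergence rates when the approximations `Y_ℓ` are used, uniformly in `ℓ`. -/
def ApproxOuterRates (M : NestedModel d Ω E) (P : Measure Ω) (ν : Measure E) (q : ℝ)
    (β lam : ℝ → ℝ) : Prop :=
  (∀ p : ℝ, 0 < p → p ≤ q → 1 ≤ β p ∧ 0 ≤ lam p) ∧
  ∃ (a₀ a₁ : ℝ) (a₂ : ℝ → ℝ),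
    (∀ (k : ℕ) (y : EuclideanSpace ℝ (Fin d)), (M.costX k y : ℝ) ≤ a₀ * 2 ^ k) ∧
    ∀ ℓ : ℕ, M.InnerRatesAt P ν q β lam a₁ a₂ (M.Yapp ℓ)

/-- Cost and convergence of the approximations `Y_ℓ` of `Y`, with rates `β̂_p = βh p`. -/
def OuterRates (M : NestedModel d Ω E) (P : Measure Ω) (ν : Measure E) (q : ℝ)
    (βh : ℝ → ℝ) : Prop :=
  (∃ a₀ : ℝ, ∀ ℓ : ℕ, (M.costY ℓ : ℝ) ≤ a₀ * 2 ^ ℓ) ∧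
  ∀ p : ℝ, 0 < p → p ≤ q → 1 ≤ βh p ∧ ∃ a₃ a₄ a₅ : ℝ,
    (∀ ℓ : ℕ, absMoment P (fun ω => M.payoff (M.Y ω) - M.payoff (M.Yapp ℓ ω)) p
        ≤ ENNReal.ofReal (a₃ * 2 ^ (-(βh p * p * ℓ / 2)))) ∧
    (∀ ℓ k : ℕ, absMoment (P.prod ν)
          (fun z => M.Xapp k (M.Y z.1) z.2 - M.Xapp k (M.Yapp ℓ z.1) z.2) p
        ≤ ENNReal.ofReal (a₄ * 2 ^ (-(βh p * p * ℓ / 2)))) ∧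
    (∀ ℓ k : ℕ, 1 ≤ ℓ → absMoment (P.prod ν)
          (fun z => M.DX k (M.Yapp ℓ z.1) z.2 - M.DX k (M.Yapp (ℓ - 1) z.1) z.2) p
        ≤ ENNReal.ofReal (a₅ * 2 ^ (-(βh p * p * ℓ / 2))))

/-- One scenario: an outer outcome and an array of inner noises `(j, k, n)`.  The streams `j = 0, 1`
feed the two coarse inner estimators, the stream `j = 2` the additional top level of the fine one;
`k` is the inner level and `n` the number of the sample. -/
abbrev Scenario (Ω E : Type*) : Type _ := Ω × (Fin 3 × ℕ × ℕ → E)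

/-- In a scenario the outer outcome and all inner noises are independent. -/
def scenarioMeasure (P : Measure Ω) (ν : Measure E) [IsProbabilityMeasure ν] :
    Measure (Scenario Ω E) :=
  P.prod (Measure.infinitePi fun _ => ν)

instance (P : Measure Ω) (ν : Measure E) [IsProbabilityMeasure P] [IsProbabilityMeasure ν] :
    IsProbabilityMeasure (scenarioMeasure P ν) := by
  unfold scenarioMeasure
  infer_instance

/-- The average of the `N ℓ k` samples of `Δ_k X(y)` from stream `j`. -/
def levelMean (M : NestedModel d Ω E) (N : ℕ → ℕ → ℕ) (ℓ k : ℕ) (j : Fin 3)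
    (y : EuclideanSpace ℝ (Fin d)) (w : Fin 3 × ℕ × ℕ → E) : ℝ :=
  (N ℓ k : ℝ)⁻¹ * ∑ n ∈ Finset.range (N ℓ k), M.DX k y (w (j, k, n))

/-- The inner multilevel estimator of `U₁(y)` at level `ℓ`,
`∑_{k ≤ ℓ} (N ℓ k)⁻¹ ∑_{n ≤ N ℓ k} Δ_k X^{(j,n)}(y)`. -/
def innerML (M : NestedModel d Ω E) (N : ℕ → ℕ → ℕ) (ℓ : ℕ) (j : Fin 3)
    (y : EuclideanSpace ℝ (Fin d)) (w : Fin 3 × ℕ × ℕ → E) : ℝ :=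
  ∑ k ∈ Finset.range (ℓ + 1), M.levelMean N ℓ k j y w

/-- The fine inner estimator at level `ℓ`: the mean of the two coarse estimators, which are
conditionally independent inner multilevel estimators of level `ℓ - 1`, plus the mean of
`N ℓ ℓ` samples of `Δ_ℓ X(y)`. -/
def fineML (M : NestedModel d Ω E) (N : ℕ → ℕ → ℕ) :
    ℕ → EuclideanSpace ℝ (Fin d) → (Fin 3 × ℕ × ℕ → E) → ℝ
  | 0, y, w => M.levelMean N 0 0 2 y w
  | ℓ + 1, y, w =>
      (1 / 2) * (M.innerML N ℓ 0 y w + M.innerML N ℓ 1 y w) + M.levelMean N (ℓ + 1) (ℓ + 1) 2 y w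

/-- The antithetic correction `Δ_ℓ^{ML,Y}(Y_ℓ, Y_{ℓ-1})`. -/
def antitheticCorrection (M : NestedModel d Ω E) (N : ℕ → ℕ → ℕ) : ℕ → Scenario Ω E → ℝ
  | 0, s => max (M.fineML N 0 (M.Yapp 0 s.1) s.2) (M.payoff (M.Yapp 0 s.1))
  | ℓ + 1, s =>
      max (M.fineML N (ℓ + 1) (M.Yapp (ℓ + 1) s.1) s.2) (M.payoff (M.Yapp (ℓ + 1) s.1))
        - (1 / 2) *
          (max (M.innerML N ℓ 0 (M.Yapp ℓ s.1) s.2) (M.payoff (M.Yapp ℓ s.1))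
            + max (M.innerML N ℓ 1 (M.Yapp ℓ s.1) s.2) (M.payoff (M.Yapp ℓ s.1)))

/-- The telescoping identity: the expectation of the fine part of the correction of level `ℓ` equals that of the
coarse part of the correction of level `ℓ + 1`. -/
def TelescopesAt (M : NestedModel d Ω E) (P : Measure Ω) (ν : Measure E) [IsProbabilityMeasure ν]
    (N : ℕ → ℕ → ℕ) (ℓ : ℕ) : Prop :=
  ∫ s, max (M.fineML N ℓ (M.Yapp ℓ s.1) s.2) (M.payoff (M.Yapp ℓ s.1)) ∂(scenarioMeasure P ν)
    = ∫ s, max (M.innerML N ℓ 0 (M.Yapp ℓ s.1) s.2) (M.payoff (M.Yapp ℓ s.1))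
        ∂(scenarioMeasure P ν)

/-- All samples of the multilevel estimator: independent scenarios, one for each `(ℓ, m)`. -/
def samplingMeasure (P : Measure Ω) (ν : Measure E) [IsProbabilityMeasure P]
    [IsProbabilityMeasure ν] : Measure (ℕ × ℕ → Scenario Ω E) :=
  Measure.infinitePi fun _ => scenarioMeasure P ν

/-- The multilevel estimator `∑_{ℓ ≤ L} (M_ℓ)⁻¹ ∑_{m ≤ M_ℓ} Δ_ℓ^{(m)}` with `M_ℓ = m ℓ`. -/
def mlmcEstimator (M : NestedModel d Ω E) (N : ℕ → ℕ → ℕ) (L : ℕ) (m : ℕ → ℕ)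
    (S : ℕ × ℕ → Scenario Ω E) : ℝ :=
  ∑ ℓ ∈ Finset.range (L + 1),
    (m ℓ : ℝ)⁻¹ * ∑ i ∈ Finset.range (m ℓ), M.antitheticCorrection N ℓ (S (ℓ, i))

/-- Cost of one inner multilevel estimator of level `ℓ` at `y`; a sample of `Δ_k X(y)` is charged
with the cost of `X_k(y)`. -/
def innerCost (M : NestedModel d Ω E) (N : ℕ → ℕ → ℕ) (ℓ : ℕ)
    (y : EuclideanSpace ℝ (Fin d)) : ℝ :=
  ∑ k ∈ Finset.range (ℓ + 1), (N ℓ k : ℝ) * M.costX k y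

/-- Cost of one sample of the antithetic correction of level `ℓ`: the two outer samples, the samples
of the fine estimator at `Y_ℓ` and those of the two coarse estimators at `Y_{ℓ-1}`. -/
def correctionCost (M : NestedModel d Ω E) (N : ℕ → ℕ → ℕ) : ℕ → Ω → ℝ
  | 0, ω => M.costY 0 + (N 0 0 : ℝ) * M.costX 0 (M.Yapp 0 ω)
  | ℓ + 1, ω =>
      M.costY (ℓ + 1) + M.costY ℓ
        + (2 * M.innerCost N ℓ (M.Yapp (ℓ + 1) ω)
            + (N (ℓ + 1) (ℓ + 1) : ℝ) * M.costX (ℓ + 1) (M.Yapp (ℓ + 1) ω))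
        + 2 * M.innerCost N ℓ (M.Yapp ℓ ω)

/-- Total cost of the multilevel estimator. -/
def mlmcCost (M : NestedModel d Ω E) (N : ℕ → ℕ → ℕ) (L : ℕ) (m : ℕ → ℕ)
    (S : ℕ × ℕ → Scenario Ω E) : ℝ :=
  ∑ ℓ ∈ Finset.range (L + 1), ∑ i ∈ Finset.range (m ℓ), M.correctionCost N ℓ (S (ℓ, i)).1

/-- Root mean square error of the multilevel estimator of `U₀`. -/
def mlmcRMSE (M : NestedModel d Ω E) (P : Measure Ω) (ν : Measure E) [IsProbabilityMeasure P]
    [IsProbabilityMeasure ν] (N : ℕ → ℕ → ℕ) (L : ℕ) (m : ℕ → ℕ) : ℝ≥0∞ :=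
  eLpNorm (fun S => M.mlmcEstimator N L m S - M.U₀ P ν) 2 (samplingMeasure P ν)

end NestedModel

end

/-!
The multilevel estimator is a telescoping sum, so its error splits into bias and variance, and both
are controlled by the `L^2` norms of the corrections `Δ_ℓ`.  The inner multilevel estimator at level
`ℓ` has root mean square error of order `2 ^ (-ℓ / 2)` at a cost of order `2 ^ ℓ`, both up to powers
of `ℓ`, hence the complexity `ε ^ (-2)` results if `‖Δ_ℓ‖₂` decays strictly faster than
`2 ^ (-ℓ / 2)`, while decay like `2 ^ (-ℓ / 2)` costs powers of `|log ε|`.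

A correction is the sum of three parts
(`NestedModel.GeometricRates.exists_eLpNorm_antitheticCorrection_le`).
* The additional top level of the fine estimator contributes `2 ^ (-β₂ ℓ / 2)`.
* The antithetic combination at the fixed outer variable `Y_ℓ` vanishes unless the two coarse
  estimators lie on opposite sides of the payoff.  In that event the exact margin `U₁(Y) - π(Y)` is
  at most as large as the errors of the two estimators.  If these are at most `s` in `L^r`, the
  density of the margin at zero gives the second moment `s ^ (3r/(r+1))`
  (`lintegral_antithetic_sq_le`), and `3r/(r+1) > 2` because `r > 2`.  Here `r = min q 3`, so that
  the `L^r` error of sample means can be bounded by an elementary Marcinkiewicz–Zygmund inequality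
  (`integral_abs_sum_rpow_le`), and `s` is of order `2 ^ (-(1/2 - τ) ℓ)` for every `τ > 0`, by the
  choice of the inner sample sizes; the loss `τ` absorbs the logarithmic factors in the `L^q` rates.
* Replacing `Y_ℓ` by `Y_(ℓ-1)` contributes `2 ^ (-β̂₂ ℓ / 2) √(1 + ∑ₖ 1 / N_(ℓ,k))`: the conditional
  means are compared through `X_ℓ` as a whole, and the independent fluctuations of the inner levels
  add up in square (`NestedModel.GeometricRates.eLpNorm_innerML_shift_le`).

The square root is bounded for `ζ = 1`, when the cost carries a factor `ℓ + 1`; for `ζ > 1` it is at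
most of order `√(ℓ + 1)` and the cost is of order `2 ^ ℓ` (`NestedModel.exists_work_factors`).  In
both cases the product of variance and cost on level `ℓ` is of order at most `ℓ + 1`, and it decays
geometrically if `β₂ > 1` and `β̂₂ > 1`.  The levels and sample sizes are chosen accordingly
(`exists_levels_of_geometric`, `exists_levels_of_linear`).

The bias is the sum of the means of the omitted corrections: by the telescoping property the partial
sums of the means are the expectations of the maximum of inner estimator and payoff, which converge
to `U₀` (`NestedModel.GeometricRates.abs_bias_le`).
-/

open ProbabilityTheory

/-! ### Sums of independent random variables -/

/-- Second-order expansion of `|x| ^ r` for `2 < r ≤ 3`, with a remainder that is the sum of a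
quadratic term and a pure `r`-th power of the increment. -/
lemma abs_add_rpow_le {r : ℝ} (h2 : 2 < r) (h3 : r ≤ 3) (x y : ℝ) :
    |x + y| ^ r ≤ |x| ^ r + r * (x * |x| ^ (r - 2)) * y
      + 11 * (|x| ^ (r - 2) * y ^ 2 + |y| ^ r) := by
  have hr0 : (0 : ℝ) < r := by linarith
  rcases le_or_gt |y| |x| with hyx | hxy
  · rcases eq_or_ne x 0 with rfl | hx
    · have hy : y = 0 := by simpa using hyx
      subst hy
      simp [Real.zero_rpow hr0.ne']
    have hx' : 0 < |x| := abs_pos.2 hx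
    set t := y / x with ht
    have hy : y = x * t := by rw [ht]; field_simp
    have ht1 : |t| ≤ 1 := by rw [ht, abs_div]; exact (div_le_one hx').2 hyx
    obtain ⟨htl, htu⟩ := abs_le.1 ht1
    have h1t : 0 ≤ 1 + t := by linarith
    -- Bernoulli's inequality for the concave power `r - 2`
    have hb : (1 + t) ^ (r - 2) ≤ 1 + (r - 2) * t :=
      rpow_one_add_le_one_add_mul_self htl (by linarith) (by linarith)
    have hkey : (1 + t) ^ r ≤ 1 + r * t + 11 * t ^ 2 := by
      have : (1 + t) ^ r = (1 + t) ^ 2 * (1 + t) ^ (r - 2) := by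
        rw [← Real.rpow_natCast, ← Real.rpow_add' h1t (by norm_num; linarith)]
        congr 1; push_cast; ring
      rw [this]
      calc (1 + t) ^ 2 * (1 + t) ^ (r - 2) ≤ (1 + t) ^ 2 * (1 + (r - 2) * t) := by gcongr
        _ ≤ _ := by
          have : 0 ≤ t ^ 2 * ((r - 2) * (1 - t)) := by
            apply mul_nonneg (sq_nonneg _) (mul_nonneg _ _) <;> linarith
          nlinarith [sq_nonneg t, mul_nonneg (sq_nonneg t) (by linarith : (0 : ℝ) ≤ 3 - r)]
    have hxr : |x| ^ r = |x| ^ (r - 2) * x ^ 2 := by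
      rw [← sq_abs, ← Real.rpow_natCast, ← Real.rpow_add hx']; congr 1; push_cast; ring
    have hl : |x + y| ^ r = |x| ^ r * (1 + t) ^ r := by
      rw [hy, show x + x * t = x * (1 + t) by ring, abs_mul, abs_of_nonneg h1t,
        Real.mul_rpow (abs_nonneg _) h1t]
    rw [hl]
    calc |x| ^ r * (1 + t) ^ r ≤ |x| ^ r * (1 + r * t + 11 * t ^ 2) := by gcongr
      _ = |x| ^ r + r * (x * |x| ^ (r - 2)) * y + 11 * (|x| ^ (r - 2) * y ^ 2) := by
        rw [hxr, hy]; ring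
      _ ≤ _ := by
        have := Real.rpow_nonneg (abs_nonneg y) r
        linarith
  · have hy0 : 0 < |y| := (abs_nonneg x).trans_lt hxy
    have h1 : |x + y| ^ r ≤ 8 * |y| ^ r := by
      calc |x + y| ^ r ≤ (2 * |y|) ^ r := by
            gcongr
            linarith [abs_add_le x y]
        _ = 2 ^ r * |y| ^ r := Real.mul_rpow (by norm_num) hy0.le
        _ ≤ 8 * |y| ^ r := by
            gcongr
            calc (2 : ℝ) ^ r ≤ 2 ^ (3 : ℝ) := Real.rpow_le_rpow_of_exponent_le (by norm_num) h3
              _ = 8 := by norm_num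
    have h2' : -(3 * |y| ^ r) ≤ r * (x * |x| ^ (r - 2)) * y := by
      have : |r * (x * |x| ^ (r - 2)) * y| ≤ 3 * |y| ^ r := by
        rw [abs_mul, abs_mul, abs_mul, abs_of_pos hr0, abs_of_nonneg (Real.rpow_nonneg
          (abs_nonneg x) _)]
        calc r * (|x| * |x| ^ (r - 2)) * |y| ≤ 3 * (|y| * |y| ^ (r - 2)) * |y| := by
              gcongr
          _ = 3 * |y| ^ r := by
              rw [show |y| ^ r = |y| ^ (r - 2) * |y| ^ (2 : ℝ) by
                rw [← Real.rpow_add hy0]; congr 1; ring]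
              rw [Real.rpow_two]; ring
      linarith [neg_le_of_abs_le this]
    have h3' := Real.rpow_nonneg (abs_nonneg x) r
    have h4' : 0 ≤ |x| ^ (r - 2) * y ^ 2 := by positivity
    linarith

/-- Lyapunov's inequality for absolute moments on a probability space. -/
lemma integral_abs_rpow_le_rpow {α : Type*} [MeasurableSpace α] {μ : Measure α}
    [IsProbabilityMeasure μ] {f : α → ℝ} {s t : ℝ} (hs : 0 < s) (hst : s ≤ t)
    (hfs : Integrable (fun x => |f x| ^ s) μ) (hft : Integrable (fun x => |f x| ^ t) μ) :
    ∫ x, |f x| ^ s ∂μ ≤ (∫ x, |f x| ^ t ∂μ) ^ (s / t) := by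
  have ht : 0 < t := hs.trans_le hst
  have hc := Real.concaveOn_rpow (p := s / t) (by positivity) ((div_le_one ht).2 hst)
  have hpow : ∀ x, (|f x| ^ t) ^ (s / t) = |f x| ^ s := fun x => by
    rw [← Real.rpow_mul (abs_nonneg _)]; congr 1; field_simp
  have := hc.le_map_integral (μ := μ) (f := fun x => |f x| ^ t)
    (Real.continuous_rpow_const (by positivity)).continuousOn isClosed_Ici
    (Filter.Eventually.of_forall fun x => by simp; positivity) hft
    (by simpa [Function.comp_def, hpow] using hfs)
  simpa [hpow] using this

lemma integrable_abs_rpow_of_memLp {α : Type*} [MeasurableSpace α] {μ : Measure α}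
    [IsFiniteMeasure μ] {f : α → ℝ} {r s : ℝ} (hs : 0 < s) (hsr : s ≤ r)
    (hf : MemLp f (ENNReal.ofReal r) μ) : Integrable (fun x => |f x| ^ s) μ := by
  have h1 : MemLp f (ENNReal.ofReal s) μ := hf.mono_exponent (ENNReal.ofReal_le_ofReal hsr)
  have := h1.integrable_norm_rpow (by simpa using hs) (by simp)
  simpa [ENNReal.toReal_ofReal hs.le] using this

/-- **Marcinkiewicz–Zygmund inequality** for independent centred random variables and exponents
`2 < r ≤ 3`.  The exponent range makes an induction on the number of summands work, because the
moment of order `r - 2 ≤ 1` of a partial sum is controlled by its variance. -/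
theorem integral_abs_sum_rpow_le {α : Type*} [MeasurableSpace α] {μ : Measure α}
    [IsProbabilityMeasure μ] {r : ℝ} (h2 : 2 < r) (h3 : r ≤ 3) {ξ : ℕ → α → ℝ}
    (hmeas : ∀ i, Measurable (ξ i)) (hind : iIndepFun ξ μ)
    (hξ : ∀ i, MemLp (ξ i) (ENNReal.ofReal r) μ) (h0 : ∀ i, ∫ x, ξ i x ∂μ = 0) {K : ℝ}
    (hK : ∀ i, ∫ x, |ξ i x| ^ r ∂μ ≤ K) (n : ℕ) :
    ∫ x, |∑ i ∈ Finset.range n, ξ i x| ^ r ∂μ ≤ 22 * (n : ℝ) ^ (r / 2) * K := by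
  have hr0 : (0 : ℝ) < r := by linarith
  have hr2 : (0 : ℝ) < r - 2 := by linarith
  have hK0 : 0 ≤ K := (integral_nonneg fun x => by positivity).trans (hK 0)
  have hle : (2 : ℝ≥0∞) ≤ ENNReal.ofReal r := by
    rw [← ENNReal.ofReal_ofNat]; exact ENNReal.ofReal_le_ofReal h2.le
  have hξ2 : ∀ i, MemLp (ξ i) 2 μ := fun i => (hξ i).mono_exponent hle
  have hSr : ∀ n, MemLp (fun x => ∑ i ∈ Finset.range n, ξ i x) (ENNReal.ofReal r) μ :=
    fun n => memLp_finsetSum _ fun i _ => hξ i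
  have hsq : ∀ i, ∫ x, ξ i x ^ 2 ∂μ ≤ K ^ (2 / r) := fun i => by
    have := integral_abs_rpow_le_rpow (μ := μ) (f := ξ i) (s := 2) (t := r) (by norm_num) h2.le
      (integrable_abs_rpow_of_memLp (by norm_num) h2.le (hξ i))
      (integrable_abs_rpow_of_memLp hr0 le_rfl (hξ i))
    simp only [Real.rpow_two, sq_abs] at this
    refine this.trans (Real.rpow_le_rpow (integral_nonneg fun x => by positivity) (hK i) ?_)
    positivity
  have hS2 : ∀ n : ℕ, ∫ x, (∑ i ∈ Finset.range n, ξ i x) ^ 2 ∂μ ≤ n * K ^ (2 / r) := fun n => by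
    have hv := IndepFun.variance_sum (s := Finset.range n) (fun i _ => hξ2 i)
      (fun i _ j _ hij => hind.indepFun hij)
    rw [variance_of_integral_eq_zero] at hv
    · simp only [Finset.sum_apply] at hv
      rw [hv]
      calc ∑ i ∈ Finset.range n, variance (ξ i) μ ≤ ∑ i ∈ Finset.range n, K ^ (2 / r) := by
            refine Finset.sum_le_sum fun i _ => ?_
            rw [variance_of_integral_eq_zero (hξ2 i).aemeasurable (h0 i)]
            exact hsq i
        _ = _ := by simp
    · exact Finset.aemeasurable_sum _ fun i _ => (hmeas i).aemeasurable
    · simp only [Finset.sum_apply]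
      rw [integral_finsetSum _ fun i _ => (hξ2 i).integrable (by norm_num)]
      simp [h0]
  induction n with
  | zero => simp [Real.zero_rpow hr0.ne', Real.zero_rpow (half_pos hr0).ne']
  | succ n ih =>
    set S : α → ℝ := fun x => ∑ i ∈ Finset.range n, ξ i x with hS
    have hSm : Measurable S := by fun_prop
    have hindep : IndepFun S (ξ n) μ := by
      have := hind.indepFun_finsetSum_of_notMem (s := Finset.range n) (i := n) hmeas (by simp)
      convert this using 1
      ext x; simp [hS]
    have hg : Measurable fun x : ℝ => x * |x| ^ (r - 2) := by fun_prop
    have hh : Measurable fun x : ℝ => |x| ^ (r - 2) := by fun_prop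
    have hi1 : Integrable (fun x => S x * |S x| ^ (r - 2)) μ := by
      have := integrable_abs_rpow_of_memLp (s := r - 1) (by linarith) (by linarith) (hSr n)
      refine this.mono' (hg.comp hSm).aestronglyMeasurable (Filter.Eventually.of_forall fun x => ?_)
      rw [Real.norm_eq_abs, abs_mul, abs_of_nonneg (Real.rpow_nonneg (abs_nonneg (S x)) _)]
      rw [show r - 1 = 1 + (r - 2) by ring, Real.rpow_add' (abs_nonneg _) (by linarith),
        Real.rpow_one]
    have hi2 : Integrable (fun x => |S x| ^ (r - 2)) μ :=
      integrable_abs_rpow_of_memLp hr2 (by linarith) (hSr n)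
    have hξ1 : Integrable (ξ n) μ := (hξ2 n).integrable (by norm_num)
    have hξsq : Integrable (fun x => ξ n x ^ 2) μ := (hξ2 n).integrable_sq
    have hind1 : IndepFun (fun x => S x * |S x| ^ (r - 2)) (ξ n) μ :=
      hindep.comp hg measurable_id
    have hind2 : IndepFun (fun x => |S x| ^ (r - 2)) (fun x => ξ n x ^ 2) μ :=
      hindep.comp hh (measurable_id.pow_const 2)
    have hp1 : Integrable (fun x => S x * |S x| ^ (r - 2) * ξ n x) μ :=
      hind1.integrable_mul hi1 hξ1
    have hp2 : Integrable (fun x => |S x| ^ (r - 2) * ξ n x ^ 2) μ :=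
      hind2.integrable_mul hi2 hξsq
    -- the term of first order vanishes by independence and centring
    have he1 : ∫ x, S x * |S x| ^ (r - 2) * ξ n x ∂μ = 0 := by
      have := hind1.integral_mul_eq_mul_integral hi1.1 hξ1.1
      simpa [h0] using this
    have he2 : ∫ x, |S x| ^ (r - 2) * ξ n x ^ 2 ∂μ ≤ (n : ℝ) ^ ((r - 2) / 2) * K := by
      have h := hind2.integral_mul_eq_mul_integral hi2.1 hξsq.1
      have h' : ∫ x, |S x| ^ (r - 2) * ξ n x ^ 2 ∂μ
          = (∫ x, |S x| ^ (r - 2) ∂μ) * ∫ x, ξ n x ^ 2 ∂μ := by simpa using h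
      rw [h']
      have hL := integral_abs_rpow_le_rpow (μ := μ) (f := S) (s := r - 2) (t := 2) hr2
        (by linarith) hi2 (integrable_abs_rpow_of_memLp (by norm_num) h2.le (hSr n))
      simp only [Real.rpow_two, sq_abs] at hL
      calc (∫ x, |S x| ^ (r - 2) ∂μ) * ∫ x, ξ n x ^ 2 ∂μ
          ≤ ((n * K ^ (2 / r)) ^ ((r - 2) / 2)) * K ^ (2 / r) := by
            refine mul_le_mul (hL.trans ?_) (hsq n) (integral_nonneg fun x => by positivity)
              (by positivity)
            exact Real.rpow_le_rpow (integral_nonneg fun x => by positivity) (hS2 n)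
              (by positivity)
        _ = (n : ℝ) ^ ((r - 2) / 2) * K := by
            rw [Real.mul_rpow (by positivity) (by positivity), ← Real.rpow_mul hK0, mul_assoc,
              ← Real.rpow_add' hK0]
            · congr 1
              rw [show 2 / r * ((r - 2) / 2) + 2 / r = 1 by field_simp; ring, Real.rpow_one]
            · rw [show 2 / r * ((r - 2) / 2) + 2 / r = 1 by field_simp; ring]; norm_num
    have hiSr : Integrable (fun x => |S x| ^ r) μ := integrable_abs_rpow_of_memLp hr0 le_rfl (hSr n)
    have hiξr : Integrable (fun x => |ξ n x| ^ r) μ :=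
      integrable_abs_rpow_of_memLp hr0 le_rfl (hξ n)
    have hsum1 : Integrable (fun x => |S x| ^ r + r * (S x * |S x| ^ (r - 2) * ξ n x)) μ :=
      hiSr.add (hp1.const_mul r)
    have hsum2 : Integrable (fun x => |S x| ^ (r - 2) * ξ n x ^ 2 + |ξ n x| ^ r) μ :=
      hp2.add hiξr
    have hstep : ∫ x, |∑ i ∈ Finset.range (n + 1), ξ i x| ^ r ∂μ
        ≤ ∫ x, |S x| ^ r ∂μ + 11 * ((n : ℝ) ^ ((r - 2) / 2) * K + K) := by
      calc ∫ x, |∑ i ∈ Finset.range (n + 1), ξ i x| ^ r ∂μ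
          ≤ ∫ x, (|S x| ^ r + r * (S x * |S x| ^ (r - 2) * ξ n x)
              + 11 * (|S x| ^ (r - 2) * ξ n x ^ 2 + |ξ n x| ^ r)) ∂μ := by
            refine integral_mono (integrable_abs_rpow_of_memLp hr0 le_rfl (hSr (n + 1)))
              (hsum1.add (hsum2.const_mul 11)) fun x => ?_
            simp only [Finset.sum_range_succ]
            have := abs_add_rpow_le h2 h3 (S x) (ξ n x)
            simpa only [mul_assoc] using this
        _ = ∫ x, |S x| ^ r ∂μ + r * ∫ x, S x * |S x| ^ (r - 2) * ξ n x ∂μ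
              + 11 * (∫ x, |S x| ^ (r - 2) * ξ n x ^ 2 ∂μ + ∫ x, |ξ n x| ^ r ∂μ) := by
            rw [integral_add hsum1 (hsum2.const_mul 11), integral_add hiSr (hp1.const_mul r),
              integral_const_mul, integral_const_mul, integral_add hp2 hiξr]
        _ ≤ _ := by
            rw [he1]
            have := hK n
            linarith
    refine hstep.trans ?_
    -- what remains is `22 * n ^ (r / 2) + 11 * n ^ (r / 2 - 1) + 11 ≤ 22 * (n + 1) ^ (r / 2)`
    have hpow : ∀ m : ℕ, (m : ℝ) ^ (r / 2) = m * (m : ℝ) ^ ((r - 2) / 2) := fun m => by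
      conv_rhs => rw [← Real.rpow_one (m : ℝ)]
      rw [Real.rpow_one, ← Real.rpow_one_add' (by positivity) (by linarith)]
      congr 1; ring
    have hm1 : (n : ℝ) ^ ((r - 2) / 2) ≤ ((n + 1 : ℕ) : ℝ) ^ ((r - 2) / 2) :=
      Real.rpow_le_rpow (by positivity) (by simp) (by linarith)
    have hm2 : 1 ≤ ((n + 1 : ℕ) : ℝ) ^ ((r - 2) / 2) :=
      Real.one_le_rpow (by simp) (by linarith)
    rw [hpow] at ih ⊢
    have hA : 0 ≤ (n : ℝ) * ((((n + 1 : ℕ) : ℝ) ^ ((r - 2) / 2)) - (n : ℝ) ^ ((r - 2) / 2)) * K :=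
      mul_nonneg (mul_nonneg (by positivity) (by linarith)) hK0
    have hB : 0 ≤ (((n + 1 : ℕ) : ℝ) ^ ((r - 2) / 2) - (n : ℝ) ^ ((r - 2) / 2)) * K :=
      mul_nonneg (by linarith) hK0
    have hC : 0 ≤ (((n + 1 : ℕ) : ℝ) ^ ((r - 2) / 2) - 1) * K :=
      mul_nonneg (by linarith) hK0
    have e : ((n + 1 : ℕ) : ℝ) = n + 1 := by push_cast; ring
    generalize ((n + 1 : ℕ) : ℝ) ^ ((r - 2) / 2) = u at *
    generalize (n : ℝ) ^ ((r - 2) / 2) = v at *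
    rw [e]
    nlinarith

/-! ### Product measures and sample means -/

lemma eLpNorm_ofReal_rpow {α : Type*} [MeasurableSpace α] {μ : Measure α} {f : α → ℝ} {r : ℝ}
    (hr : 0 < r) : eLpNorm f (ENNReal.ofReal r) μ ^ r = ∫⁻ x, ‖f x‖ₑ ^ r ∂μ := by
  have h := eLpNorm_nnreal_pow_eq_lintegral (f := f) (μ := μ) (p := r.toNNReal)
    (by simpa using hr)
  rw [Real.coe_toNNReal r hr.le] at h
  exact h

lemma eLpNorm_two_sq {α : Type*} [MeasurableSpace α] {μ : Measure α} {f : α → ℝ} :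
    eLpNorm f 2 μ ^ 2 = ∫⁻ x, ‖f x‖ₑ ^ 2 ∂μ := by
  have h := eLpNorm_ofReal_rpow (f := f) (μ := μ) (r := 2) (by norm_num)
  simpa using h

lemma eLpNorm_ofReal_eq {α : Type*} [MeasurableSpace α] {μ : Measure α} {f : α → ℝ} {r : ℝ}
    (hr : 0 < r) (hf : MemLp f (ENNReal.ofReal r) μ) :
    eLpNorm f (ENNReal.ofReal r) μ = ENNReal.ofReal ((∫ x, |f x| ^ r ∂μ) ^ r⁻¹) := by
  rw [hf.eLpNorm_eq_integral_rpow_norm (by simpa using hr) (by simp),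
    ENNReal.toReal_ofReal hr.le]
  rfl

lemma integral_comp_of_measurePreserving {α β : Type*} [MeasurableSpace α] [MeasurableSpace β]
    {μ : Measure α} {ν : Measure β} {g : α → β} (hg : MeasurePreserving g μ ν) {u : β → ℝ}
    (hu : Measurable u) : ∫ x, u (g x) ∂μ = ∫ y, u y ∂ν := by
  rw [← hg.map_eq, integral_map hg.measurable.aemeasurable hu.aestronglyMeasurable]

/-- A comparison of conditional `L^p` norms, given the first coordinate, integrates to a comparison
of `L^p` norms on the product. -/
lemma eLpNorm_prod_le_of_ae {Ω A B : Type*} [MeasurableSpace Ω] [MeasurableSpace A]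
    [MeasurableSpace B] {P : Measure Ω} {μ : Measure A} {ν : Measure B} [SFinite μ] [SFinite ν]
    {r : ℝ} (hr : 0 < r) {F : Ω × A → ℝ} {H : Ω × B → ℝ}
    (hF : Measurable F) (hH : Measurable H) {c : ℝ≥0∞}
    (h : ∀ᵐ ω ∂P, eLpNorm (fun x => F (ω, x)) (ENNReal.ofReal r) μ
      ≤ c * eLpNorm (fun x => H (ω, x)) (ENNReal.ofReal r) ν) :
    eLpNorm F (ENNReal.ofReal r) (P.prod μ) ≤ c * eLpNorm H (ENNReal.ofReal r) (P.prod ν) := by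
  have key : eLpNorm F (ENNReal.ofReal r) (P.prod μ) ^ r
      ≤ (c * eLpNorm H (ENNReal.ofReal r) (P.prod ν)) ^ r := by
    rw [ENNReal.mul_rpow_of_nonneg _ _ hr.le, eLpNorm_ofReal_rpow hr, eLpNorm_ofReal_rpow hr,
      lintegral_prod _ (by fun_prop), lintegral_prod _ (by fun_prop),
      ← lintegral_const_mul _ (by fun_prop)]
    refine lintegral_mono_ae (h.mono fun ω hω => ?_)
    rw [← eLpNorm_ofReal_rpow hr, ← eLpNorm_ofReal_rpow hr, ← ENNReal.mul_rpow_of_nonneg _ _ hr.le]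
    exact ENNReal.rpow_le_rpow hω hr.le
  exact (ENNReal.rpow_le_rpow_iff hr).1 key

/-- The mean is bounded by every `L^p` norm, `p ≥ 1`, on a probability space. -/
lemma enorm_integral_le_eLpNorm {α : Type*} [MeasurableSpace α] {μ : Measure α}
    [IsProbabilityMeasure μ] {f : α → ℝ} (hf : Measurable f) {p : ℝ≥0∞} (hp : 1 ≤ p) :
    ‖∫ x, f x ∂μ‖ₑ ≤ eLpNorm f p μ := by
  refine (enorm_integral_le_lintegral_enorm _).trans ?_
  rw [← eLpNorm_one_eq_lintegral_enorm]
  exact eLpNorm_le_eLpNorm_of_exponent_le hp hf.aestronglyMeasurable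

/-- Averaging over the second coordinate contracts `L^p` norms. -/
lemma eLpNorm_integral_right_le {Ω A : Type*} [MeasurableSpace Ω] [MeasurableSpace A]
    {P : Measure Ω} {ν : Measure A} [IsProbabilityMeasure ν] {r : ℝ} (hr : 1 ≤ r)
    {H : Ω × A → ℝ} (hH : Measurable H) :
    eLpNorm (fun ω => ∫ x, H (ω, x) ∂ν) (ENNReal.ofReal r) P
      ≤ eLpNorm H (ENNReal.ofReal r) (P.prod ν) := by
  have hm : Measurable fun ω => ∫ x, H (ω, x) ∂ν :=
    hH.stronglyMeasurable.integral_prod_right'.measurable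
  have h := eLpNorm_prod_le_of_ae (P := P) (μ := (Measure.dirac () : Measure Unit)) (ν := ν)
    (r := r) (by linarith) (F := fun z => ∫ x, H (z.1, x) ∂ν) (H := H) (c := 1)
    (hm.comp measurable_fst) hH (Filter.Eventually.of_forall fun ω => by
      have hp : (1 : ℝ≥0∞) ≤ ENNReal.ofReal r := by simpa using hr
      rw [one_mul,
        show (fun x : Unit => ∫ a, H ((ω, x).1, a) ∂ν) = fun _ => ∫ a, H (ω, a) ∂ν from rfl,
        eLpNorm_const _ (by simp; linarith) (by simp)]
      simpa using enorm_integral_le_eLpNorm (μ := ν) (f := fun x => H (ω, x)) (by fun_prop) hp)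
  rw [one_mul] at h
  refine le_trans (le_of_eq ?_) h
  have hmp := measurePreserving_fst (μ := P) (ν := (Measure.dirac () : Measure Unit))
  exact (eLpNorm_comp_measurePreserving hm.aestronglyMeasurable hmp).symm

/-- Under a product measure with equal factors, the variance of a sum of functions of distinct
coordinates is the sum of the variances. -/
lemma variance_sum_infinitePi {κ ι E : Type*} [MeasurableSpace E] {ν : Measure E}
    [IsProbabilityMeasure ν] {idx : κ → ι} (hidx : Function.Injective idx) {f : κ → E → ℝ}
    (hf : ∀ i, Measurable (f i)) (s : Finset κ) (hf2 : ∀ i ∈ s, MemLp (f i) 2 ν) :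
    Var[fun w => ∑ i ∈ s, f i (w (idx i)); Measure.infinitePi fun _ : ι => ν]
      = ∑ i ∈ s, Var[f i; ν] := by
  have hmp : ∀ i : κ, MeasurePreserving (fun w : ι → E => w (idx i))
    (Measure.infinitePi fun _ : ι => ν) ν := fun i => measurePreserving_eval_infinitePi _ (idx i)
  have hind : iIndepFun (fun (i : κ) (w : ι → E) => f i (w (idx i)))
      (Measure.infinitePi fun _ : ι => ν) := by
    have h : iIndepFun (fun (i : ι) (w : ι → E) => w i) (Measure.infinitePi fun _ : ι => ν) :=
      iIndepFun_infinitePi (X := fun _ x => x) fun _ => measurable_id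
    exact (h.precomp hidx).comp f hf
  have hv := IndepFun.variance_sum (s := s) (μ := Measure.infinitePi fun _ : ι => ν)
    (X := fun i w => f i (w (idx i)))
    (fun i hi => (hf2 i hi).comp_measurePreserving (hmp i))
    (fun i _ j _ hij => hind.indepFun hij)
  have e : (∑ i ∈ s, fun w : ι → E => f i (w (idx i))) = fun w => ∑ i ∈ s, f i (w (idx i)) := by
    ext w; simp
  rw [e] at hv
  rw [hv]
  exact Finset.sum_congr rfl fun i _ => (hmp i).variance_fun_comp (hf i).aemeasurable

/-- Mean square error of a sum over `k < m` of sample means of functions `h k`, computed from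
independent noises: the variances of the sample means add up. -/
lemma lintegral_sum_sampleMean_sq_le {ι E : Type*} [MeasurableSpace E] {ν : Measure E}
    [IsProbabilityMeasure ν] {idx : ℕ × ℕ → ι} (hidx : Function.Injective idx) {h : ℕ → E → ℝ}
    (hh : ∀ k, Measurable (h k)) {N : ℕ → ℕ} (m : ℕ) (hN : ∀ k < m, 0 < N k) :
    ∫⁻ w, ‖∑ k ∈ Finset.range m, ((N k : ℝ)⁻¹ * ∑ n ∈ Finset.range (N k), h k (w (idx (k, n)))
        - ∫ e, h k e ∂ν)‖ₑ ^ 2 ∂(Measure.infinitePi fun _ : ι => ν)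
      ≤ ∑ k ∈ Finset.range m, ENNReal.ofReal (N k : ℝ)⁻¹ * ∫⁻ e, ‖h k e‖ₑ ^ 2 ∂ν := by
  -- if some `h k` is not square integrable, the right-hand side is infinite
  by_cases hL : ∀ k < m, MemLp (h k) 2 ν
  swap
  · push Not at hL
    obtain ⟨k, hk, hkL⟩ := hL
    have htop : ∫⁻ e, ‖h k e‖ₑ ^ 2 ∂ν = ∞ := by
      rw [← eLpNorm_two_sq]
      have : eLpNorm (h k) 2 ν = ∞ := by
        by_contra hne
        exact hkL ⟨(hh k).aestronglyMeasurable, lt_top_iff_ne_top.2 hne⟩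
      simp [this]
    have hNk := hN k hk
    have : ENNReal.ofReal (N k : ℝ)⁻¹ * ∫⁻ e, ‖h k e‖ₑ ^ 2 ∂ν = ∞ := by
      rw [htop, ENNReal.mul_top]; simp; positivity
    rw [ENNReal.sum_eq_top.2 ⟨k, Finset.mem_range.2 hk, this⟩]
    exact le_top
  set μ := Measure.infinitePi fun _ : ι => ν with hμ
  -- the double sum is a single sum over pairs `(k, n)`, hence over distinct coordinates
  let s : Finset (Σ _ : ℕ, ℕ) := (Finset.range m).sigma fun k => Finset.range (N k)
  let f : (Σ _ : ℕ, ℕ) → E → ℝ := fun i e => (N i.1 : ℝ)⁻¹ * h i.1 e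
  have hidx' : Function.Injective fun i : (Σ _ : ℕ, ℕ) => idx (i.1, i.2) := by
    rintro ⟨a, b⟩ ⟨c, d⟩ hab
    have := hidx hab
    simp_all
  have hf : ∀ i, Measurable (f i) := fun i => (hh i.1).const_mul _
  have hmp : ∀ i : ι, MeasurePreserving (fun w : ι → E => w i) μ ν :=
    fun i => measurePreserving_eval_infinitePi _ i
  have hf2 : ∀ i ∈ s, MemLp (f i) 2 ν := fun i hi =>
    (hL i.1 (by simpa using (Finset.mem_sigma.1 hi).1)).const_mul _
  have hfw : ∀ i ∈ s, MemLp (fun w : ι → E => f i (w (idx (i.1, i.2)))) 2 μ := fun i hi =>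
    (hf2 i hi).comp_measurePreserving (hmp _)
  have hvar := variance_sum_infinitePi (ν := ν) hidx' hf s hf2
  have hmean : ∫ w, ∑ i ∈ s, f i (w (idx (i.1, i.2))) ∂μ
      = ∑ k ∈ Finset.range m, ∫ e, h k e ∂ν := by
    rw [integral_finsetSum _ fun i hi => (hfw i hi).integrable (by norm_num)]
    have : ∀ i ∈ s, ∫ w, f i (w (idx (i.1, i.2))) ∂μ = (N i.1 : ℝ)⁻¹ * ∫ e, h i.1 e ∂ν := by
      intro i _
      rw [← integral_const_mul]
      exact integral_comp_of_measurePreserving (hmp _) (hf i)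
    rw [Finset.sum_congr rfl this, Finset.sum_sigma]
    refine Finset.sum_congr rfl fun k hk => ?_
    have hNk : (N k : ℝ) ≠ 0 := by
      have := hN k (Finset.mem_range.1 hk)
      positivity
    simp [mul_inv_cancel_left₀ hNk]
  have hsum : ∀ w : ι → E, ∑ k ∈ Finset.range m, ((N k : ℝ)⁻¹ *
      ∑ n ∈ Finset.range (N k), h k (w (idx (k, n))) - ∫ e, h k e ∂ν)
      = ∑ i ∈ s, f i (w (idx (i.1, i.2))) - ∫ w, ∑ i ∈ s, f i (w (idx (i.1, i.2))) ∂μ := by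
    intro w
    rw [hmean, Finset.sum_sub_distrib, Finset.sum_sigma]
    simp only [Finset.mul_sum, f]
  have hX2 : MemLp (fun w : ι → E => ∑ i ∈ s, f i (w (idx (i.1, i.2)))) 2 μ :=
    memLp_finsetSum _ hfw
  simp only [hsum]
  have := ofReal_variance hX2
  rw [evariance] at this
  rw [← this, hvar, Finset.sum_sigma]
  rw [ENNReal.ofReal_sum_of_nonneg fun k _ => Finset.sum_nonneg fun n _ => variance_nonneg _ _]
  refine Finset.sum_le_sum fun k hk => ?_
  have hk' := Finset.mem_range.1 hk
  have hNk : (N k : ℝ) ≠ 0 := by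
    have := hN k hk'
    positivity
  have e1 : ∑ n ∈ Finset.range (N k), Var[f ⟨k, n⟩; ν] = (N k : ℝ)⁻¹ * Var[h k; ν] := by
    simp only [f, variance_const_mul, Finset.sum_const, Finset.card_range, nsmul_eq_mul]
    field_simp
  rw [e1, ENNReal.ofReal_mul (by positivity)]
  gcongr
  have hint : Integrable (fun e => h k e ^ 2) ν := (hL k hk').integrable_sq
  calc ENNReal.ofReal Var[h k; ν] ≤ ENNReal.ofReal (∫ e, h k e ^ 2 ∂ν) := by
        refine ENNReal.ofReal_le_ofReal ?_
        simpa using variance_le_expectation_sq (hh k).aestronglyMeasurable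
    _ = ∫⁻ e, ‖h k e‖ₑ ^ 2 ∂ν := by
        rw [ofReal_integral_eq_lintegral_ofReal hint
          (Filter.Eventually.of_forall fun e => sq_nonneg _)]
        refine lintegral_congr fun e => ?_
        rw [← sq_abs, ENNReal.ofReal_pow (abs_nonneg _), Real.enorm_eq_ofReal_abs]

/-- `L^r` error of a sample mean of independent copies, `2 < r ≤ 3`. -/
lemma eLpNorm_sampleMean_sub_le {ι E : Type*} [MeasurableSpace E] {ν : Measure E}
    [IsProbabilityMeasure ν] {r : ℝ} (h2 : 2 < r) (h3 : r ≤ 3) {idx : ℕ → ι}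
    (hidx : Function.Injective idx) {h : E → ℝ} (hh : Measurable h) {N : ℕ} (hN : 0 < N) :
    eLpNorm (fun w : ι → E => (N : ℝ)⁻¹ * ∑ n ∈ Finset.range N, h (w (idx n)) - ∫ e, h e ∂ν)
        (ENNReal.ofReal r) (Measure.infinitePi fun _ : ι => ν)
      ≤ ENNReal.ofReal (44 * (N : ℝ) ^ (-(1 / 2) : ℝ)) * eLpNorm h (ENNReal.ofReal r) ν := by
  have hr0 : 0 < r := by linarith
  have hNpos : (0 : ℝ) < N := by positivity
  -- otherwise the right-hand side is infinite
  by_cases hL : MemLp h (ENNReal.ofReal r) ν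
  swap
  · have : eLpNorm h (ENNReal.ofReal r) ν = ∞ := by
      by_contra hne
      exact hL ⟨hh.aestronglyMeasurable, lt_top_iff_ne_top.2 hne⟩
    rw [this, ENNReal.mul_top]
    · exact le_top
    · simp; positivity
  set μ := Measure.infinitePi fun _ : ι => ν with hμ
  have hr1 : (1 : ℝ≥0∞) ≤ ENNReal.ofReal r := by simp; linarith
  set g : E → ℝ := fun e => h e - ∫ e, h e ∂ν with hg
  have hgm : Measurable g := by fun_prop
  have hgL : MemLp g (ENNReal.ofReal r) ν := hL.sub (memLp_const _)
  have hmp : ∀ n : ℕ, MeasurePreserving (fun w : ι → E => w (idx n)) μ ν :=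
    fun n => measurePreserving_eval_infinitePi _ (idx n)
  have hind : iIndepFun (fun (n : ℕ) (w : ι → E) => g (w (idx n))) μ := by
    have h : iIndepFun (fun (i : ι) (w : ι → E) => w i) (Measure.infinitePi fun _ : ι => ν) :=
      iIndepFun_infinitePi (X := fun _ x => x) fun _ => measurable_id
    exact (h.precomp hidx).comp (fun _ => g) fun _ => hgm
  have hpush : ∀ (n : ℕ) {u : E → ℝ}, Measurable u → ∫ w, u (w (idx n)) ∂μ = ∫ e, u e ∂ν := by
    intro n u hu
    exact integral_comp_of_measurePreserving (hmp n) hu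
  have hMZ := integral_abs_sum_rpow_le (μ := μ) h2 h3 (ξ := fun n (w : ι → E) => g (w (idx n)))
    (fun n => hgm.comp (hmp n).measurable) hind
    (fun n => hgL.comp_measurePreserving (hmp n))
    (fun n => by
      rw [hpush n hgm, hg, integral_sub (hL.integrable hr1) (integrable_const _)]
      simp) (K := ∫ e, |g e| ^ r ∂ν)
    (fun n => by rw [hpush n (u := fun e => |g e| ^ r) (by fun_prop)]) N
  have hmean : ∀ w : ι → E, (N : ℝ)⁻¹ * ∑ n ∈ Finset.range N, h (w (idx n)) - ∫ e, h e ∂ν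
      = (N : ℝ)⁻¹ * ∑ n ∈ Finset.range N, g (w (idx n)) := by
    intro w
    simp only [hg, Finset.sum_sub_distrib, Finset.sum_const, Finset.card_range, nsmul_eq_mul]
    field_simp
  simp only [hmean]
  have hSL : MemLp (fun w : ι → E => ∑ n ∈ Finset.range N, g (w (idx n))) (ENNReal.ofReal r) μ :=
    memLp_finsetSum _ fun n _ => hgL.comp_measurePreserving (hmp n)
  have hg2 : eLpNorm g (ENNReal.ofReal r) ν ≤ 2 * eLpNorm h (ENNReal.ofReal r) ν := by
    refine (eLpNorm_sub_le hh.aestronglyMeasurable aestronglyMeasurable_const hr1).trans ?_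
    rw [two_mul, eLpNorm_const _ (by simpa using hr0) (IsProbabilityMeasure.ne_zero ν)]
    simpa using add_le_add_right (enorm_integral_le_eLpNorm (μ := ν) hh hr1) _
  have h22 : (22 : ℝ) ^ r⁻¹ ≤ 22 := by
    calc (22 : ℝ) ^ r⁻¹ ≤ 22 ^ (1 : ℝ) :=
          Real.rpow_le_rpow_of_exponent_le (by norm_num) (inv_le_one_of_one_le₀ (by linarith))
      _ = 22 := by norm_num
  have hI0 : 0 ≤ ∫ e, |g e| ^ r ∂ν := integral_nonneg fun e => by positivity
  calc eLpNorm (fun w : ι → E => (N : ℝ)⁻¹ * ∑ n ∈ Finset.range N, g (w (idx n)))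
        (ENNReal.ofReal r) μ
      = ENNReal.ofReal (N : ℝ)⁻¹ * eLpNorm (fun w : ι → E => ∑ n ∈ Finset.range N, g (w (idx n)))
        (ENNReal.ofReal r) μ := by
        have := eLpNorm_const_smul (N : ℝ)⁻¹
          (fun w : ι → E => ∑ n ∈ Finset.range N, g (w (idx n))) (ENNReal.ofReal r) μ
        rw [Real.enorm_eq_ofReal (by positivity)] at this
        exact this
    _ ≤ ENNReal.ofReal (N : ℝ)⁻¹ * (ENNReal.ofReal (22 * (N : ℝ) ^ (1 / 2 : ℝ))
          * eLpNorm g (ENNReal.ofReal r) ν) := by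
        gcongr
        rw [eLpNorm_ofReal_eq hr0 hSL, eLpNorm_ofReal_eq hr0 hgL,
          ← ENNReal.ofReal_mul (by positivity)]
        refine ENNReal.ofReal_le_ofReal ?_
        calc (∫ w, |∑ n ∈ Finset.range N, g (w (idx n))| ^ r ∂μ) ^ r⁻¹
            ≤ (22 * (N : ℝ) ^ (r / 2) * ∫ e, |g e| ^ r ∂ν) ^ r⁻¹ := by
              refine Real.rpow_le_rpow (integral_nonneg fun e => by positivity) hMZ (by positivity)
          _ = 22 ^ r⁻¹ * (N : ℝ) ^ (1 / 2 : ℝ) * (∫ e, |g e| ^ r ∂ν) ^ r⁻¹ := by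
              rw [Real.mul_rpow (by positivity) hI0, Real.mul_rpow (by positivity) (by positivity),
                ← Real.rpow_mul hNpos.le]
              congr 3
              field_simp
          _ ≤ _ := by gcongr
    _ ≤ ENNReal.ofReal (N : ℝ)⁻¹ * (ENNReal.ofReal (22 * (N : ℝ) ^ (1 / 2 : ℝ))
          * (2 * eLpNorm h (ENNReal.ofReal r) ν)) := by gcongr
    _ = _ := by
        rw [← ENNReal.ofReal_ofNat 2, ← mul_assoc, ← mul_assoc,
          ← ENNReal.ofReal_mul (by positivity), ← ENNReal.ofReal_mul (by positivity)]
        congr 2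
        have : (N : ℝ) ^ (1 / 2 : ℝ) = N * (N : ℝ) ^ (-(1 / 2) : ℝ) := by
          conv_rhs => rw [← Real.rpow_one (N : ℝ)]
          rw [Real.rpow_one, ← Real.rpow_one_add' hNpos.le (by norm_num)]
          norm_num
        rw [this]
        field_simp
        norm_num

/-! ### The antithetic combination -/

/-- The antithetic combination vanishes unless both coarse values lie on opposite sides of the kink,
in which case both its size and the distance `|z|` of the limit to the kink are at most the sum of
the errors of the two coarse values.  Comparing this sum with `y` separates a small-ball event from
a tail. -/
lemma sq_antithetic_le {r : ℝ} (hr : 2 < r) {y : ℝ} (hy : 0 < y) (c₀ c₁ p z : ℝ) :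
    (max (1 / 2 * (c₀ + c₁)) p - 1 / 2 * (max c₀ p + max c₁ p)) ^ 2
      ≤ (if |z| < y then y ^ 2 else 0)
        + y ^ (2 - r) * (|c₀ - p - z| + |c₁ - p - z|) ^ r := by
  set T := max (1 / 2 * (c₀ + c₁)) p - 1 / 2 * (max c₀ p + max c₁ p) with hT
  set D := |c₀ - p - z| + |c₁ - p - z| with hD
  have hD0 : 0 ≤ D := by positivity
  have hrhs : 0 ≤ (if |z| < y then y ^ 2 else 0) := by split_ifs <;> positivity
  have hrhs' : 0 ≤ y ^ (2 - r) * D ^ r := by positivity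
  rcases eq_or_ne T 0 with h0 | h0
  · rw [h0]
    simp only [ne_eq, OfNat.ofNat_ne_zero, not_false_eq_true, zero_pow]
    positivity
  -- on either side of the kink the maximum is linear and the antithetic combination vanishes
  have hopp : (c₀ < p ∧ p < c₁) ∨ (c₁ < p ∧ p < c₀) := by
    by_contra hcon
    push Not at hcon
    apply h0
    rcases lt_trichotomy c₀ p with h | h | h <;> rcases lt_trichotomy c₁ p with h' | h' | h'
    all_goals first
      | (exfalso; linarith [hcon.1 h]) | (exfalso; linarith [hcon.2 h'])
      | (rw [hT, max_eq_right (by linarith), max_eq_right (by linarith),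
          max_eq_right (by linarith)]; ring)
      | (rw [hT, max_eq_left (by linarith), max_eq_left (by linarith),
          max_eq_left (by linarith)]; ring)
  have ha := abs_le.1 (le_refl |c₀ - p - z|)
  have hb := abs_le.1 (le_refl |c₁ - p - z|)
  have hzD : |z| ≤ D := by
    rw [abs_le]
    rcases hopp with h | h <;> constructor <;> rw [hD] <;>
      linarith [ha.1, ha.2, hb.1, hb.2, h.1, h.2, abs_nonneg (c₀ - p - z), abs_nonneg (c₁ - p - z)]
  have hTD : |T| ≤ D := by
    rw [abs_le, hT]
    rcases hopp with h | h
    · rw [max_eq_right h.1.le, max_eq_left h.2.le]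
      constructor
      · have := le_max_right (1 / 2 * (c₀ + c₁)) p
        linarith [ha.1, ha.2, hb.1, hb.2, h.1, h.2]
      · have : max (1 / 2 * (c₀ + c₁)) p ≤ 1 / 2 * (p + c₁) := max_le (by linarith) (by linarith)
        linarith
    · rw [max_eq_right h.1.le, max_eq_left h.2.le]
      constructor
      · have := le_max_right (1 / 2 * (c₀ + c₁)) p
        linarith [ha.1, ha.2, hb.1, hb.2, h.1, h.2]
      · have : max (1 / 2 * (c₀ + c₁)) p ≤ 1 / 2 * (p + c₀) := max_le (by linarith) (by linarith)
        linarith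
  have hT2 : T ^ 2 ≤ D ^ 2 := by
    rw [← sq_abs]; gcongr
  rcases lt_or_ge D y with hDy | hDy
  · rw [if_pos (hzD.trans_lt hDy)]
    have : D ^ 2 ≤ y ^ 2 := by gcongr
    linarith
  · have hDpos : 0 < D := hy.trans_le hDy
    have : D ^ 2 ≤ y ^ (2 - r) * D ^ r := by
      calc D ^ 2 = D ^ (2 - r) * D ^ r := by
            rw [← Real.rpow_add hDpos, ← Real.rpow_two]; congr 1; ring
        _ ≤ y ^ (2 - r) * D ^ r := by
            gcongr ?_ * _
            exact Real.rpow_le_rpow_of_nonpos hy hDy (by linarith)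
    linarith

/-- Second moment of the antithetic combination.  When both coarse values are within `s` of the
limit `Z` in `L^r` and `Z` has a bounded density near the kink, the exponent `3r/(r+1) > 2` of `s`
beats the trivial exponent `2`. -/
lemma lintegral_antithetic_sq_le {α : Type*} [MeasurableSpace α] {μ : Measure α} {r : ℝ}
    (hr : 2 < r) {c₀ c₁ p Z : α → ℝ} (h₀ : Measurable c₀) (h₁ : Measurable c₁) (hp : Measurable p)
    (hZm : Measurable Z) {ρ : ℝ} (hρ : 0 ≤ ρ)
    (hZ : ∀ y : ℝ, 0 < y → μ {x | |Z x| < y} ≤ ENNReal.ofReal (ρ * y)) {s : ℝ} (hs : 0 < s)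
    (hc₀ : eLpNorm (fun x => c₀ x - p x - Z x) (ENNReal.ofReal r) μ ≤ ENNReal.ofReal s)
    (hc₁ : eLpNorm (fun x => c₁ x - p x - Z x) (ENNReal.ofReal r) μ ≤ ENNReal.ofReal s) :
    ∫⁻ x, ‖max (1 / 2 * (c₀ x + c₁ x)) (p x)
        - 1 / 2 * (max (c₀ x) (p x) + max (c₁ x) (p x))‖ₑ ^ 2 ∂μ
      ≤ ENNReal.ofReal ((ρ + 1) * (2 * s) ^ (3 * r / (r + 1))) := by
  have hr0 : 0 < r := by linarith
  -- this `y` balances the small-ball term `ρ * y ^ 3` and the tail term `y ^ (2 - r) * (2 * s) ^ r`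
  set y : ℝ := (2 * s) ^ (r / (r + 1)) with hy
  have hy0 : 0 < y := by positivity
  have hr1 : (1 : ℝ≥0∞) ≤ ENNReal.ofReal r := by simp; linarith
  set D : α → ℝ := fun x => |c₀ x - p x - Z x| + |c₁ x - p x - Z x| with hD
  have hDm : Measurable D := by fun_prop
  have hDn : eLpNorm D (ENNReal.ofReal r) μ ≤ ENNReal.ofReal (2 * s) := by
    have hadd := eLpNorm_add_le (μ := μ) (f := fun x => |c₀ x - p x - Z x|)
      (g := fun x => |c₁ x - p x - Z x|) (by fun_prop) (by fun_prop) hr1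
    refine hadd.trans ?_
    rw [two_mul, ENNReal.ofReal_add hs.le hs.le]
    refine add_le_add (le_trans (le_of_eq ?_) hc₀) (le_trans (le_of_eq ?_) hc₁)
    · exact eLpNorm_norm (fun x => c₀ x - p x - Z x)
    · exact eLpNorm_norm (fun x => c₁ x - p x - Z x)
  have hDr : ∫⁻ x, ENNReal.ofReal (D x ^ r) ∂μ ≤ ENNReal.ofReal ((2 * s) ^ r) := by
    have h := ENNReal.rpow_le_rpow hDn hr0.le
    rw [eLpNorm_ofReal_rpow hr0, ENNReal.ofReal_rpow_of_nonneg (by positivity) hr0.le] at h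
    refine le_trans (le_of_eq (lintegral_congr fun x => ?_)) h
    have hDx : 0 ≤ D x := by simp only [hD]; positivity
    rw [Real.enorm_eq_ofReal hDx, ENNReal.ofReal_rpow_of_nonneg hDx hr0.le]
  have hset : MeasurableSet {x | |Z x| < y} := measurableSet_lt (by fun_prop) measurable_const
  calc ∫⁻ x, ‖max (1 / 2 * (c₀ x + c₁ x)) (p x)
        - 1 / 2 * (max (c₀ x) (p x) + max (c₁ x) (p x))‖ₑ ^ 2 ∂μ
      ≤ ∫⁻ x, ({x | |Z x| < y}.indicator (fun _ => ENNReal.ofReal (y ^ 2)) x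
          + ENNReal.ofReal (y ^ (2 - r)) * ENNReal.ofReal (D x ^ r)) ∂μ := by
        refine lintegral_mono fun x => ?_
        rw [Real.enorm_eq_ofReal_abs, ← ENNReal.ofReal_pow (abs_nonneg _), sq_abs]
        refine (ENNReal.ofReal_le_ofReal (sq_antithetic_le hr hy0 _ _ _ (Z x))).trans ?_
        refine ENNReal.ofReal_add_le.trans (add_le_add (le_of_eq ?_) (le_of_eq ?_))
        · by_cases h : |Z x| < y <;> simp [h]
        · rw [ENNReal.ofReal_mul (by positivity)]
    _ = ENNReal.ofReal (y ^ 2) * μ {x | |Z x| < y}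
          + ENNReal.ofReal (y ^ (2 - r)) * ∫⁻ x, ENNReal.ofReal (D x ^ r) ∂μ := by
        rw [lintegral_add_left (measurable_const.indicator hset), lintegral_indicator_const hset,
          lintegral_const_mul _ (by fun_prop)]
    _ ≤ ENNReal.ofReal (y ^ 2) * ENNReal.ofReal (ρ * y)
          + ENNReal.ofReal (y ^ (2 - r)) * ENNReal.ofReal ((2 * s) ^ r) := by
        gcongr
        exact hZ y hy0
    _ = ENNReal.ofReal ((ρ + 1) * (2 * s) ^ (3 * r / (r + 1))) := by
        rw [← ENNReal.ofReal_mul (by positivity), ← ENNReal.ofReal_mul (by positivity),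
          ← ENNReal.ofReal_add (by positivity) (by positivity)]
        congr 1
        have h3 : (2 * s) ^ (3 * r / (r + 1)) = y ^ 3 := by
          rw [hy, ← Real.rpow_natCast, ← Real.rpow_mul (by positivity)]
          congr 1; push_cast; ring
        have h4 : (2 * s) ^ r = y ^ (r + 1) := by
          rw [hy, ← Real.rpow_mul (by positivity)]
          congr 1; field_simp
        rw [h3, h4, ← Real.rpow_add hy0, show 2 - r + (r + 1) = (3 : ℕ) by push_cast; ring,
          Real.rpow_natCast]
        ring

/-! ### Choice of levels and sample sizes -/

lemma geom_sum_le_inv_one_sub {t : ℝ} (h0 : 0 ≤ t) (h1 : t < 1) (n : ℕ) :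
    ∑ ℓ ∈ Finset.range n, t ^ ℓ ≤ (1 - t)⁻¹ := by
  rw [← tsum_geometric_of_lt_one h0 h1]
  exact (summable_geometric_of_lt_one h0 h1).sum_le_tsum _ fun i _ => pow_nonneg h0 i

lemma geom_sum_le_of_one_lt {y : ℝ} (h1 : 1 < y) (n : ℕ) :
    ∑ ℓ ∈ Finset.range (n + 1), y ^ ℓ ≤ y / (y - 1) * y ^ n := by
  rw [geom_sum_eq h1.ne', div_mul_eq_mul_div, ← pow_succ']
  have : 0 < y - 1 := by linarith
  gcongr
  linarith

/-- Choice of the finest level `L` and of the sample sizes `m ℓ` of a multilevel estimator with bias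
`b`, variances `V` and costs `W` per level, when `V ℓ * W ℓ` decays geometrically, like
`t ^ (2 * ℓ)`. -/
lemma exists_levels_of_geometric {A B u t : ℝ} (hA : 0 < A) (hB : 0 < B) (hu : 1 < u)
    (ht0 : 0 < t) (ht1 : t < 1) (hy : 1 < t ^ 2 * u ^ 2) {V W b : ℕ → ℝ}
    (hV : ∀ ℓ, V ℓ ≤ A * ((u ^ 2)⁻¹) ^ ℓ) (hW : ∀ ℓ, W ℓ ≤ B * (t ^ 2 * u ^ 2) ^ ℓ)
    (hb : ∀ L, b L ≤ A * u⁻¹ ^ L) :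
    ∃ C > (0 : ℝ), ∀ ε : ℝ, 0 < ε → ε < 1 → ∃ (L : ℕ) (m : ℕ → ℕ), (∀ ℓ, 0 < m ℓ) ∧
      b L ≤ ε / 2 ∧ ∑ ℓ ∈ Finset.range (L + 1), V ℓ / m ℓ ≤ ε ^ 2 / 4 ∧
      ∑ ℓ ∈ Finset.range (L + 1), m ℓ * W ℓ ≤ C * ε⁻¹ ^ 2 := by
  set y := t ^ 2 * u ^ 2 with hydef
  have hu0 : 0 < u := by linarith
  have hy0 : 0 < y := by linarith
  have h1t : 0 < 1 - t := by linarith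
  have hy1 : 0 < y - 1 := by linarith
  set K : ℝ := 4 * A / (1 - t) with hK
  have hK0 : 0 < K := by positivity
  -- `m ℓ ≈ K * ε ^ (-2) * v ^ ℓ` is proportional to the square root of variance over cost
  set v : ℝ := (t * u ^ 2)⁻¹ with hv
  have hv0 : 0 < v := by positivity
  refine ⟨B * (y / (y - 1) * (1 + y * (4 * A ^ 2))) + K * B * (1 - t)⁻¹, by positivity,
    fun ε hε hε1 => ?_⟩
  have hex : ∃ L : ℕ, A * u⁻¹ ^ L ≤ ε / 2 := by
    have h := (tendsto_pow_atTop_nhds_zero_of_lt_one (inv_nonneg.2 hu0.le)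
      (inv_lt_one_of_one_lt₀ hu)).const_mul A
    rw [mul_zero] at h
    exact (h.eventually_le_const (half_pos hε)).exists
  classical
  set L := Nat.find hex with hL
  have hLspec : A * u⁻¹ ^ L ≤ ε / 2 := Nat.find_spec hex
  -- by minimality of `L`, the work on the finest level is of the order of `ε ^ (-2)`
  have hyL : y ^ L ≤ (1 + y * (4 * A ^ 2)) * ε⁻¹ ^ 2 := by
    have hε2 : 1 ≤ ε⁻¹ ^ 2 := one_le_pow₀ (one_le_inv_iff₀.2 ⟨hε, hε1.le⟩)
    rcases Nat.eq_zero_or_pos L with h0 | hpos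
    · rw [h0, pow_zero]
      have : 0 ≤ y * (4 * A ^ 2) * ε⁻¹ ^ 2 := by positivity
      linarith
    · have hmin := Nat.find_min hex (m := L - 1) (by omega)
      rw [not_le] at hmin
      have hu' : u ^ (L - 1) < 2 * A * ε⁻¹ := by
        have hup : 0 < u ^ (L - 1) := by positivity
        rw [inv_pow] at hmin
        have : ε / 2 * u ^ (L - 1) < A := by
          calc ε / 2 * u ^ (L - 1) < A * (u ^ (L - 1))⁻¹ * u ^ (L - 1) := by gcongr
            _ = A := by field_simp
        rw [← div_eq_mul_inv, lt_div_iff₀ hε]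
        linarith
      calc y ^ L = y * y ^ (L - 1) := by rw [← pow_succ']; congr 1; omega
        _ ≤ y * (u ^ 2) ^ (L - 1) := by
            gcongr
            rw [hydef]
            have : t ^ 2 ≤ 1 := pow_le_one₀ ht0.le ht1.le
            nlinarith [sq_nonneg u]
        _ = y * (u ^ (L - 1)) ^ 2 := by rw [← pow_mul, ← pow_mul, mul_comm 2]
        _ ≤ y * (2 * A * ε⁻¹) ^ 2 := by gcongr
        _ = y * (4 * A ^ 2) * ε⁻¹ ^ 2 := by ring
        _ ≤ _ := by
            have : 0 ≤ ε⁻¹ ^ 2 := by positivity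
            linarith
  refine ⟨L, fun ℓ => ⌈K * ε⁻¹ ^ 2 * v ^ ℓ⌉₊, fun ℓ => Nat.ceil_pos.2 (by positivity),
    (hb L).trans hLspec, ?_, ?_⟩
  · calc ∑ ℓ ∈ Finset.range (L + 1), V ℓ / (⌈K * ε⁻¹ ^ 2 * v ^ ℓ⌉₊ : ℝ)
        ≤ ∑ ℓ ∈ Finset.range (L + 1), A * ε ^ 2 / K * t ^ ℓ := by
          refine Finset.sum_le_sum fun ℓ _ => ?_
          calc V ℓ / (⌈K * ε⁻¹ ^ 2 * v ^ ℓ⌉₊ : ℝ)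
              ≤ A * ((u ^ 2)⁻¹) ^ ℓ / (⌈K * ε⁻¹ ^ 2 * v ^ ℓ⌉₊ : ℝ) := by
                gcongr; exact hV ℓ
            _ ≤ A * ((u ^ 2)⁻¹) ^ ℓ / (K * ε⁻¹ ^ 2 * v ^ ℓ) := by
                gcongr; exact Nat.le_ceil _
            _ = A * ε ^ 2 / K * t ^ ℓ := by
                have huv : (u ^ 2)⁻¹ = v * t := by rw [hv]; field_simp
                rw [huv, mul_pow]; field_simp
      _ = A * ε ^ 2 / K * ∑ ℓ ∈ Finset.range (L + 1), t ^ ℓ := by rw [Finset.mul_sum]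
      _ ≤ A * ε ^ 2 / K * (1 - t)⁻¹ := by
          gcongr; exact geom_sum_le_inv_one_sub ht0.le ht1 _
      _ = ε ^ 2 / 4 := by rw [hK]; field_simp
  · calc ∑ ℓ ∈ Finset.range (L + 1), (⌈K * ε⁻¹ ^ 2 * v ^ ℓ⌉₊ : ℝ) * W ℓ
        ≤ ∑ ℓ ∈ Finset.range (L + 1), (B * y ^ ℓ + K * B * ε⁻¹ ^ 2 * t ^ ℓ) := by
          refine Finset.sum_le_sum fun ℓ _ => ?_
          calc (⌈K * ε⁻¹ ^ 2 * v ^ ℓ⌉₊ : ℝ) * W ℓ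
              ≤ (⌈K * ε⁻¹ ^ 2 * v ^ ℓ⌉₊ : ℝ) * (B * y ^ ℓ) := by gcongr; exact hW ℓ
            _ ≤ (K * ε⁻¹ ^ 2 * v ^ ℓ + 1) * (B * y ^ ℓ) := by
                gcongr; exact (Nat.ceil_lt_add_one (by positivity)).le
            _ = B * y ^ ℓ + K * B * ε⁻¹ ^ 2 * (v * y) ^ ℓ := by rw [mul_pow]; ring
            _ = _ := by
                congr 3
                rw [hv, hydef]; field_simp
      _ = B * ∑ ℓ ∈ Finset.range (L + 1), y ^ ℓ
            + K * B * ε⁻¹ ^ 2 * ∑ ℓ ∈ Finset.range (L + 1), t ^ ℓ := by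
          rw [Finset.sum_add_distrib, Finset.mul_sum, Finset.mul_sum]
      _ ≤ B * (y / (y - 1) * ((1 + y * (4 * A ^ 2)) * ε⁻¹ ^ 2))
            + K * B * ε⁻¹ ^ 2 * (1 - t)⁻¹ := by
          gcongr
          · exact (geom_sum_le_of_one_lt hy L).trans (by gcongr)
          · exact geom_sum_le_inv_one_sub ht0.le ht1 _
      _ = _ := by ring

/-- Choice of the finest level `L` and of the sample sizes `m ℓ` of a multilevel estimator with bias
`b`, variances `V` and costs `W` per level, when `V ℓ * W ℓ` grows at most like `ℓ + 1`. -/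
lemma exists_levels_of_linear {A : ℝ} (hA : 0 < A) {u v V W b : ℕ → ℝ} (hu : ∀ ℓ, 1 ≤ u ℓ)
    (hv : ∀ ℓ, 1 ≤ v ℓ) (huv : ∀ ℓ, u ℓ * v ℓ ≤ ℓ + 1)
    (hV : ∀ ℓ, V ℓ ≤ A * u ℓ * (1 / 2) ^ ℓ) (hW : ∀ ℓ, W ℓ ≤ A * v ℓ * 2 ^ ℓ)
    (hb : ∀ L : ℕ, b L ≤ A * (L + 1) * (√2)⁻¹ ^ L) :
    ∃ C > (0 : ℝ), ∀ ε : ℝ, 0 < ε → ε < Real.exp (-1) → ∃ (L : ℕ) (m : ℕ → ℕ), (∀ ℓ, 0 < m ℓ) ∧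
      b L ≤ ε / 2 ∧ ∑ ℓ ∈ Finset.range (L + 1), V ℓ / m ℓ ≤ ε ^ 2 / 4 ∧
      ∑ ℓ ∈ Finset.range (L + 1), m ℓ * W ℓ ≤ C * ε⁻¹ ^ 2 * |Real.log ε| ^ 3 := by
  have hs2 : (√2)⁻¹ ^ 2 = (1 / 2 : ℝ) := by
    rw [inv_pow, Real.sq_sqrt (by norm_num)]; norm_num
  have hs0 : (0 : ℝ) < (√2)⁻¹ := by positivity
  have hs1 : (√2)⁻¹ < (1 : ℝ) := by
    by_contra hcon
    rw [not_lt] at hcon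
    have := one_le_pow₀ hcon (n := 2)
    rw [hs2] at this
    norm_num at this
  set c : ℝ := 7 + 5 * |Real.log A| + 5 * Real.log 8 + 5 * Real.log 2 + 5 with hc
  have hlog8 : 0 < Real.log 8 := Real.log_pos (by norm_num)
  have hlog2 : 0 < Real.log 2 := Real.log_pos (by norm_num)
  have hc0 : 0 < c := by positivity
  refine ⟨(16 * A ^ 3 + 2 * A + 4 * A ^ 2) * c ^ 3, by positivity, fun ε hε hε1 => ?_⟩
  have hlogε : 1 ≤ |Real.log ε| := by
    have : Real.log ε < -1 := by
      rw [Real.log_lt_iff_lt_exp hε]; exact hε1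
    rw [abs_of_neg (by linarith)]; linarith
  have hε1' : ε < 1 := hε1.trans (by rw [Real.exp_lt_one_iff]; norm_num)
  have hex : ∃ L : ℕ, A * (L + 1) * (√2)⁻¹ ^ L ≤ ε / 2 := by
    have h1 := tendsto_self_mul_const_pow_of_lt_one hs0.le hs1
    have h2 := tendsto_pow_atTop_nhds_zero_of_lt_one hs0.le hs1
    have h := (h1.add h2).const_mul A
    rw [add_zero, mul_zero] at h
    obtain ⟨L, hL⟩ := (h.eventually_le_const (half_pos hε)).exists
    exact ⟨L, by linarith⟩
  classical
  set L := Nat.find hex with hL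
  have hLspec : A * (L + 1) * (√2)⁻¹ ^ L ≤ ε / 2 := Nat.find_spec hex
  have hε2 : 1 ≤ ε⁻¹ ^ 2 := one_le_pow₀ (one_le_inv_iff₀.2 ⟨hε, hε1'.le⟩)
  have hmin : 0 < L → ε / 2 < A * L * (√2)⁻¹ ^ (L - 1) := fun hpos => by
    have := Nat.find_min hex (m := L - 1) (by omega)
    rw [not_le] at this
    have e : ((L - 1 : ℕ) : ℝ) + 1 = L := by
      have : L - 1 + 1 = L := by omega
      exact_mod_cast this
    rwa [e] at this
  -- by minimality of `L`, the bias at level `L - 1` exceeds `ε / 2`, so `2 ^ L` is of the order of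
  -- `L ^ 2 * ε ^ (-2)`, and `L` of the order of `|log ε|`
  have h2L : (2 : ℝ) ^ L ≤ (8 * A ^ 2 + 1) * (L + 1) ^ 2 * ε⁻¹ ^ 2 := by
    rcases Nat.eq_zero_or_pos L with h0 | hpos
    · rw [h0]; simp only [pow_zero, Nat.cast_zero, zero_add, one_pow, mul_one]
      have : 0 ≤ 8 * A ^ 2 * ε⁻¹ ^ 2 := by positivity
      linarith
    · have h := hmin hpos
      have hsq : (ε / 2) ^ 2 < (A * L * (√2)⁻¹ ^ (L - 1)) ^ 2 := by gcongr
      rw [mul_pow, ← pow_mul, mul_comm (L - 1) 2, pow_mul, hs2, one_div, inv_pow] at hsq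
      have hp : (0 : ℝ) < 2 ^ (L - 1) := by positivity
      have h3 : (ε / 2) ^ 2 * 2 ^ (L - 1) < (A * L) ^ 2 := by
        calc (ε / 2) ^ 2 * 2 ^ (L - 1) < (A * L) ^ 2 * (2 ^ (L - 1))⁻¹ * 2 ^ (L - 1) := by gcongr
          _ = _ := by field_simp
      have h4 : (2 : ℝ) ^ (L - 1) ≤ 4 * (A * L) ^ 2 * ε⁻¹ ^ 2 := by
        rw [inv_pow, ← div_eq_mul_inv, le_div_iff₀ (by positivity)]
        nlinarith
      calc (2 : ℝ) ^ L = 2 * 2 ^ (L - 1) := by rw [← pow_succ']; congr 1; omega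
        _ ≤ 2 * (4 * (A * L) ^ 2 * ε⁻¹ ^ 2) := by gcongr
        _ = 8 * A ^ 2 * L ^ 2 * ε⁻¹ ^ 2 := by ring
        _ ≤ _ := by gcongr <;> linarith
  have hLlog : (L : ℝ) + 1 ≤ c * |Real.log ε| := by
    rcases Nat.eq_zero_or_pos L with h0 | hpos
    · rw [h0]
      have : c * 1 ≤ c * |Real.log ε| := by gcongr
      have : 7 ≤ c := by rw [hc]; linarith [abs_nonneg (Real.log A)]
      simp; linarith
    · have h := hmin hpos
      have hLpos : (0 : ℝ) < L := by exact_mod_cast hpos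
      have hlog := Real.log_lt_log (by positivity) h
      rw [Real.log_mul (by positivity) (by positivity), Real.log_mul hA.ne' hLpos.ne',
        Real.log_pow, Real.log_inv, Real.log_sqrt (by norm_num),
        Real.log_div hε.ne' (by norm_num)] at hlog
      have e : ((L - 1 : ℕ) : ℝ) = L - 1 := by
        rw [Nat.cast_sub (by omega)]; simp
      rw [e] at hlog
      have hl8 : Real.log L ≤ L / 8 - 1 + Real.log 8 := by
        have := Real.log_le_sub_one_of_pos (x := (L : ℝ) / 8) (by positivity)
        rw [Real.log_div hLpos.ne' (by norm_num)] at this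
        linarith
      have hl2 : 0.69 < Real.log 2 := by
        have := Real.log_two_gt_d9; linarith
      have hA' := le_abs_self (Real.log A)
      have hε' := neg_abs_le (Real.log ε)
      have h5 : (L : ℝ) ≤ 5 * (|Real.log ε| + |Real.log A| + Real.log 8 + Real.log 2) := by
        nlinarith
      have h6 : 0 ≤ (|Real.log A| + Real.log 8 + Real.log 2) * (|Real.log ε| - 1) :=
        mul_nonneg (by positivity) (by linarith)
      rw [hc]
      nlinarith
  have hvle : ∀ ℓ : ℕ, v ℓ ≤ ℓ + 1 := fun ℓ => by
    have := huv ℓ; nlinarith [hu ℓ, hv ℓ]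
  set K : ℝ := 4 * A with hK
  have hK0 : 0 < K := by positivity
  have hupos : ∀ ℓ, 0 < u ℓ := fun ℓ => one_pos.trans_le (hu ℓ)
  have hvpos : ∀ ℓ, 0 < v ℓ := fun ℓ => one_pos.trans_le (hv ℓ)
  have hx : ∀ ℓ : ℕ, 0 < K * ε⁻¹ ^ 2 * (L + 1) * u ℓ * (1 / 2) ^ ℓ := fun ℓ => by
    have := hupos ℓ; positivity
  -- with these sample sizes, all levels have the same share of the variance `ε ^ 2 / 4`
  refine ⟨L, fun ℓ => ⌈K * ε⁻¹ ^ 2 * (L + 1) * u ℓ * (1 / 2) ^ ℓ⌉₊,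
    fun ℓ => Nat.ceil_pos.2 (hx ℓ), (hb L).trans hLspec, ?_, ?_⟩
  · calc ∑ ℓ ∈ Finset.range (L + 1), V ℓ / (⌈K * ε⁻¹ ^ 2 * (L + 1) * u ℓ * (1 / 2) ^ ℓ⌉₊ : ℝ)
        ≤ ∑ ℓ ∈ Finset.range (L + 1), A * ε ^ 2 / (K * (L + 1)) := by
          refine Finset.sum_le_sum fun ℓ _ => ?_
          have := hupos ℓ
          calc V ℓ / (⌈K * ε⁻¹ ^ 2 * (L + 1) * u ℓ * (1 / 2) ^ ℓ⌉₊ : ℝ)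
              ≤ A * u ℓ * (1 / 2) ^ ℓ / (⌈K * ε⁻¹ ^ 2 * (L + 1) * u ℓ * (1 / 2) ^ ℓ⌉₊ : ℝ) := by
                gcongr; exact hV ℓ
            _ ≤ A * u ℓ * (1 / 2) ^ ℓ / (K * ε⁻¹ ^ 2 * (L + 1) * u ℓ * (1 / 2) ^ ℓ) := by
                gcongr
                exact Nat.le_ceil _
            _ = _ := by field_simp
      _ = ε ^ 2 / 4 := by
          rw [Finset.sum_const, Finset.card_range, nsmul_eq_mul, hK]
          push_cast; field_simp
  · calc ∑ ℓ ∈ Finset.range (L + 1), (⌈K * ε⁻¹ ^ 2 * (L + 1) * u ℓ * (1 / 2) ^ ℓ⌉₊ : ℝ) * W ℓ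
        ≤ ∑ ℓ ∈ Finset.range (L + 1),
            (A * (L + 1) * 2 ^ ℓ + A * K * ε⁻¹ ^ 2 * (L + 1) * (L + 1)) := by
          refine Finset.sum_le_sum fun ℓ hℓ => ?_
          have hℓL : (ℓ : ℝ) + 1 ≤ L + 1 := by
            have := Finset.mem_range.1 hℓ
            exact_mod_cast this
          have h1 := hupos ℓ
          have h2 := hvpos ℓ
          calc (⌈K * ε⁻¹ ^ 2 * (L + 1) * u ℓ * (1 / 2) ^ ℓ⌉₊ : ℝ) * W ℓ
              ≤ (⌈K * ε⁻¹ ^ 2 * (L + 1) * u ℓ * (1 / 2) ^ ℓ⌉₊ : ℝ) * (A * v ℓ * 2 ^ ℓ) := by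
                gcongr; exact hW ℓ
            _ ≤ (K * ε⁻¹ ^ 2 * (L + 1) * u ℓ * (1 / 2) ^ ℓ + 1) * (A * v ℓ * 2 ^ ℓ) := by
                gcongr; exact (Nat.ceil_lt_add_one (hx ℓ).le).le
            _ = A * v ℓ * 2 ^ ℓ
                  + A * K * ε⁻¹ ^ 2 * (L + 1) * (u ℓ * v ℓ) * ((1 / 2) ^ ℓ * 2 ^ ℓ) := by ring
            _ = A * v ℓ * 2 ^ ℓ + A * K * ε⁻¹ ^ 2 * (L + 1) * (u ℓ * v ℓ) := by
                rw [← mul_pow]; norm_num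
            _ ≤ _ := by
                gcongr
                · exact (hvle ℓ).trans hℓL
                · exact (huv ℓ).trans hℓL
      _ = A * (L + 1) * ∑ ℓ ∈ Finset.range (L + 1), 2 ^ ℓ
            + A * K * ε⁻¹ ^ 2 * (L + 1) ^ 3 := by
          rw [Finset.sum_add_distrib, Finset.mul_sum, Finset.sum_const, Finset.card_range,
            nsmul_eq_mul]
          push_cast; ring
      _ ≤ A * (L + 1) * (2 * ((8 * A ^ 2 + 1) * (L + 1) ^ 2 * ε⁻¹ ^ 2))
            + A * K * ε⁻¹ ^ 2 * (L + 1) ^ 3 := by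
          gcongr
          have := geom_sum_le_of_one_lt (y := 2) (by norm_num) L
          norm_num at this
          exact this.trans (by gcongr)
      _ = (16 * A ^ 3 + 2 * A + 4 * A ^ 2) * ε⁻¹ ^ 2 * (L + 1) ^ 3 := by rw [hK]; ring
      _ ≤ (16 * A ^ 3 + 2 * A + 4 * A ^ 2) * ε⁻¹ ^ 2 * (c * |Real.log ε|) ^ 3 := by gcongr
      _ = _ := by ring

/-- Level choice when the norms of the corrections decay geometrically, faster than the square root
of their cost grows.  The sequence `G` bounds the bias. -/
lemma exists_levels_of_norm_le_geometric {A B u t : ℝ} (hA : 0 < A) (hB : 0 < B) (hu : 1 < u)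
    (ht0 : 0 < t) (ht1 : t < 1) (hy : 1 < t ^ 2 * u ^ 2) {D W : ℕ → ℝ} (hD0 : ∀ ℓ, 0 ≤ D ℓ)
    (hD : ∀ ℓ, D (ℓ + 1) ≤ A * u⁻¹ ^ ℓ) (hW : ∀ ℓ, W ℓ ≤ B * (t ^ 2 * u ^ 2) ^ ℓ) :
    ∃ G : ℕ → ℝ, (∀ ℓ, 0 ≤ G ℓ) ∧ (∀ ℓ, D (ℓ + 1) ≤ G ℓ - G (ℓ + 1)) ∧
      ∃ C > (0 : ℝ), ∀ ε : ℝ, 0 < ε → ε < 1 → ∃ (L : ℕ) (m : ℕ → ℕ), (∀ ℓ, 0 < m ℓ) ∧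
        G L ≤ ε / 2 ∧ ∑ ℓ ∈ Finset.range (L + 1), D ℓ ^ 2 / m ℓ ≤ ε ^ 2 / 4 ∧
        ∑ ℓ ∈ Finset.range (L + 1), m ℓ * W ℓ ≤ C * ε⁻¹ ^ 2 := by
  have hu0 : 0 < u := by linarith
  have h1 : 0 < 1 - u⁻¹ := by linarith [inv_lt_one_of_one_lt₀ hu]
  have hA' : 0 < D 0 ^ 2 + (A * u) ^ 2 + A / (1 - u⁻¹) := by positivity
  refine ⟨fun ℓ => A / (1 - u⁻¹) * u⁻¹ ^ ℓ, fun ℓ => by positivity, fun ℓ => (hD ℓ).trans ?_,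
    exists_levels_of_geometric hA' hB hu ht0 ht1 hy (fun ℓ => ?_) hW fun L => ?_⟩
  · refine le_of_eq ?_
    rw [← mul_sub, pow_succ, ← mul_one_sub, mul_comm (u⁻¹ ^ ℓ), ← mul_assoc,
      div_mul_cancel₀ A h1.ne']
  · have h2 : 0 ≤ A / (1 - u⁻¹) := by positivity
    cases ℓ with
    | zero =>
      rw [pow_zero, mul_one]
      linarith [sq_nonneg (A * u)]
    | succ ℓ =>
      calc D (ℓ + 1) ^ 2 ≤ (A * u⁻¹ ^ ℓ) ^ 2 := pow_le_pow_left₀ (hD0 _) (hD ℓ) 2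
        _ = (A * u) ^ 2 * (u ^ 2)⁻¹ ^ (ℓ + 1) := by
          rw [pow_succ ((u ^ 2)⁻¹), mul_pow, ← pow_mul, mul_comm ℓ 2, pow_mul, inv_pow u 2]
          field_simp
        _ ≤ _ := by
          gcongr
          linarith [sq_nonneg (D 0)]
  · gcongr
    linarith [sq_nonneg (D 0), sq_nonneg (A * u)]

/-- Level choice in the critical case, where the cost of a correction grows at the rate at which its
variance decays, up to the factors `u` and `v`.  The sequence `G` bounds the bias. -/
lemma exists_levels_of_norm_le_linear {A B : ℝ} (hA : 0 < A) (hB : 0 < B) {u v D W : ℕ → ℝ}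
    (hu : ∀ ℓ, 1 ≤ u ℓ) (hv : ∀ ℓ, 1 ≤ v ℓ) (huv : ∀ ℓ, u ℓ * v ℓ ≤ ℓ + 1) (hum : Monotone u)
    (hD0 : ∀ ℓ, 0 ≤ D ℓ) (hD : ∀ ℓ, D (ℓ + 1) ≤ A * √(u ℓ) * (√2)⁻¹ ^ ℓ)
    (hW : ∀ ℓ, W ℓ ≤ B * v ℓ * 2 ^ ℓ) :
    ∃ G : ℕ → ℝ, (∀ ℓ, 0 ≤ G ℓ) ∧ (∀ ℓ, D (ℓ + 1) ≤ G ℓ - G (ℓ + 1)) ∧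
      ∃ C > (0 : ℝ), ∀ ε : ℝ, 0 < ε → ε < Real.exp (-1) →
        ∃ (L : ℕ) (m : ℕ → ℕ), (∀ ℓ, 0 < m ℓ) ∧
        G L ≤ ε / 2 ∧ ∑ ℓ ∈ Finset.range (L + 1), D ℓ ^ 2 / m ℓ ≤ ε ^ 2 / 4 ∧
        ∑ ℓ ∈ Finset.range (L + 1), m ℓ * W ℓ ≤ C * ε⁻¹ ^ 2 * |Real.log ε| ^ 3 := by
  set s : ℝ := (√2)⁻¹ with hs
  have hs0 : 0 < s := by positivity
  have hs2 : s ^ 2 = 1 / 2 := by rw [hs, inv_pow, Real.sq_sqrt (by norm_num)]; norm_num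
  have hs1 : s ≤ 3 / 4 := by nlinarith
  have hsqrt : ∀ ℓ : ℕ, √(u ℓ) ≤ ℓ + 1 := fun ℓ => by
    have h1 : √(u ℓ) ≤ u ℓ := Real.sqrt_le_iff.2 ⟨by linarith [hu ℓ], by nlinarith [hu ℓ]⟩
    have h2 := huv ℓ
    nlinarith [hu ℓ, hv ℓ]
  refine ⟨fun ℓ => 4 * A * (ℓ + 4) * s ^ ℓ, fun ℓ => by positivity, fun ℓ => (hD ℓ).trans ?_,
    exists_levels_of_linear (A := D 0 ^ 2 + 2 * A ^ 2 + 16 * A + B) (by positivity) hu hv huv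
      (fun ℓ => ?_) (fun ℓ => (hW ℓ).trans ?_) fun L => ?_⟩
  · calc A * √(u ℓ) * s ^ ℓ ≤ A * (ℓ + 1) * s ^ ℓ := by gcongr; exact hsqrt ℓ
      _ = 4 * A * ((ℓ + 4) - 3 / 4 * (ℓ + 5)) * s ^ ℓ := by ring
      _ ≤ 4 * A * ((ℓ + 4) - s * (ℓ + 5)) * s ^ ℓ := by gcongr
      _ = _ := by push_cast; ring
  · have h16 : 0 ≤ 16 * A + B := by positivity
    cases ℓ with
    | zero =>
      rw [pow_zero, mul_one]
      nlinarith [hu 0, sq_nonneg (D 0), sq_nonneg A]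
    | succ ℓ =>
      have hu0 : 0 ≤ u ℓ := zero_le_one.trans (hu ℓ)
      have hu1 : 0 ≤ u (ℓ + 1) := zero_le_one.trans (hu _)
      calc D (ℓ + 1) ^ 2 ≤ (A * √(u ℓ) * s ^ ℓ) ^ 2 := pow_le_pow_left₀ (hD0 _) (hD ℓ) 2
        _ = A ^ 2 * u ℓ * (1 / 2) ^ ℓ := by
          rw [mul_pow, mul_pow, Real.sq_sqrt hu0, ← pow_mul, mul_comm ℓ 2, pow_mul, hs2]
        _ ≤ A ^ 2 * u (ℓ + 1) * (1 / 2) ^ ℓ := by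
          gcongr
          exact hum (Nat.le_succ ℓ)
        _ = 2 * A ^ 2 * u (ℓ + 1) * (1 / 2) ^ (ℓ + 1) := by ring
        _ ≤ _ := by
          gcongr
          linarith [sq_nonneg (D 0)]
  · have := hv ℓ
    gcongr
    linarith [sq_nonneg (D 0), sq_nonneg A]
  · calc 4 * A * (L + 4) * s ^ L ≤ 4 * A * (4 * (L + 1)) * s ^ L := by
          gcongr
          have : (0 : ℝ) ≤ L := by positivity
          linarith
      _ = 16 * A * (L + 1) * s ^ L := by ring
      _ ≤ _ := by
          gcongr
          linarith [sq_nonneg (D 0), sq_nonneg A]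

/-! ### Geometric rates -/

lemma eLpNorm_le_of_absMoment_le {α : Type*} [MeasurableSpace α] {μ : Measure α} {f : α → ℝ}
    {p a x : ℝ} (hp : 0 < p) (hx : 0 ≤ x) (h : absMoment μ f p ≤ ENNReal.ofReal (a * x ^ p)) :
    eLpNorm f (ENNReal.ofReal p) μ ≤ ENNReal.ofReal ((|a| + 1) ^ p⁻¹ * x) := by
  rw [← ENNReal.rpow_le_rpow_iff hp, eLpNorm_ofReal_rpow hp,
    ENNReal.ofReal_rpow_of_nonneg (by positivity) hp.le,
    Real.mul_rpow (by positivity) hx, ← Real.rpow_mul (by positivity), inv_mul_cancel₀ hp.ne',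
    Real.rpow_one]
  have e : absMoment μ f p = ∫⁻ z, ‖f z‖ₑ ^ p ∂μ := by
    refine lintegral_congr fun z => ?_
    rw [Real.enorm_eq_ofReal_abs, ENNReal.ofReal_rpow_of_nonneg (abs_nonneg _) hp.le]
  rw [← e]
  refine h.trans (ENNReal.ofReal_le_ofReal ?_)
  gcongr
  linarith [le_abs_self a]

/-- Polynomial factors are absorbed by an arbitrarily slow exponential. -/
lemma exists_max_rpow_le (lam : ℝ) {σ : ℝ} (hσ : 0 < σ) :
    ∃ K > (0 : ℝ), ∀ k : ℕ, (max (k : ℝ) 1) ^ lam ≤ K * 2 ^ (σ * k) := by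
  have hb : 0 < σ * Real.log 2 := mul_pos hσ (Real.log_pos (by norm_num))
  have h1 := (isLittleO_rpow_exp_pos_mul_atTop lam hb).tendsto_div_nhds_zero.comp
    (tendsto_natCast_atTop_atTop (R := ℝ))
  obtain ⟨K, hK⟩ := h1.bddAbove_range
  have hK' : ∀ k : ℕ, (k : ℝ) ^ lam ≤ K * 2 ^ (σ * k) := fun k => by
    have h2 : (k : ℝ) ^ lam / Real.exp (σ * Real.log 2 * k) ≤ K := hK ⟨k, rfl⟩
    rw [div_le_iff₀ (Real.exp_pos _)] at h2
    rw [Real.rpow_def_of_pos (by norm_num : (0 : ℝ) < 2), ← mul_assoc, mul_comm (Real.log 2)]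
    exact h2
  refine ⟨|K| + 1, by positivity, fun k => ?_⟩
  have h2 : (1 : ℝ) ≤ 2 ^ (σ * k) := Real.one_le_rpow (by norm_num) (by positivity)
  rcases Nat.eq_zero_or_pos k with rfl | hk
  · simp
  · have h3 : max (k : ℝ) 1 = k := max_eq_left (by exact_mod_cast hk)
    rw [h3]
    refine (hK' k).trans ?_
    gcongr
    linarith [le_abs_self K]

/-- Conditioning a function of an outer variable and of an independent noise on the outer variable
amounts to integrating out the noise. -/
lemma condExp_prod_comap_fst {Ω E S : Type*} [MeasurableSpace Ω] [MeasurableSpace E]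
    [MeasurableSpace S] {P : Measure Ω} [IsProbabilityMeasure P] {ν : Measure E}
    [IsProbabilityMeasure ν] {Z : Ω → S} (hZ : Measurable Z) {H : S → E → ℝ}
    (hH : Measurable (Function.uncurry H))
    (hint : Integrable (fun z : Ω × E => H (Z z.1) z.2) (P.prod ν)) :
    (P.prod ν)[fun z => H (Z z.1) z.2 | MeasurableSpace.comap (fun z => Z z.1) inferInstance]
      =ᵐ[P.prod ν] fun z => ∫ e, H (Z z.1) e ∂ν := by
  have hZ' : Measurable fun z : Ω × E => Z z.1 := hZ.comp measurable_fst
  have hm := hZ'.comap_le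
  have hG : Measurable fun y => ∫ e, H y e ∂ν :=
    (hH.stronglyMeasurable.integral_prod_right' (ν := ν)).measurable
  have hgint : Integrable (fun z : Ω × E => ∫ e, H (Z z.1) e ∂ν) (P.prod ν) :=
    hint.integral_prod_left.comp_fst ν
  refine (ae_eq_condExp_of_forall_setIntegral_eq hm hint (fun _ _ _ => hgint.integrableOn) ?_
    ?_).symm
  · rintro s ⟨t, ht, rfl⟩ -
    have e : (fun z : Ω × E => Z z.1) ⁻¹' t = (Z ⁻¹' t) ×ˢ Set.univ := by ext z; simp
    rw [e, setIntegral_prod _ hgint.integrableOn, setIntegral_prod _ hint.integrableOn]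
    simp
  · have h1 : Measurable[MeasurableSpace.comap (fun z : Ω × E => Z z.1) inferInstance]
        (fun z : Ω × E => ∫ e, H (Z z.1) e ∂ν) := hG.comp (comap_measurable _)
    exact h1.stronglyMeasurable.aestronglyMeasurable

/-- The assumptions on a nested model in the form in which they enter the error analysis: bounds of
`L^r` and `L^2` norms by geometric sequences, with `2 < r ≤ 3` and an arbitrarily small loss `τ` in
the `L^r` rates that pays for all logarithmic factors.  Conditional expectations given the outer
variable are written as integrals over the inner noise.  The exponent `ζ` of the inner sample sizes
serves as `L^r` rate of the corrections. -/
structure NestedModel.GeometricRates {d : ℕ} {Ω E : Type*} [MeasurableSpace Ω] [MeasurableSpace E]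
    (M : NestedModel d Ω E) (P : Measure Ω) (ν : Measure E) (r τ ζ β₂ βh₂ K ρ : ℝ) : Prop where
  meas : M.IsMeasurable
  two_lt : 2 < r
  le_three : r ≤ 3
  tau_pos : 0 < τ
  tau_lt : τ < 1 / 2
  K_pos : 0 < K
  rho_nonneg : 0 ≤ ρ
  memLp_X : MemLp (fun z => M.X (M.Y z.1) z.2) (ENNReal.ofReal r) (P.prod ν)
  memLp_payoff : MemLp (fun ω => M.payoff (M.Y ω)) (ENNReal.ofReal r) P
  X_sub : ∀ k : ℕ, eLpNorm (fun z => M.Xapp k (M.Y z.1) z.2 - M.X (M.Y z.1) z.2)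
    (ENNReal.ofReal r) (P.prod ν) ≤ ENNReal.ofReal (K * 2 ^ (-(1 / 2 - τ) * k))
  DX_r : ∀ ℓ k : ℕ, eLpNorm (fun z => M.DX k (M.Yapp ℓ z.1) z.2)
    (ENNReal.ofReal r) (P.prod ν) ≤ ENNReal.ofReal (K * 2 ^ (-(ζ / 2 - τ) * k))
  DX_two : ∀ ℓ k : ℕ, eLpNorm (fun z => M.DX k (M.Yapp ℓ z.1) z.2)
    2 (P.prod ν) ≤ ENNReal.ofReal (K * 2 ^ (-(β₂ / 2) * k))
  payoff_r : ∀ ℓ : ℕ, eLpNorm (fun ω => M.payoff (M.Y ω) - M.payoff (M.Yapp ℓ ω))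
    (ENNReal.ofReal r) P ≤ ENNReal.ofReal (K * 2 ^ (-(1 / 2 : ℝ) * ℓ))
  payoff_two : ∀ ℓ : ℕ, eLpNorm (fun ω => M.payoff (M.Y ω) - M.payoff (M.Yapp ℓ ω))
    2 P ≤ ENNReal.ofReal (K * 2 ^ (-(βh₂ / 2) * ℓ))
  X_shift_r : ∀ ℓ k : ℕ,
    eLpNorm (fun z => M.Xapp k (M.Y z.1) z.2 - M.Xapp k (M.Yapp ℓ z.1) z.2)
      (ENNReal.ofReal r) (P.prod ν) ≤ ENNReal.ofReal (K * 2 ^ (-(1 / 2 : ℝ) * ℓ))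
  X_shift_two : ∀ ℓ k : ℕ,
    eLpNorm (fun z => M.Xapp k (M.Y z.1) z.2 - M.Xapp k (M.Yapp ℓ z.1) z.2)
      2 (P.prod ν) ≤ ENNReal.ofReal (K * 2 ^ (-(βh₂ / 2) * ℓ))
  DX_shift_two : ∀ ℓ k : ℕ,
    eLpNorm (fun z => M.DX k (M.Yapp (ℓ + 1) z.1) z.2 - M.DX k (M.Yapp ℓ z.1) z.2)
      2 (P.prod ν) ≤ ENNReal.ofReal (K * 2 ^ (-(βh₂ / 2) * ((ℓ + 1 : ℕ) : ℝ)))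
  density : ∀ y : ℝ, 0 < y →
    P {ω | |∫ e, M.X (M.Y ω) e ∂ν - M.payoff (M.Y ω)| < y} ≤ ENNReal.ofReal (ρ * y)
  mean_DX : ∀ ℓ : ℕ, ∀ᵐ ω ∂P, ∀ k : ℕ, ∫ e, M.DX k (M.Yapp ℓ ω) e ∂ν
    = ∫ e, M.Xapp k (M.Yapp ℓ ω) e ∂ν - if k = 0 then 0 else ∫ e, M.Xapp (k - 1) (M.Yapp ℓ ω) e ∂ν

namespace NestedModel

variable {d : ℕ} {Ω E : Type*} [MeasurableSpace Ω] [MeasurableSpace E]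

lemma IsMeasurable.X_comp {M : NestedModel d Ω E} (hM : M.IsMeasurable)
    {Z : Ω → EuclideanSpace ℝ (Fin d)} (hZ : Measurable Z) :
    Measurable fun z : Ω × E => M.X (Z z.1) z.2 :=
  hM.X.comp ((hZ.comp measurable_fst).prodMk measurable_snd)

lemma IsMeasurable.Xapp_comp {M : NestedModel d Ω E} (hM : M.IsMeasurable) (k : ℕ)
    {Z : Ω → EuclideanSpace ℝ (Fin d)} (hZ : Measurable Z) :
    Measurable fun z : Ω × E => M.Xapp k (Z z.1) z.2 :=
  (hM.Xapp k).comp ((hZ.comp measurable_fst).prodMk measurable_snd)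

lemma IsMeasurable.DX_comp {M : NestedModel d Ω E} (hM : M.IsMeasurable) (k : ℕ)
    {Z : Ω → EuclideanSpace ℝ (Fin d)} (hZ : Measurable Z) :
    Measurable fun z : Ω × E => M.DX k (Z z.1) z.2 :=
  (hM.DX k).comp ((hZ.comp measurable_fst).prodMk measurable_snd)

/-- The correction property, with conditional expectations replaced by integrals over the noise. -/
lemma IsCorrectionAt.ae_integral_DX {M : NestedModel d Ω E} (hM : M.IsMeasurable)
    {P : Measure Ω} [IsProbabilityMeasure P] {ν : Measure E} [IsProbabilityMeasure ν]
    {Z : Ω → EuclideanSpace ℝ (Fin d)} (hZ : Measurable Z) (h : M.IsCorrectionAt P ν Z)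
    (hD : ∀ k, Integrable (fun z => M.DX k (Z z.1) z.2) (P.prod ν))
    (hX : ∀ k, Integrable (fun z => M.Xapp k (Z z.1) z.2) (P.prod ν)) :
    ∀ᵐ ω ∂P, ∀ k : ℕ, ∫ e, M.DX k (Z ω) e ∂ν
      = ∫ e, M.Xapp k (Z ω) e ∂ν - if k = 0 then 0 else ∫ e, M.Xapp (k - 1) (Z ω) e ∂ν := by
  refine ae_all_iff.2 fun k => ?_
  let G : EuclideanSpace ℝ (Fin d) → E → ℝ := fun y e =>
    M.Xapp k y e - if k = 0 then 0 else M.Xapp (k - 1) y e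
  have hGm : Measurable (Function.uncurry G) := by
    by_cases hk : k = 0
    · simpa [G, hk, Function.uncurry_def] using hM.Xapp 0
    · simp only [G, hk, Function.uncurry_def, if_false]
      exact (hM.Xapp k).sub (hM.Xapp (k - 1))
  have hGi : Integrable (fun z : Ω × E => G (Z z.1) z.2) (P.prod ν) := by
    by_cases hk : k = 0
    · simpa [G, hk] using hX 0
    · simp only [G, hk, if_false]
      exact (hX k).sub (hX (k - 1))
  have h1 := condExp_prod_comap_fst hZ (hM.DX k) (hD k)
  have h2 := condExp_prod_comap_fst hZ hGm hGi
  have h3 := (h1.symm.trans (h k)).trans h2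
  have h4 := Measure.ae_ae_of_ae_prod h3
  filter_upwards [h4, (hX k).prod_right_ae, (hX (k - 1)).prod_right_ae] with ω hω hi hi'
  obtain ⟨e, he⟩ := hω.exists
  refine he.trans ?_
  by_cases hk : k = 0
  · simp [G, hk]
  · simp only [G, hk, if_false]
    exact integral_sub hi hi'

end NestedModel

namespace NestedModel

variable {d : ℕ} {Ω E : Type*} [MeasurableSpace Ω] [MeasurableSpace E]

lemma InnerRatesAt.exists_eLpNorm_X_le {M : NestedModel d Ω E} {P : Measure Ω} {ν : Measure E}
    {q : ℝ} (hq : 0 < q) {lam : ℝ → ℝ} {a₁ : ℝ} {τ : ℝ} (hτ : 0 < τ) :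
    ∃ K > (0 : ℝ), ∀ (β : ℝ → ℝ) (a₂ : ℝ → ℝ) (Z : Ω → EuclideanSpace ℝ (Fin d)),
      M.InnerRatesAt P ν q β lam a₁ a₂ Z → ∀ k : ℕ,
        eLpNorm (fun z => M.Xapp k (Z z.1) z.2 - M.X (Z z.1) z.2) (ENNReal.ofReal q) (P.prod ν)
          ≤ ENNReal.ofReal (K * 2 ^ (-(1 / 2 - τ) * k)) := by
  obtain ⟨C, hC, hCk⟩ := exists_max_rpow_le (lam q) (mul_pos hτ hq)
  refine ⟨(|(|a₁| * C)| + 1) ^ q⁻¹, by positivity, fun β a₂ Z h k => ?_⟩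
  refine eLpNorm_le_of_absMoment_le hq (by positivity) ((h k).1.trans ?_)
  refine ENNReal.ofReal_le_ofReal ?_
  calc a₁ * (max (k : ℝ) 1) ^ lam q * 2 ^ (-(q * k / 2))
      ≤ |a₁| * (C * 2 ^ (τ * q * k)) * 2 ^ (-(q * k / 2)) := by
        gcongr
        · exact le_abs_self _
        · exact hCk k
    _ = |a₁| * C * (2 ^ (τ * q * k) * 2 ^ (-(q * k / 2))) := by ring
    _ = |a₁| * C * (2 ^ (-(1 / 2 - τ) * k)) ^ q := by
        rw [← Real.rpow_add (by norm_num), ← Real.rpow_mul (by norm_num)]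
        congr 2; ring

lemma InnerRatesAt.exists_eLpNorm_DX_le {M : NestedModel d Ω E} {P : Measure Ω} {ν : Measure E}
    {q p : ℝ} (hp : 0 < p) (hpq : p ≤ q) {β lam : ℝ → ℝ} {a₂ : ℝ → ℝ} {τ : ℝ} (hτ : 0 < τ) :
    ∃ K > (0 : ℝ), ∀ (a₁ : ℝ) (Z : Ω → EuclideanSpace ℝ (Fin d)),
      M.InnerRatesAt P ν q β lam a₁ a₂ Z → ∀ k : ℕ,
        eLpNorm (fun z => M.DX k (Z z.1) z.2) (ENNReal.ofReal p) (P.prod ν)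
          ≤ ENNReal.ofReal (K * 2 ^ (-(β p / 2 - τ) * k)) := by
  obtain ⟨C, hC, hCk⟩ := exists_max_rpow_le (lam p) (mul_pos hτ hp)
  refine ⟨(|(|a₂ p| * C)| + 1) ^ p⁻¹, by positivity, fun a₁ Z h k => ?_⟩
  refine eLpNorm_le_of_absMoment_le hp (by positivity) (((h k).2 p hp hpq).trans ?_)
  refine ENNReal.ofReal_le_ofReal ?_
  calc a₂ p * (max (k : ℝ) 1) ^ lam p * 2 ^ (-(β p * p * k / 2))
      ≤ |a₂ p| * (C * 2 ^ (τ * p * k)) * 2 ^ (-(β p * p * k / 2)) := by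
        gcongr
        · exact le_abs_self _
        · exact hCk k
    _ = |a₂ p| * C * (2 ^ (τ * p * k) * 2 ^ (-(β p * p * k / 2))) := by ring
    _ = |a₂ p| * C * (2 ^ (-(β p / 2 - τ) * k)) ^ p := by
        rw [← Real.rpow_add (by norm_num), ← Real.rpow_mul (by norm_num)]
        congr 2; ring

/-- Without a logarithmic factor there is no loss in the rate. -/
lemma InnerRatesAt.eLpNorm_DX_two_le {M : NestedModel d Ω E} {P : Measure Ω} {ν : Measure E}
    {q : ℝ} (hq : 2 < q) {β lam : ℝ → ℝ} (hlam : lam 2 = 0) {a₁ : ℝ} {a₂ : ℝ → ℝ}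
    {Z : Ω → EuclideanSpace ℝ (Fin d)} (h : M.InnerRatesAt P ν q β lam a₁ a₂ Z) (k : ℕ) :
    eLpNorm (fun z => M.DX k (Z z.1) z.2) 2 (P.prod ν)
      ≤ ENNReal.ofReal ((|a₂ 2| + 1) ^ (2 : ℝ)⁻¹ * 2 ^ (-(β 2 / 2) * k)) := by
  rw [← ENNReal.ofReal_ofNat 2]
  refine eLpNorm_le_of_absMoment_le (by norm_num) (by positivity)
    (((h k).2 2 (by norm_num) hq.le).trans (ENNReal.ofReal_le_ofReal (le_of_eq ?_)))
  rw [hlam, Real.rpow_zero, mul_one, ← Real.rpow_mul (by norm_num)]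
  congr 2; ring

lemma eLpNorm_le_of_absMoment_rate {α : Type*} [MeasurableSpace α] {μ : Measure α} {f : α → ℝ}
    {p a b x : ℝ} (hp : 0 < p)
    (h : absMoment μ f p ≤ ENNReal.ofReal (a * 2 ^ (-(b * p * x / 2)))) :
    eLpNorm f (ENNReal.ofReal p) μ ≤ ENNReal.ofReal ((|a| + 1) ^ p⁻¹ * 2 ^ (-(b / 2) * x)) := by
  refine eLpNorm_le_of_absMoment_le hp (by positivity) (h.trans (le_of_eq ?_))
  rw [← Real.rpow_mul (by norm_num)]
  congr 3; ring

lemma memLp_of_absMoment_lt_top {α : Type*} [MeasurableSpace α] {μ : Measure α} {f : α → ℝ}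
    (hf : Measurable f) {p : ℝ} (hp : 0 < p) (h : absMoment μ f p < ∞) :
    MemLp f (ENNReal.ofReal p) μ := by
  refine ⟨hf.aestronglyMeasurable, ?_⟩
  have h' : absMoment μ f p ≤ ENNReal.ofReal ((absMoment μ f p).toReal * 1 ^ p) := by
    rw [Real.one_rpow, mul_one, ENNReal.ofReal_toReal h.ne]
  exact (eLpNorm_le_of_absMoment_le hp zero_le_one h').trans_lt ENNReal.ofReal_lt_top

lemma memLp_of_sub_memLp {α : Type*} [MeasurableSpace α] {μ : Measure α} {f g : α → ℝ} {p : ℝ≥0∞}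
    (hg : MemLp g p μ) (h : MemLp (fun x => f x - g x) p μ) : MemLp f p μ := by
  have := h.add hg
  convert this using 1
  ext x; simp

/-- The assumptions of the complexity theorem imply geometric rates for every `2 < r ≤ min q 3` and
every loss `τ`. -/
theorem exists_geometricRates (P : Measure Ω) [IsProbabilityMeasure P] (ν : Measure E)
    [IsProbabilityMeasure ν] (M : NestedModel d Ω E) (hM : M.IsMeasurable)
    (hcorrApp : ∀ ℓ, M.IsCorrectionAt P ν (M.Yapp ℓ))
    {q : ℝ} (hq : 2 < q) {β βh lam : ℝ → ℝ} (hmom : M.MomentDensity P ν q)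
    (hexact : M.ExactOuterRates P ν q β lam) (happrox : M.ApproxOuterRates P ν q β lam)
    (houter : M.OuterRates P ν q βh) (hlam : lam 2 = 0) {ζ : ℝ} (hζβ : ζ ≤ β q)
    {r τ : ℝ} (hr2 : 2 < r) (hr3 : r ≤ 3) (hrq : r ≤ q) (hτ : 0 < τ) (hτ' : τ < 1 / 2) :
    ∃ K ρ : ℝ, M.GeometricRates P ν r τ ζ (β 2) (βh 2) K ρ := by
  have hq0 : 0 < q := by linarith
  obtain ⟨hmom, δ, hδ, ρ, hρ, hdens⟩ := hmom
  obtain ⟨-, -, b₁, b₂, -, hexact⟩ := hexact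
  obtain ⟨-, -, c₁, c₂, -, happrox⟩ := happrox
  obtain ⟨hβhq, a₃, a₄, a₅, h₃, h₄, h₅⟩ := houter.2 q hq0 le_rfl
  obtain ⟨-, e₃, e₄, e₅, g₃, g₄, g₅⟩ := houter.2 2 (by norm_num) hq.le
  obtain ⟨K₁, hK₁, hX⟩ := InnerRatesAt.exists_eLpNorm_X_le (M := M) (P := P) (ν := ν) hq0
    (lam := lam) (a₁ := b₁) hτ
  obtain ⟨K₂, hK₂, hD⟩ := InnerRatesAt.exists_eLpNorm_DX_le (M := M) (P := P) (ν := ν) hq0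
    le_rfl (β := β) (lam := lam) (a₂ := c₂) hτ
  have hrq' : ENNReal.ofReal r ≤ ENNReal.ofReal q := ENNReal.ofReal_le_ofReal hrq
  have hr1 : (1 : ℝ≥0∞) ≤ ENNReal.ofReal r := by simp; linarith
  set K₃ : ℝ := (|a₃| + 1) ^ q⁻¹ with hK₃
  set K₄ : ℝ := (|a₄| + 1) ^ q⁻¹ with hK₄
  set K₆ : ℝ := (|e₃| + 1) ^ (2 : ℝ)⁻¹ with hK₆
  set K₇ : ℝ := (|e₄| + 1) ^ (2 : ℝ)⁻¹ with hK₇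
  set K₈ : ℝ := (|e₅| + 1) ^ (2 : ℝ)⁻¹ with hK₈
  set K₉ : ℝ := (|c₂ 2| + 1) ^ (2 : ℝ)⁻¹ with hK₉
  have p₃ : 0 < K₃ := by positivity
  have p₄ : 0 < K₄ := by positivity
  have p₆ : 0 < K₆ := by positivity
  have p₇ : 0 < K₇ := by positivity
  have p₈ : 0 < K₈ := by positivity
  have p₉ : 0 < K₉ := by positivity
  set K := K₁ + K₂ + K₃ + K₄ + K₆ + K₇ + K₈ + K₉ with hK
  have hmono : ∀ {K' x : ℝ}, K' ≤ K → 0 ≤ x → ENNReal.ofReal (K' * x) ≤ ENNReal.ofReal (K * x) :=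
    fun h hx => ENNReal.ofReal_le_ofReal (mul_le_mul_of_nonneg_right h hx)
  have mX := hM.X_comp hM.Y
  have mXk := fun k => hM.Xapp_comp k hM.Y
  have mXk' := fun ℓ k => hM.Xapp_comp k (hM.Yapp ℓ)
  have mD := fun ℓ k => hM.DX_comp k (hM.Yapp ℓ)
  have mπ : Measurable fun ω => M.payoff (M.Y ω) := hM.payoff.comp hM.Y
  have mπ' : ∀ ℓ, Measurable fun ω => M.payoff (M.Yapp ℓ ω) := fun ℓ => hM.payoff.comp (hM.Yapp ℓ)
  have hmX : MemLp (fun z => M.X (M.Y z.1) z.2) (ENNReal.ofReal r) (P.prod ν) :=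
    (memLp_of_absMoment_lt_top mX hq0 ((le_add_right le_rfl).trans_lt hmom)).mono_exponent hrq'
  have hmπ : MemLp (fun ω => M.payoff (M.Y ω)) (ENNReal.ofReal r) P :=
    (memLp_of_absMoment_lt_top mπ hq0 ((le_add_left le_rfl).trans_lt hmom)).mono_exponent hrq'
  have fX : ∀ k : ℕ, eLpNorm (fun z => M.Xapp k (M.Y z.1) z.2 - M.X (M.Y z.1) z.2)
      (ENNReal.ofReal r) (P.prod ν) ≤ ENNReal.ofReal (K * 2 ^ (-(1 / 2 - τ) * k)) := fun k =>
    (eLpNorm_le_eLpNorm_of_exponent_le hrq' ((mXk k).sub mX).aestronglyMeasurable).trans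
      ((hX β b₂ M.Y hexact k).trans (hmono (by linarith) (by positivity)))
  have fD : ∀ ℓ k : ℕ, eLpNorm (fun z => M.DX k (M.Yapp ℓ z.1) z.2)
      (ENNReal.ofReal r) (P.prod ν) ≤ ENNReal.ofReal (K * 2 ^ (-(ζ / 2 - τ) * k)) := fun ℓ k =>
    (eLpNorm_le_eLpNorm_of_exponent_le hrq' (mD ℓ k).aestronglyMeasurable).trans
      ((hD c₁ _ (happrox ℓ) k).trans ((hmono (by linarith) (by positivity)).trans
        (ENNReal.ofReal_le_ofReal (by gcongr; norm_num))))
  have hrate : ∀ ℓ : ℕ, (2 : ℝ) ^ (-(βh q / 2) * ℓ) ≤ 2 ^ (-(1 / 2 : ℝ) * ℓ) := fun ℓ => by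
    gcongr
    norm_num
  have fS : ∀ ℓ k : ℕ,
      eLpNorm (fun z => M.Xapp k (M.Y z.1) z.2 - M.Xapp k (M.Yapp ℓ z.1) z.2)
        (ENNReal.ofReal r) (P.prod ν) ≤ ENNReal.ofReal (K * 2 ^ (-(1 / 2 : ℝ) * ℓ)) := fun ℓ k =>
    (eLpNorm_le_eLpNorm_of_exponent_le hrq' ((mXk k).sub (mXk' ℓ k)).aestronglyMeasurable).trans
      ((eLpNorm_le_of_absMoment_rate hq0 (h₄ ℓ k)).trans ((hmono (by linarith)
        (by positivity)).trans (ENNReal.ofReal_le_ofReal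
          (mul_le_mul_of_nonneg_left (hrate ℓ) (by positivity)))))
  have hXk : ∀ k, MemLp (fun z => M.Xapp k (M.Y z.1) z.2) (ENNReal.ofReal r) (P.prod ν) :=
    fun k => memLp_of_sub_memLp hmX
      ⟨((mXk k).sub mX).aestronglyMeasurable, (fX k).trans_lt ENNReal.ofReal_lt_top⟩
  have hXk' : ∀ ℓ k, MemLp (fun z => M.Xapp k (M.Yapp ℓ z.1) z.2) (ENNReal.ofReal r) (P.prod ν) :=
    fun ℓ k => by
      have h : MemLp (fun z => M.Xapp k (M.Y z.1) z.2 - M.Xapp k (M.Yapp ℓ z.1) z.2)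
        (ENNReal.ofReal r) (P.prod ν) :=
        ⟨((mXk k).sub (mXk' ℓ k)).aestronglyMeasurable, (fS ℓ k).trans_lt ENNReal.ofReal_lt_top⟩
      have h' := (hXk k).sub h
      convert h' using 1
      ext z; simp
  refine ⟨K, max ρ δ⁻¹, hM, hr2, hr3, hτ, hτ', by positivity, by positivity, hmX, hmπ, fX, fD, ?_,
    ?_, ?_, fS, ?_, ?_, ?_, ?_⟩
  · exact fun ℓ k => ((happrox ℓ).eLpNorm_DX_two_le hq hlam k).trans
      (hmono (by linarith) (by positivity))
  · exact fun ℓ => (eLpNorm_le_eLpNorm_of_exponent_le hrq'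
      (mπ.sub (mπ' ℓ)).aestronglyMeasurable).trans
      ((eLpNorm_le_of_absMoment_rate hq0 (h₃ ℓ)).trans ((hmono (by linarith)
        (by positivity)).trans (ENNReal.ofReal_le_ofReal
          (mul_le_mul_of_nonneg_left (hrate ℓ) (by positivity)))))
  · intro ℓ
    have := eLpNorm_le_of_absMoment_rate (by norm_num) (g₃ ℓ)
    rw [ENNReal.ofReal_ofNat] at this
    exact this.trans (hmono (by linarith) (by positivity))
  · intro ℓ k
    have := eLpNorm_le_of_absMoment_rate (by norm_num) (g₄ ℓ k)
    rw [ENNReal.ofReal_ofNat] at this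
    exact this.trans (hmono (by linarith) (by positivity))
  · intro ℓ k
    have := eLpNorm_le_of_absMoment_rate (by norm_num) (g₅ (ℓ + 1) k (by omega))
    rw [ENNReal.ofReal_ofNat] at this
    exact this.trans (hmono (by linarith) (by positivity))
  · intro y hy
    rcases lt_or_ge y δ with hyδ | hyδ
    · have hU := condExp_prod_comap_fst hM.Y hM.X (hmX.integrable hr1)
      have hset : (P.prod ν) {z | |M.U₁ P ν z - M.payoff (M.Y z.1)| < y}
          = (P.prod ν) ({ω | |∫ e, M.X (M.Y ω) e ∂ν - M.payoff (M.Y ω)| < y} ×ˢ Set.univ) := by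
        refine measure_congr ?_
        filter_upwards [hU] with z hz
        have hz' : M.U₁ P ν z = ∫ e, M.X (M.Y z.1) e ∂ν := hz
        refine propext ?_
        change |M.U₁ P ν z - M.payoff (M.Y z.1)| < y ↔
          |∫ e, M.X (M.Y z.1) e ∂ν - M.payoff (M.Y z.1)| < y ∧ z.2 ∈ Set.univ
        rw [hz']
        simp
      have := hdens y hyδ
      rw [hset, Measure.prod_prod, measure_univ, mul_one] at this
      refine this.trans (ENNReal.ofReal_le_ofReal ?_)
      gcongr
      exact le_max_left _ _
    · refine prob_le_one.trans ?_
      rw [← ENNReal.ofReal_one]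
      refine ENNReal.ofReal_le_ofReal ?_
      calc (1 : ℝ) = δ⁻¹ * δ := (inv_mul_cancel₀ hδ.ne').symm
        _ ≤ max ρ δ⁻¹ * y := by
          gcongr
          exact le_max_right _ _
  · intro ℓ
    refine (hcorrApp ℓ).ae_integral_DX hM (hM.Yapp ℓ) (fun k => ?_)
      fun k => (hXk' ℓ k).integrable hr1
    exact MemLp.integrable hr1
      ⟨(mD ℓ k).aestronglyMeasurable, (fD ℓ k).trans_lt ENNReal.ofReal_lt_top⟩

end NestedModel

/-! ### Errors of the inner estimators -/

namespace NestedModel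

variable {d : ℕ} {Ω E : Type*} [MeasurableSpace Ω] [MeasurableSpace E]

lemma IsMeasurable.levelMean {M : NestedModel d Ω E} (hM : M.IsMeasurable) (N : ℕ → ℕ → ℕ)
    (ℓ k : ℕ) (j : Fin 3) {Z : Ω → EuclideanSpace ℝ (Fin d)} (hZ : Measurable Z) :
    Measurable fun s : Scenario Ω E => M.levelMean N ℓ k j (Z s.1) s.2 := by
  unfold NestedModel.levelMean
  refine Measurable.const_mul (Finset.measurable_sum _ fun n _ => ?_) _
  exact (hM.DX k).comp ((hZ.comp measurable_fst).prodMk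
    ((measurable_pi_apply (j, k, n)).comp measurable_snd))

lemma IsMeasurable.innerML {M : NestedModel d Ω E} (hM : M.IsMeasurable) (N : ℕ → ℕ → ℕ)
    (ℓ : ℕ) (j : Fin 3) {Z : Ω → EuclideanSpace ℝ (Fin d)} (hZ : Measurable Z) :
    Measurable fun s : Scenario Ω E => M.innerML N ℓ j (Z s.1) s.2 :=
  Finset.measurable_sum _ fun k _ => hM.levelMean N ℓ k j hZ

lemma IsMeasurable.fineML {M : NestedModel d Ω E} (hM : M.IsMeasurable) (N : ℕ → ℕ → ℕ)
    (ℓ : ℕ) {Z : Ω → EuclideanSpace ℝ (Fin d)} (hZ : Measurable Z) :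
    Measurable fun s : Scenario Ω E => M.fineML N ℓ (Z s.1) s.2 := by
  cases ℓ with
  | zero => exact hM.levelMean N 0 0 2 hZ
  | succ ℓ =>
    exact (((hM.innerML N ℓ 0 hZ).add (hM.innerML N ℓ 1 hZ)).const_mul _).add
      (hM.levelMean N (ℓ + 1) (ℓ + 1) 2 hZ)

lemma IsMeasurable.payoff_comp {M : NestedModel d Ω E} (hM : M.IsMeasurable)
    {Z : Ω → EuclideanSpace ℝ (Fin d)} (hZ : Measurable Z) :
    Measurable fun s : Scenario Ω E => M.payoff (Z s.1) :=
  (hM.payoff.comp hZ).comp measurable_fst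

lemma IsMeasurable.antitheticCorrection {M : NestedModel d Ω E} (hM : M.IsMeasurable)
    (N : ℕ → ℕ → ℕ) (ℓ : ℕ) : Measurable (M.antitheticCorrection N ℓ) := by
  cases ℓ with
  | zero => exact (hM.fineML N 0 (hM.Yapp 0)).max (hM.payoff_comp (hM.Yapp 0))
  | succ ℓ =>
    exact ((hM.fineML N (ℓ + 1) (hM.Yapp _)).max (hM.payoff_comp (hM.Yapp _))).sub
      ((((hM.innerML N ℓ 0 (hM.Yapp ℓ)).max (hM.payoff_comp (hM.Yapp _))).add
        ((hM.innerML N ℓ 1 (hM.Yapp ℓ)).max (hM.payoff_comp (hM.Yapp _)))).const_mul _)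

/-- The inner mean `y ↦ E[X(y)]`, which is a version of `U₁` when evaluated at `Y`. -/
noncomputable def innerMean (M : NestedModel d Ω E) (ν : Measure E)
    (y : EuclideanSpace ℝ (Fin d)) : ℝ := ∫ e, M.X y e ∂ν

/-- The inner mean `y ↦ E[X_k(y)]` of the approximation of level `k`. -/
noncomputable def innerMeanApp (M : NestedModel d Ω E) (ν : Measure E) (k : ℕ)
    (y : EuclideanSpace ℝ (Fin d)) : ℝ := ∫ e, M.Xapp k y e ∂ν

lemma IsMeasurable.innerMean {M : NestedModel d Ω E} (hM : M.IsMeasurable) (ν : Measure E)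
    [SFinite ν] : Measurable (M.innerMean ν) :=
  (hM.X.stronglyMeasurable.integral_prod_right' (ν := ν)).measurable

lemma IsMeasurable.innerMeanApp {M : NestedModel d Ω E} (hM : M.IsMeasurable) (ν : Measure E)
    [SFinite ν] (k : ℕ) : Measurable (M.innerMeanApp ν k) :=
  ((hM.Xapp k).stronglyMeasurable.integral_prod_right' (ν := ν)).measurable

lemma sum_range_sub_pred (x : ℕ → ℝ) (ℓ : ℕ) :
    ∑ k ∈ Finset.range (ℓ + 1), (x k - if k = 0 then 0 else x (k - 1)) = x ℓ := by
  induction ℓ with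
  | zero => simp
  | succ ℓ ih => rw [Finset.sum_range_succ, ih]; simp

lemma eLpNorm_scenario_fst {P : Measure Ω} [IsProbabilityMeasure P] {ν : Measure E}
    [IsProbabilityMeasure ν] {f : Ω → ℝ} (hf : Measurable f) (p : ℝ≥0∞) :
    eLpNorm (fun s : Scenario Ω E => f s.1) p (scenarioMeasure P ν) = eLpNorm f p P :=
  eLpNorm_comp_measurePreserving hf.aestronglyMeasurable
    (measurePreserving_fst (μ := P) (ν := Measure.infinitePi fun _ : Fin 3 × ℕ × ℕ => ν))

namespace GeometricRates

variable {P : Measure Ω} {ν : Measure E}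
  {M : NestedModel d Ω E} {r τ ζ β₂ βh₂ K ρ : ℝ}

lemma one_le_ofReal (h : M.GeometricRates P ν r τ ζ β₂ βh₂ K ρ) : 1 ≤ ENNReal.ofReal r := by
  have := h.two_lt
  simp; linarith

lemma two_le_ofReal (h : M.GeometricRates P ν r τ ζ β₂ βh₂ K ρ) : 2 ≤ ENNReal.ofReal r := by
  rw [← ENNReal.ofReal_ofNat 2]; exact ENNReal.ofReal_le_ofReal h.two_lt.le

lemma memLp_Xapp_Y (h : M.GeometricRates P ν r τ ζ β₂ βh₂ K ρ) (k : ℕ) :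
    MemLp (fun z => M.Xapp k (M.Y z.1) z.2) (ENNReal.ofReal r) (P.prod ν) :=
  memLp_of_sub_memLp h.memLp_X
    ⟨((h.meas.Xapp_comp k h.meas.Y).sub (h.meas.X_comp h.meas.Y)).aestronglyMeasurable,
      (h.X_sub k).trans_lt ENNReal.ofReal_lt_top⟩

lemma memLp_Xapp_Yapp (h : M.GeometricRates P ν r τ ζ β₂ βh₂ K ρ) (ℓ k : ℕ) :
    MemLp (fun z => M.Xapp k (M.Yapp ℓ z.1) z.2) (ENNReal.ofReal r) (P.prod ν) := by
  have h1 : MemLp (fun z => M.Xapp k (M.Y z.1) z.2 - M.Xapp k (M.Yapp ℓ z.1) z.2)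
      (ENNReal.ofReal r) (P.prod ν) :=
    ⟨((h.meas.Xapp_comp k h.meas.Y).sub (h.meas.Xapp_comp k (h.meas.Yapp ℓ))).aestronglyMeasurable,
      (h.X_shift_r ℓ k).trans_lt ENNReal.ofReal_lt_top⟩
  have h2 := (h.memLp_Xapp_Y k).sub h1
  convert h2 using 1
  ext z; simp

lemma memLp_payoff_Yapp (h : M.GeometricRates P ν r τ ζ β₂ βh₂ K ρ) (ℓ : ℕ) :
    MemLp (fun ω => M.payoff (M.Yapp ℓ ω)) (ENNReal.ofReal r) P := by
  have h1 : MemLp (fun ω => M.payoff (M.Y ω) - M.payoff (M.Yapp ℓ ω)) (ENNReal.ofReal r) P :=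
    ⟨((h.meas.payoff.comp h.meas.Y).sub
      (h.meas.payoff.comp (h.meas.Yapp ℓ))).aestronglyMeasurable,
      (h.payoff_r ℓ).trans_lt ENNReal.ofReal_lt_top⟩
  have h2 := h.memLp_payoff.sub h1
  convert h2 using 1
  ext z; simp

/-- The sum of the means of the corrections up to level `ℓ` is the mean of `X_ℓ`. -/
lemma ae_sum_integral_DX (h : M.GeometricRates P ν r τ ζ β₂ βh₂ K ρ) (ℓ' : ℕ) :
    ∀ᵐ ω ∂P, ∀ ℓ : ℕ, ∑ k ∈ Finset.range (ℓ + 1), ∫ e, M.DX k (M.Yapp ℓ' ω) e ∂ν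
      = M.innerMeanApp ν ℓ (M.Yapp ℓ' ω) := by
  filter_upwards [h.mean_DX ℓ'] with ω hω ℓ
  rw [Finset.sum_congr rfl fun k _ => hω k]
  exact sum_range_sub_pred (fun k => ∫ e, M.Xapp k (M.Yapp ℓ' ω) e ∂ν) ℓ

variable [IsProbabilityMeasure ν]

lemma memLp_innerMean (h : M.GeometricRates P ν r τ ζ β₂ βh₂ K ρ) :
    MemLp (fun ω => M.innerMean ν (M.Y ω)) (ENNReal.ofReal r) P :=
  ⟨((h.meas.innerMean ν).comp h.meas.Y).aestronglyMeasurable,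
    (eLpNorm_integral_right_le (by linarith [h.two_lt]) (h.meas.X_comp h.meas.Y)).trans_lt
      h.memLp_X.2⟩

lemma memLp_scenario_fst {f : Ω → ℝ} {p : ℝ≥0∞} (hf : MemLp f p P) :
    MemLp (fun s : Scenario Ω E => f s.1) p (scenarioMeasure P ν) :=
  hf.comp_measurePreserving
    (measurePreserving_fst (μ := P) (ν := Measure.infinitePi fun _ : Fin 3 × ℕ × ℕ => ν))

/-- The `L^r` distance of an inner multilevel estimator from its conditional mean.  The number
`N ℓ k ≳ 2 ^ (ℓ - ζ * k)` of samples exactly compensates the rate `ζ` of the corrections. -/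
lemma exists_eLpNorm_innerML_sub_le (h : M.GeometricRates P ν r τ ζ β₂ βh₂ K ρ) {N : ℕ → ℕ → ℕ}
    {c : ℝ} (hc : 0 < c) (hN : ∀ ℓ k : ℕ, k ≤ ℓ → c * max ((2 : ℝ) ^ ((ℓ : ℝ) - ζ * k)) 1 ≤ N ℓ k) :
    ∃ C > (0 : ℝ), ∀ (ℓ ℓ' : ℕ) (j : Fin 3),
      eLpNorm (fun s : Scenario Ω E => M.innerML N ℓ j (M.Yapp ℓ' s.1) s.2
          - M.innerMeanApp ν ℓ (M.Yapp ℓ' s.1)) (ENNReal.ofReal r) (scenarioMeasure P ν)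
        ≤ ENNReal.ofReal (C * 2 ^ (-(1 / 2 - τ) * ℓ)) := by
  have hK := h.K_pos
  have hr0 : 0 < r := by linarith [h.two_lt]
  have h2τ : (1 : ℝ) < 2 ^ τ := Real.one_lt_rpow (by norm_num) h.tau_pos
  have h2τ' : (0 : ℝ) < 2 ^ τ - 1 := by linarith
  refine ⟨44 * K * c ^ (-(1 / 2) : ℝ) * (2 ^ τ / (2 ^ τ - 1)), by positivity, fun ℓ ℓ' j => ?_⟩
  have hDm := fun k => h.meas.DX_comp k (h.meas.Yapp ℓ')
  have hIm : ∀ k, Measurable fun ω => ∫ e, M.DX k (M.Yapp ℓ' ω) e ∂ν := fun k =>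
    ((hDm k).stronglyMeasurable.integral_prod_right' (ν := ν)).measurable
  -- the sample mean of level `k` has error `2 ^ (τ * k - ℓ / 2)`; the sum over `k` is geometric
  have hterm : ∀ k ∈ Finset.range (ℓ + 1),
      eLpNorm (fun s : Scenario Ω E => M.levelMean N ℓ k j (M.Yapp ℓ' s.1) s.2
          - ∫ e, M.DX k (M.Yapp ℓ' s.1) e ∂ν) (ENNReal.ofReal r) (scenarioMeasure P ν)
        ≤ ENNReal.ofReal (44 * K * c ^ (-(1 / 2) : ℝ) * 2 ^ (-(1 / 2 : ℝ) * ℓ) * (2 ^ τ) ^ k) := by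
    intro k hk
    have hkℓ : k ≤ ℓ := by have := Finset.mem_range.1 hk; omega
    have hNk : c * (2 : ℝ) ^ ((ℓ : ℝ) - ζ * k) ≤ N ℓ k :=
      (mul_le_mul_of_nonneg_left (le_max_left _ _) hc.le).trans (hN ℓ k hkℓ)
    have hpos : (0 : ℝ) < c * (2 : ℝ) ^ ((ℓ : ℝ) - ζ * k) := by positivity
    have hNpos : 0 < N ℓ k := by exact_mod_cast hpos.trans_le hNk
    have hidx : Function.Injective fun n : ℕ => (j, k, n) := fun a b hab => by simpa using hab
    have hprod := eLpNorm_prod_le_of_ae (P := P)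
      (μ := Measure.infinitePi fun _ : Fin 3 × ℕ × ℕ => ν) (ν := ν) hr0
      (F := fun s : Scenario Ω E => M.levelMean N ℓ k j (M.Yapp ℓ' s.1) s.2
          - ∫ e, M.DX k (M.Yapp ℓ' s.1) e ∂ν)
      (H := fun z => M.DX k (M.Yapp ℓ' z.1) z.2)
      (c := ENNReal.ofReal (44 * (N ℓ k : ℝ) ^ (-(1 / 2) : ℝ)))
      ((h.meas.levelMean N ℓ k j (h.meas.Yapp ℓ')).sub ((hIm k).comp measurable_fst)) (hDm k)
      (Filter.Eventually.of_forall fun ω =>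
        eLpNorm_sampleMean_sub_le h.two_lt h.le_three hidx
          (h := fun e => M.DX k (M.Yapp ℓ' ω) e) ((hDm k).comp measurable_prodMk_left) hNpos)
    refine hprod.trans ((mul_le_mul_right (h.DX_r ℓ' k) _).trans ?_)
    rw [← ENNReal.ofReal_mul (by positivity)]
    refine ENNReal.ofReal_le_ofReal ?_
    have hpow : (N ℓ k : ℝ) ^ (-(1 / 2) : ℝ)
        ≤ c ^ (-(1 / 2) : ℝ) * 2 ^ (((ℓ : ℝ) - ζ * k) * (-(1 / 2))) := by
      refine (Real.rpow_le_rpow_of_nonpos hpos hNk (by norm_num)).trans (le_of_eq ?_)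
      rw [Real.mul_rpow hc.le (by positivity), ← Real.rpow_mul (by norm_num)]
    calc 44 * (N ℓ k : ℝ) ^ (-(1 / 2) : ℝ) * (K * 2 ^ (-(ζ / 2 - τ) * k))
        ≤ 44 * (c ^ (-(1 / 2) : ℝ) * 2 ^ (((ℓ : ℝ) - ζ * k) * (-(1 / 2))))
            * (K * 2 ^ (-(ζ / 2 - τ) * k)) := by gcongr
      _ = 44 * K * c ^ (-(1 / 2) : ℝ)
            * (2 ^ (((ℓ : ℝ) - ζ * k) * (-(1 / 2))) * 2 ^ (-(ζ / 2 - τ) * k)) := by ring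
      _ = 44 * K * c ^ (-(1 / 2) : ℝ) * (2 ^ (-(1 / 2 : ℝ) * ℓ) * (2 ^ τ) ^ k) := by
          rw [← Real.rpow_natCast (2 ^ τ) k, ← Real.rpow_mul (by norm_num),
            ← Real.rpow_add (by norm_num), ← Real.rpow_add (by norm_num)]
          congr 2; ring
      _ = _ := by ring
  have hae : (fun s : Scenario Ω E => M.innerML N ℓ j (M.Yapp ℓ' s.1) s.2
        - M.innerMeanApp ν ℓ (M.Yapp ℓ' s.1)) =ᵐ[scenarioMeasure P ν]
      ∑ k ∈ Finset.range (ℓ + 1), fun s : Scenario Ω E =>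
        M.levelMean N ℓ k j (M.Yapp ℓ' s.1) s.2 - ∫ e, M.DX k (M.Yapp ℓ' s.1) e ∂ν := by
    have h1 : ∀ᵐ s ∂(scenarioMeasure P ν), ∀ ℓ : ℕ,
        ∑ k ∈ Finset.range (ℓ + 1), ∫ e, M.DX k (M.Yapp ℓ' s.1) e ∂ν
          = M.innerMeanApp ν ℓ (M.Yapp ℓ' s.1) :=
      Measure.quasiMeasurePreserving_fst.ae (h.ae_sum_integral_DX ℓ')
    filter_upwards [h1] with s hs
    rw [Finset.sum_apply, Finset.sum_sub_distrib, hs ℓ]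
    rfl
  rw [eLpNorm_congr_ae hae]
  refine (eLpNorm_sum_le (fun k _ => ((h.meas.levelMean N ℓ k j (h.meas.Yapp ℓ')).sub
    ((hIm k).comp measurable_fst)).aestronglyMeasurable) h.one_le_ofReal).trans ?_
  refine (Finset.sum_le_sum hterm).trans ?_
  rw [← ENNReal.ofReal_sum_of_nonneg fun k _ => by positivity]
  refine ENNReal.ofReal_le_ofReal ?_
  rw [← Finset.mul_sum]
  calc 44 * K * c ^ (-(1 / 2) : ℝ) * 2 ^ (-(1 / 2 : ℝ) * ℓ)
        * ∑ k ∈ Finset.range (ℓ + 1), ((2 : ℝ) ^ τ) ^ k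
      ≤ 44 * K * c ^ (-(1 / 2) : ℝ) * 2 ^ (-(1 / 2 : ℝ) * ℓ)
        * (2 ^ τ / (2 ^ τ - 1) * (2 ^ τ) ^ ℓ) := by
        gcongr
        exact geom_sum_le_of_one_lt h2τ ℓ
    _ = 44 * K * c ^ (-(1 / 2) : ℝ) * (2 ^ τ / (2 ^ τ - 1))
        * (2 ^ (-(1 / 2 : ℝ) * ℓ) * (2 ^ τ) ^ ℓ) := by ring
    _ = _ := by
        rw [← Real.rpow_natCast (2 ^ τ) ℓ, ← Real.rpow_mul (by norm_num),
          ← Real.rpow_add (by norm_num)]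
        congr 2; ring

variable [IsProbabilityMeasure P]

/-- The `L^r` distance between `E[X_ℓ(Y_ℓ') | Y_ℓ']` and `E[X(Y) | Y]` for `ℓ ≤ ℓ'`. -/
lemma eLpNorm_innerMeanApp_sub_le (h : M.GeometricRates P ν r τ ζ β₂ βh₂ K ρ) {ℓ ℓ' : ℕ}
    (hℓ : ℓ ≤ ℓ') :
    eLpNorm (fun ω => M.innerMeanApp ν ℓ (M.Yapp ℓ' ω) - M.innerMean ν (M.Y ω))
      (ENNReal.ofReal r) P ≤ ENNReal.ofReal (2 * K * 2 ^ (-(1 / 2 - τ) * ℓ)) := by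
  have hK := h.K_pos
  have hr1 : 1 ≤ r := by linarith [h.two_lt]
  have hX := h.meas.X_comp h.meas.Y
  have hXk := h.meas.Xapp_comp ℓ h.meas.Y
  have hXk' := h.meas.Xapp_comp ℓ (h.meas.Yapp ℓ')
  have hae : (fun ω => M.innerMeanApp ν ℓ (M.Yapp ℓ' ω) - M.innerMean ν (M.Y ω)) =ᵐ[P]
      fun ω => ∫ e, (M.Xapp ℓ (M.Yapp ℓ' ω) e - M.X (M.Y ω) e) ∂ν := by
    filter_upwards [((h.memLp_Xapp_Yapp ℓ' ℓ).integrable h.one_le_ofReal).prod_right_ae,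
      (h.memLp_X.integrable h.one_le_ofReal).prod_right_ae] with ω h1 h2
    exact (integral_sub h1 h2).symm
  rw [eLpNorm_congr_ae hae]
  refine (eLpNorm_integral_right_le hr1
    (H := fun z => M.Xapp ℓ (M.Yapp ℓ' z.1) z.2 - M.X (M.Y z.1) z.2) (hXk'.sub hX)).trans ?_
  have e : (fun z : Ω × E => M.Xapp ℓ (M.Yapp ℓ' z.1) z.2 - M.X (M.Y z.1) z.2)
      = (fun z => M.Xapp ℓ (M.Y z.1) z.2 - M.X (M.Y z.1) z.2)
        - fun z => M.Xapp ℓ (M.Y z.1) z.2 - M.Xapp ℓ (M.Yapp ℓ' z.1) z.2 := by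
    ext z; simp
  rw [e]
  refine (eLpNorm_sub_le (hXk.sub hX).aestronglyMeasurable (hXk.sub hXk').aestronglyMeasurable
    h.one_le_ofReal).trans ((add_le_add (h.X_sub ℓ) (h.X_shift_r ℓ' ℓ)).trans ?_)
  rw [← ENNReal.ofReal_add (by positivity) (by positivity)]
  refine ENNReal.ofReal_le_ofReal ?_
  have : (2 : ℝ) ^ (-(1 / 2 : ℝ) * ℓ') ≤ 2 ^ (-(1 / 2 - τ) * ℓ) := by
    refine Real.rpow_le_rpow_of_exponent_le (by norm_num) ?_
    have h1 : (ℓ : ℝ) ≤ ℓ' := by exact_mod_cast hℓ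
    have h2 : 0 ≤ τ * ℓ := mul_nonneg h.tau_pos.le (by positivity)
    linarith
  nlinarith

/-- The `L^r` error of the margin `innerML - payoff` at `Y_ℓ'` relative to the exact margin
`U₁(Y) - payoff(Y)`. -/
lemma exists_eLpNorm_margin_sub_le (h : M.GeometricRates P ν r τ ζ β₂ βh₂ K ρ) {N : ℕ → ℕ → ℕ}
    {c : ℝ} (hc : 0 < c) (hN : ∀ ℓ k : ℕ, k ≤ ℓ → c * max ((2 : ℝ) ^ ((ℓ : ℝ) - ζ * k)) 1 ≤ N ℓ k) :
    ∃ C > (0 : ℝ), ∀ (ℓ ℓ' : ℕ) (j : Fin 3), ℓ ≤ ℓ' →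
      eLpNorm (fun s : Scenario Ω E => M.innerML N ℓ j (M.Yapp ℓ' s.1) s.2
          - M.payoff (M.Yapp ℓ' s.1) - (M.innerMean ν (M.Y s.1) - M.payoff (M.Y s.1)))
          (ENNReal.ofReal r) (scenarioMeasure P ν)
        ≤ ENNReal.ofReal (C * 2 ^ (-(1 / 2 - τ) * ℓ)) := by
  obtain ⟨C, hC, hCb⟩ := h.exists_eLpNorm_innerML_sub_le hc hN
  have hK := h.K_pos
  refine ⟨C + 3 * K, by positivity, fun ℓ ℓ' j hℓ => ?_⟩
  have m1 : Measurable fun s : Scenario Ω E => M.innerML N ℓ j (M.Yapp ℓ' s.1) s.2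
      - M.innerMeanApp ν ℓ (M.Yapp ℓ' s.1) :=
    (h.meas.innerML N ℓ j (h.meas.Yapp ℓ')).sub
      (((h.meas.innerMeanApp ν ℓ).comp (h.meas.Yapp ℓ')).comp measurable_fst)
  have m2 : Measurable fun ω => M.innerMeanApp ν ℓ (M.Yapp ℓ' ω) - M.innerMean ν (M.Y ω) :=
    ((h.meas.innerMeanApp ν ℓ).comp (h.meas.Yapp ℓ')).sub ((h.meas.innerMean ν).comp h.meas.Y)
  have m3 : Measurable fun ω => M.payoff (M.Y ω) - M.payoff (M.Yapp ℓ' ω) :=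
    (h.meas.payoff.comp h.meas.Y).sub (h.meas.payoff.comp (h.meas.Yapp ℓ'))
  have e : (fun s : Scenario Ω E => M.innerML N ℓ j (M.Yapp ℓ' s.1) s.2
        - M.payoff (M.Yapp ℓ' s.1) - (M.innerMean ν (M.Y s.1) - M.payoff (M.Y s.1)))
      = ((fun s : Scenario Ω E => M.innerML N ℓ j (M.Yapp ℓ' s.1) s.2
          - M.innerMeanApp ν ℓ (M.Yapp ℓ' s.1))
        + fun s => M.innerMeanApp ν ℓ (M.Yapp ℓ' s.1) - M.innerMean ν (M.Y s.1))
        + fun s => M.payoff (M.Y s.1) - M.payoff (M.Yapp ℓ' s.1) := by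
    ext s; simp only [Pi.add_apply]; ring
  rw [e]
  have m2' : Measurable fun s : Scenario Ω E =>
      M.innerMeanApp ν ℓ (M.Yapp ℓ' s.1) - M.innerMean ν (M.Y s.1) := m2.comp measurable_fst
  have m3' : Measurable fun s : Scenario Ω E => M.payoff (M.Y s.1) - M.payoff (M.Yapp ℓ' s.1) :=
    m3.comp measurable_fst
  refine (eLpNorm_add_le (m1.add m2').aestronglyMeasurable m3'.aestronglyMeasurable
    h.one_le_ofReal).trans ?_
  refine (add_le_add (eLpNorm_add_le m1.aestronglyMeasurable m2'.aestronglyMeasurable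
    h.one_le_ofReal) le_rfl).trans ?_
  rw [eLpNorm_scenario_fst m2, eLpNorm_scenario_fst m3]
  refine (add_le_add (add_le_add (hCb ℓ ℓ' j) (h.eLpNorm_innerMeanApp_sub_le hℓ))
    (h.payoff_r ℓ')).trans ?_
  rw [← ENNReal.ofReal_add (by positivity) (by positivity),
    ← ENNReal.ofReal_add (by positivity) (by positivity)]
  refine ENNReal.ofReal_le_ofReal ?_
  have : (2 : ℝ) ^ (-(1 / 2 : ℝ) * ℓ') ≤ 2 ^ (-(1 / 2 - τ) * ℓ) := by
    refine Real.rpow_le_rpow_of_exponent_le (by norm_num) ?_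
    have h1 : (ℓ : ℝ) ≤ ℓ' := by exact_mod_cast hℓ
    have h2 : 0 ≤ τ * ℓ := mul_nonneg h.tau_pos.le (by positivity)
    linarith
  nlinarith

end GeometricRates

end NestedModel

/-! ### Second moments of the corrections -/

lemma abs_max_sub_max_le_add (a b p p' : ℝ) :
    |max a p - max b p'| ≤ |a - b| + |p - p'| := by
  refine (abs_max_sub_max_le_max a p b p').trans (max_le ?_ ?_) <;>
    linarith [abs_nonneg (a - b), abs_nonneg (p - p')]

lemma eLpNorm_le_ofReal_of_lintegral_sq_le {α : Type*} [MeasurableSpace α] {μ : Measure α}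
    {f : α → ℝ} {a : ℝ} (ha : 0 ≤ a) (h : ∫⁻ x, ‖f x‖ₑ ^ 2 ∂μ ≤ ENNReal.ofReal (a ^ 2)) :
    eLpNorm f 2 μ ≤ ENNReal.ofReal a := by
  rw [← eLpNorm_two_sq, ENNReal.ofReal_pow ha] at h
  exact (ENNReal.pow_le_pow_left_iff two_ne_zero).1 h

lemma eLpNorm_sampleMean_le {ι E : Type*} [MeasurableSpace E] {ν : Measure E}
    [IsProbabilityMeasure ν] {p : ℝ≥0∞} (hp : 1 ≤ p) (idx : ℕ → ι) {h : E → ℝ}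
    (hh : Measurable h) (N : ℕ) :
    eLpNorm (fun w : ι → E => (N : ℝ)⁻¹ * ∑ n ∈ Finset.range N, h (w (idx n))) p
      (Measure.infinitePi fun _ : ι => ν) ≤ eLpNorm h p ν := by
  have hmp : ∀ n : ℕ, MeasurePreserving (fun w : ι → E => w (idx n))
      (Measure.infinitePi fun _ : ι => ν) ν := fun n => measurePreserving_eval_infinitePi _ (idx n)
  have h1 := eLpNorm_const_smul (N : ℝ)⁻¹
    (fun w : ι → E => ∑ n ∈ Finset.range N, h (w (idx n))) p (Measure.infinitePi fun _ : ι => ν)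
  have h2 : eLpNorm (fun w : ι → E => ∑ n ∈ Finset.range N, h (w (idx n))) p
      (Measure.infinitePi fun _ : ι => ν) ≤ N * eLpNorm h p ν := by
    have e : (fun w : ι → E => ∑ n ∈ Finset.range N, h (w (idx n)))
        = ∑ n ∈ Finset.range N, fun w : ι → E => h (w (idx n)) := by ext w; simp
    rw [e]
    refine (eLpNorm_sum_le (fun n _ => (hh.comp (hmp n).measurable).aestronglyMeasurable)
      hp).trans ?_
    rw [Finset.sum_congr rfl fun n _ =>
      eLpNorm_comp_measurePreserving hh.aestronglyMeasurable (hmp n)]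
    simp
  refine (le_of_eq h1).trans ((mul_le_mul_right h2 _).trans ?_)
  rcases Nat.eq_zero_or_pos N with rfl | hN
  · simp
  · have hN' : (0 : ℝ) < N := by exact_mod_cast hN
    rw [← mul_assoc, Real.enorm_eq_ofReal (by positivity), ← ENNReal.ofReal_natCast,
      ← ENNReal.ofReal_mul (by positivity), inv_mul_cancel₀ hN'.ne', ENNReal.ofReal_one, one_mul]

namespace NestedModel

variable {d : ℕ} {Ω E : Type*} [MeasurableSpace Ω] [MeasurableSpace E]

namespace GeometricRates

variable {P : Measure Ω} {ν : Measure E} [IsProbabilityMeasure ν]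
  {M : NestedModel d Ω E} {r τ ζ β₂ βh₂ K ρ : ℝ}

lemma eLpNorm_levelMean_two_le (h : M.GeometricRates P ν r τ ζ β₂ βh₂ K ρ) (N : ℕ → ℕ → ℕ)
    (ℓ ℓ' k : ℕ) (j : Fin 3) :
    eLpNorm (fun s : Scenario Ω E => M.levelMean N ℓ k j (M.Yapp ℓ' s.1) s.2) 2
      (scenarioMeasure P ν) ≤ ENNReal.ofReal (K * 2 ^ (-(β₂ / 2) * k)) := by
  have hDm := h.meas.DX_comp k (h.meas.Yapp ℓ')
  have := eLpNorm_prod_le_of_ae (P := P)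
    (μ := Measure.infinitePi fun _ : Fin 3 × ℕ × ℕ => ν) (ν := ν) (r := 2) (by norm_num)
    (F := fun s : Scenario Ω E => M.levelMean N ℓ k j (M.Yapp ℓ' s.1) s.2)
    (H := fun z => M.DX k (M.Yapp ℓ' z.1) z.2) (c := 1)
    (h.meas.levelMean N ℓ k j (h.meas.Yapp ℓ')) hDm
    (Filter.Eventually.of_forall fun ω => by
      rw [one_mul]
      exact eLpNorm_sampleMean_le (by simp) (fun n => (j, k, n))
        (h := fun e => M.DX k (M.Yapp ℓ' ω) e) (hDm.comp measurable_prodMk_left) (N ℓ k))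
  rw [one_mul, ENNReal.ofReal_ofNat] at this
  exact this.trans (h.DX_two ℓ' k)

lemma eLpNorm_innerMeanApp_shift_le (h : M.GeometricRates P ν r τ ζ β₂ βh₂ K ρ)
    [IsProbabilityMeasure P] (hβh : 0 ≤ βh₂) (ℓ k : ℕ) :
    eLpNorm (fun ω => M.innerMeanApp ν k (M.Yapp (ℓ + 1) ω) - M.innerMeanApp ν k (M.Yapp ℓ ω)) 2 P
      ≤ ENNReal.ofReal (2 * K * 2 ^ (-(βh₂ / 2) * ℓ)) := by
  have hK := h.K_pos
  have hX := h.meas.Xapp_comp k h.meas.Y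
  have hX' := fun ℓ => h.meas.Xapp_comp k (h.meas.Yapp ℓ)
  have hae : (fun ω => M.innerMeanApp ν k (M.Yapp (ℓ + 1) ω) - M.innerMeanApp ν k (M.Yapp ℓ ω))
      =ᵐ[P] fun ω => ∫ e, (M.Xapp k (M.Yapp (ℓ + 1) ω) e - M.Xapp k (M.Yapp ℓ ω) e) ∂ν := by
    filter_upwards [((h.memLp_Xapp_Yapp (ℓ + 1) k).integrable h.one_le_ofReal).prod_right_ae,
      ((h.memLp_Xapp_Yapp ℓ k).integrable h.one_le_ofReal).prod_right_ae] with ω h1 h2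
    exact (integral_sub h1 h2).symm
  rw [eLpNorm_congr_ae hae]
  have h1 := eLpNorm_integral_right_le (P := P) (ν := ν) (r := 2) (by norm_num)
    (H := fun z => M.Xapp k (M.Yapp (ℓ + 1) z.1) z.2 - M.Xapp k (M.Yapp ℓ z.1) z.2)
    ((hX' (ℓ + 1)).sub (hX' ℓ))
  rw [ENNReal.ofReal_ofNat] at h1
  refine h1.trans ?_
  have e : (fun z : Ω × E => M.Xapp k (M.Yapp (ℓ + 1) z.1) z.2 - M.Xapp k (M.Yapp ℓ z.1) z.2)
      = (fun z => M.Xapp k (M.Y z.1) z.2 - M.Xapp k (M.Yapp ℓ z.1) z.2)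
        - fun z => M.Xapp k (M.Y z.1) z.2 - M.Xapp k (M.Yapp (ℓ + 1) z.1) z.2 := by
    ext z; simp
  rw [e]
  refine (eLpNorm_sub_le (hX.sub (hX' ℓ)).aestronglyMeasurable
    (hX.sub (hX' (ℓ + 1))).aestronglyMeasurable (by norm_num)).trans
    ((add_le_add (h.X_shift_two ℓ k) (h.X_shift_two (ℓ + 1) k)).trans ?_)
  rw [← ENNReal.ofReal_add (by positivity) (by positivity)]
  refine ENNReal.ofReal_le_ofReal ?_
  have : (2 : ℝ) ^ (-(βh₂ / 2) * ((ℓ + 1 : ℕ) : ℝ)) ≤ 2 ^ (-(βh₂ / 2) * ℓ) := by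
    refine Real.rpow_le_rpow_of_exponent_le (by norm_num) ?_
    push_cast
    linarith
  nlinarith

/-- The `L^2` effect of replacing `Y_(ℓ+1)` by `Y_ℓ` in a coarse inner estimator.  The conditional
means are compared through `X_ℓ` as a whole, and the independent fluctuations of the corrections add
up in square, so that only `∑ 1 / N ℓ k` appears and not the number of inner levels. -/
lemma eLpNorm_innerML_shift_le (h : M.GeometricRates P ν r τ ζ β₂ βh₂ K ρ)
    [IsProbabilityMeasure P] (hβh : 0 ≤ βh₂) {N : ℕ → ℕ → ℕ} (hN : ∀ ℓ k : ℕ, k ≤ ℓ → 0 < N ℓ k)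
    (ℓ : ℕ) (j : Fin 3) :
    eLpNorm (fun s : Scenario Ω E => M.innerML N ℓ j (M.Yapp (ℓ + 1) s.1) s.2
        - M.innerML N ℓ j (M.Yapp ℓ s.1) s.2) 2 (scenarioMeasure P ν)
      ≤ ENNReal.ofReal (3 * K * 2 ^ (-(βh₂ / 2) * ℓ)
          * √(1 + ∑ k ∈ Finset.range (ℓ + 1), (N ℓ k : ℝ)⁻¹)) := by
  have hK := h.K_pos
  set S : ℝ := ∑ k ∈ Finset.range (ℓ + 1), (N ℓ k : ℝ)⁻¹ with hS
  have hS0 : 0 ≤ S := Finset.sum_nonneg fun k _ => by positivity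
  have hDm := fun ℓ k => h.meas.DX_comp k (h.meas.Yapp ℓ)
  have hHm : ∀ k, Measurable fun z : Ω × E =>
      M.DX k (M.Yapp (ℓ + 1) z.1) z.2 - M.DX k (M.Yapp ℓ z.1) z.2 :=
    fun k => (hDm (ℓ + 1) k).sub (hDm ℓ k)
  have hIm : ∀ k, Measurable fun ω =>
      ∫ e, (M.DX k (M.Yapp (ℓ + 1) ω) e - M.DX k (M.Yapp ℓ ω) e) ∂ν := fun k =>
    ((hHm k).stronglyMeasurable.integral_prod_right' (ν := ν)).measurable
  have hidx : Function.Injective fun p : ℕ × ℕ => (j, p.1, p.2) := by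
    rintro ⟨a, b⟩ ⟨a', b'⟩ hab; simpa using hab
  have hDint : ∀ ℓ k, Integrable (fun z => M.DX k (M.Yapp ℓ z.1) z.2) (P.prod ν) := fun ℓ k =>
    MemLp.integrable h.one_le_ofReal
      ⟨(hDm ℓ k).aestronglyMeasurable, (h.DX_r ℓ k).trans_lt ENNReal.ofReal_lt_top⟩
  -- the part that is centred given the outer variable
  let F : Scenario Ω E → ℝ := fun s => ∑ k ∈ Finset.range (ℓ + 1),
    ((N ℓ k : ℝ)⁻¹ * ∑ n ∈ Finset.range (N ℓ k),
      (M.DX k (M.Yapp (ℓ + 1) s.1) (s.2 (j, k, n)) - M.DX k (M.Yapp ℓ s.1) (s.2 (j, k, n)))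
      - ∫ e, (M.DX k (M.Yapp (ℓ + 1) s.1) e - M.DX k (M.Yapp ℓ s.1) e) ∂ν)
  have hFm : Measurable F := by
    refine Finset.measurable_sum _ fun k _ => ?_
    refine (Measurable.const_mul (Finset.measurable_sum _ fun n _ => ?_) _).sub
      ((hIm k).comp measurable_fst)
    exact (hHm k).comp (measurable_fst.prodMk
      ((measurable_pi_apply (j, k, n)).comp measurable_snd))
  have hFn : eLpNorm F 2 (scenarioMeasure P ν)
      ≤ ENNReal.ofReal (K * 2 ^ (-(βh₂ / 2) * ((ℓ + 1 : ℕ) : ℝ)) * √S) := by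
    refine eLpNorm_le_ofReal_of_lintegral_sq_le (by positivity) ?_
    unfold scenarioMeasure
    rw [lintegral_prod _ (by fun_prop)]
    calc ∫⁻ ω, ∫⁻ w, ‖F (ω, w)‖ₑ ^ 2 ∂(Measure.infinitePi fun _ : Fin 3 × ℕ × ℕ => ν) ∂P
        ≤ ∫⁻ ω, ∑ k ∈ Finset.range (ℓ + 1), ENNReal.ofReal (N ℓ k : ℝ)⁻¹ *
            ∫⁻ e, ‖M.DX k (M.Yapp (ℓ + 1) ω) e - M.DX k (M.Yapp ℓ ω) e‖ₑ ^ 2 ∂ν ∂P := by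
          refine lintegral_mono fun ω => ?_
          exact lintegral_sum_sampleMean_sq_le hidx
            (h := fun k e => M.DX k (M.Yapp (ℓ + 1) ω) e - M.DX k (M.Yapp ℓ ω) e)
            (fun k => (hHm k).comp measurable_prodMk_left) (N := N ℓ) (ℓ + 1)
            fun k hk => hN ℓ k (by omega)
      _ = ∑ k ∈ Finset.range (ℓ + 1), ENNReal.ofReal (N ℓ k : ℝ)⁻¹ *
            ∫⁻ z, ‖M.DX k (M.Yapp (ℓ + 1) z.1) z.2 - M.DX k (M.Yapp ℓ z.1) z.2‖ₑ ^ 2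
              ∂(P.prod ν) := by
          have hm2 : ∀ k, Measurable fun z : Ω × E =>
              ‖M.DX k (M.Yapp (ℓ + 1) z.1) z.2 - M.DX k (M.Yapp ℓ z.1) z.2‖ₑ ^ 2 :=
            fun k => (hHm k).enorm.pow_const 2
          rw [lintegral_finsetSum _ fun k _ => ((hm2 k).lintegral_prod_right').const_mul _]
          refine Finset.sum_congr rfl fun k _ => ?_
          rw [lintegral_const_mul _ (hm2 k).lintegral_prod_right',
            lintegral_prod _ (hm2 k).aemeasurable]
      _ ≤ ∑ k ∈ Finset.range (ℓ + 1), ENNReal.ofReal (N ℓ k : ℝ)⁻¹ *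
            ENNReal.ofReal (K * 2 ^ (-(βh₂ / 2) * ((ℓ + 1 : ℕ) : ℝ))) ^ 2 := by
          refine Finset.sum_le_sum fun k _ => mul_le_mul_right ?_ _
          rw [← eLpNorm_two_sq]
          exact pow_le_pow_left₀ zero_le (h.DX_shift_two ℓ k) 2
      _ = ENNReal.ofReal ((K * 2 ^ (-(βh₂ / 2) * ((ℓ + 1 : ℕ) : ℝ)) * √S) ^ 2) := by
          rw [mul_pow _ (√S), Real.sq_sqrt hS0, ← Finset.sum_mul,
            ← ENNReal.ofReal_sum_of_nonneg fun k _ => by positivity,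
            ← ENNReal.ofReal_pow (by positivity), ← ENNReal.ofReal_mul hS0, mul_comm]
  have hGm : Measurable fun ω =>
      M.innerMeanApp ν ℓ (M.Yapp (ℓ + 1) ω) - M.innerMeanApp ν ℓ (M.Yapp ℓ ω) :=
    ((h.meas.innerMeanApp ν ℓ).comp (h.meas.Yapp (ℓ + 1))).sub
      ((h.meas.innerMeanApp ν ℓ).comp (h.meas.Yapp ℓ))
  have hae : (fun s : Scenario Ω E => M.innerML N ℓ j (M.Yapp (ℓ + 1) s.1) s.2
        - M.innerML N ℓ j (M.Yapp ℓ s.1) s.2) =ᵐ[scenarioMeasure P ν]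
      F + fun s : Scenario Ω E =>
        M.innerMeanApp ν ℓ (M.Yapp (ℓ + 1) s.1) - M.innerMeanApp ν ℓ (M.Yapp ℓ s.1) := by
    have hω : ∀ᵐ ω ∂P, ∑ k ∈ Finset.range (ℓ + 1),
        ∫ e, (M.DX k (M.Yapp (ℓ + 1) ω) e - M.DX k (M.Yapp ℓ ω) e) ∂ν
          = M.innerMeanApp ν ℓ (M.Yapp (ℓ + 1) ω) - M.innerMeanApp ν ℓ (M.Yapp ℓ ω) := by
      filter_upwards [h.ae_sum_integral_DX ℓ, h.ae_sum_integral_DX (ℓ + 1),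
        ae_all_iff.2 fun k => (hDint ℓ k).prod_right_ae,
        ae_all_iff.2 fun k => (hDint (ℓ + 1) k).prod_right_ae] with ω h1 h2 h3 h4
      rw [← h1 ℓ, ← h2 ℓ, ← Finset.sum_sub_distrib]
      exact Finset.sum_congr rfl fun k _ => integral_sub (h4 k) (h3 k)
    have hs : ∀ᵐ s ∂(scenarioMeasure P ν), ∑ k ∈ Finset.range (ℓ + 1),
        ∫ e, (M.DX k (M.Yapp (ℓ + 1) s.1) e - M.DX k (M.Yapp ℓ s.1) e) ∂ν
          = M.innerMeanApp ν ℓ (M.Yapp (ℓ + 1) s.1) - M.innerMeanApp ν ℓ (M.Yapp ℓ s.1) :=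
      Measure.quasiMeasurePreserving_fst.ae hω
    filter_upwards [hs] with s hs
    simp only [Pi.add_apply, F]
    rw [Finset.sum_sub_distrib, hs, sub_add_cancel]
    simp only [NestedModel.innerML, NestedModel.levelMean, Finset.sum_sub_distrib, mul_sub]
  rw [eLpNorm_congr_ae hae]
  have hGm' : Measurable fun s : Scenario Ω E =>
      M.innerMeanApp ν ℓ (M.Yapp (ℓ + 1) s.1) - M.innerMeanApp ν ℓ (M.Yapp ℓ s.1) :=
    hGm.comp measurable_fst
  refine (eLpNorm_add_le hFm.aestronglyMeasurable hGm'.aestronglyMeasurable (by norm_num)).trans ?_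
  rw [eLpNorm_scenario_fst hGm]
  refine (add_le_add hFn (h.eLpNorm_innerMeanApp_shift_le hβh ℓ ℓ)).trans ?_
  rw [← ENNReal.ofReal_add (by positivity) (by positivity)]
  refine ENNReal.ofReal_le_ofReal ?_
  have h1 : (2 : ℝ) ^ (-(βh₂ / 2) * ((ℓ + 1 : ℕ) : ℝ)) ≤ 2 ^ (-(βh₂ / 2) * ℓ) := by
    refine Real.rpow_le_rpow_of_exponent_le (by norm_num) ?_
    push_cast
    linarith
  have h2 : √S ≤ √(1 + S) := Real.sqrt_le_sqrt (by linarith)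
  have h3 : 1 ≤ √(1 + S) := Real.one_le_sqrt.2 (by linarith)
  calc K * 2 ^ (-(βh₂ / 2) * ((ℓ + 1 : ℕ) : ℝ)) * √S + 2 * K * 2 ^ (-(βh₂ / 2) * ℓ)
      ≤ K * 2 ^ (-(βh₂ / 2) * ℓ) * √(1 + S) + 2 * K * 2 ^ (-(βh₂ / 2) * ℓ) * √(1 + S) := by
        refine add_le_add (by gcongr) (le_mul_of_one_le_right (by positivity) h3)
    _ = _ := by ring

lemma memLp_levelMean (h : M.GeometricRates P ν r τ ζ β₂ βh₂ K ρ) (N : ℕ → ℕ → ℕ)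
    (ℓ ℓ' k : ℕ) (j : Fin 3) :
    MemLp (fun s : Scenario Ω E => M.levelMean N ℓ k j (M.Yapp ℓ' s.1) s.2) 2
      (scenarioMeasure P ν) :=
  ⟨(h.meas.levelMean N ℓ k j (h.meas.Yapp ℓ')).aestronglyMeasurable,
    (h.eLpNorm_levelMean_two_le N ℓ ℓ' k j).trans_lt ENNReal.ofReal_lt_top⟩

lemma memLp_innerML_two (h : M.GeometricRates P ν r τ ζ β₂ βh₂ K ρ) (N : ℕ → ℕ → ℕ)
    (ℓ ℓ' : ℕ) (j : Fin 3) :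
    MemLp (fun s : Scenario Ω E => M.innerML N ℓ j (M.Yapp ℓ' s.1) s.2) 2
      (scenarioMeasure P ν) :=
  memLp_finsetSum _ fun k _ => h.memLp_levelMean N ℓ ℓ' k j

lemma memLp_fineML (h : M.GeometricRates P ν r τ ζ β₂ βh₂ K ρ) (N : ℕ → ℕ → ℕ) (ℓ ℓ' : ℕ) :
    MemLp (fun s : Scenario Ω E => M.fineML N ℓ (M.Yapp ℓ' s.1) s.2) 2 (scenarioMeasure P ν) := by
  cases ℓ with
  | zero => exact h.memLp_levelMean N 0 ℓ' 0 2
  | succ ℓ =>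
    exact (((h.memLp_innerML_two N ℓ ℓ' 0).add (h.memLp_innerML_two N ℓ ℓ' 1)).const_mul
      (1 / 2)).add (h.memLp_levelMean N (ℓ + 1) ℓ' (ℓ + 1) 2)

variable [IsProbabilityMeasure P]

lemma memLp_payoff_scenario (h : M.GeometricRates P ν r τ ζ β₂ βh₂ K ρ) (ℓ : ℕ) :
    MemLp (fun s : Scenario Ω E => M.payoff (M.Yapp ℓ s.1)) 2 (scenarioMeasure P ν) :=
  memLp_scenario_fst ((h.memLp_payoff_Yapp ℓ).mono_exponent h.two_le_ofReal)

lemma memLp_max_fineML (h : M.GeometricRates P ν r τ ζ β₂ βh₂ K ρ) (N : ℕ → ℕ → ℕ) (ℓ : ℕ) :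
    MemLp (fun s : Scenario Ω E => max (M.fineML N ℓ (M.Yapp ℓ s.1) s.2)
      (M.payoff (M.Yapp ℓ s.1))) 2 (scenarioMeasure P ν) :=
  (h.memLp_fineML N ℓ ℓ).sup (h.memLp_payoff_scenario ℓ)

lemma memLp_max_innerML (h : M.GeometricRates P ν r τ ζ β₂ βh₂ K ρ) (N : ℕ → ℕ → ℕ) (ℓ : ℕ)
    (j : Fin 3) :
    MemLp (fun s : Scenario Ω E => max (M.innerML N ℓ j (M.Yapp ℓ s.1) s.2)
      (M.payoff (M.Yapp ℓ s.1))) 2 (scenarioMeasure P ν) :=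
  (h.memLp_innerML_two N ℓ ℓ j).sup (h.memLp_payoff_scenario ℓ)

lemma memLp_antitheticCorrection (h : M.GeometricRates P ν r τ ζ β₂ βh₂ K ρ) (N : ℕ → ℕ → ℕ)
    (ℓ : ℕ) : MemLp (M.antitheticCorrection N ℓ) 2 (scenarioMeasure P ν) := by
  cases ℓ with
  | zero => exact h.memLp_max_fineML N 0
  | succ ℓ =>
    exact (h.memLp_max_fineML N (ℓ + 1)).sub
      (((h.memLp_max_innerML N ℓ 0).add (h.memLp_max_innerML N ℓ 1)).const_mul (1 / 2))

end GeometricRates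

end NestedModel

namespace NestedModel

variable {d : ℕ} {Ω E : Type*} [MeasurableSpace Ω] [MeasurableSpace E]

namespace GeometricRates

variable {P : Measure Ω} [IsProbabilityMeasure P] {ν : Measure E} [IsProbabilityMeasure ν]
  {M : NestedModel d Ω E} {r τ ζ β₂ βh₂ K ρ : ℝ}

/-- Second moments of the antithetic corrections.  The three terms are due to the additional top
level of the fine estimator, to the antithetic combination at `Y_(ℓ+1)`, and to the change of the
outer approximation. -/
lemma exists_eLpNorm_antitheticCorrection_le (h : M.GeometricRates P ν r τ ζ β₂ βh₂ K ρ)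
    (hβ : 0 ≤ β₂) (hβh : 0 ≤ βh₂) {N : ℕ → ℕ → ℕ} {c : ℝ} (hc : 0 < c)
    (hN : ∀ ℓ k : ℕ, k ≤ ℓ → c * max ((2 : ℝ) ^ ((ℓ : ℝ) - ζ * k)) 1 ≤ N ℓ k) :
    ∃ C > (0 : ℝ), ∀ ℓ : ℕ,
      eLpNorm (M.antitheticCorrection N (ℓ + 1)) 2 (scenarioMeasure P ν)
        ≤ ENNReal.ofReal (C * (2 ^ (-(β₂ / 2) * ℓ)
          + 2 ^ (-((1 / 2 - τ) * (3 * r / (r + 1) / 2)) * ℓ)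
          + 2 ^ (-(βh₂ / 2) * ℓ) * √(1 + ∑ k ∈ Finset.range (ℓ + 1), (N ℓ k : ℝ)⁻¹))) := by
  obtain ⟨C, hC, hCb⟩ := h.exists_eLpNorm_margin_sub_le hc hN
  have hK := h.K_pos
  have hρ := h.rho_nonneg
  have hNpos : ∀ ℓ k : ℕ, k ≤ ℓ → 0 < N ℓ k := fun ℓ k hk => by
    have h1 : 0 < c * max ((2 : ℝ) ^ ((ℓ : ℝ) - ζ * k)) 1 := by positivity
    exact_mod_cast h1.trans_le (hN ℓ k hk)
  set e : ℝ := 3 * r / (r + 1) with he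
  set B : ℝ := √((ρ + 1) * (2 * C) ^ e) with hB
  have hB0 : 0 ≤ B := Real.sqrt_nonneg _
  refine ⟨B + 5 * K, by positivity, fun ℓ => ?_⟩
  set S : ℝ := √(1 + ∑ k ∈ Finset.range (ℓ + 1), (N ℓ k : ℝ)⁻¹) with hS
  have hS1 : 1 ≤ S := Real.one_le_sqrt.2 (by
    have : 0 ≤ ∑ k ∈ Finset.range (ℓ + 1), (N ℓ k : ℝ)⁻¹ :=
      Finset.sum_nonneg fun k _ => by positivity
    linarith)
  -- the coarse estimators and the payoff at the finer (primed) and at the coarser outer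
  -- approximation, and the additional top level of the fine estimator
  let c' : Fin 3 → Scenario Ω E → ℝ := fun j s => M.innerML N ℓ j (M.Yapp (ℓ + 1) s.1) s.2
  let c₀ : Fin 3 → Scenario Ω E → ℝ := fun j s => M.innerML N ℓ j (M.Yapp ℓ s.1) s.2
  let p' : Scenario Ω E → ℝ := fun s => M.payoff (M.Yapp (ℓ + 1) s.1)
  let p₀ : Scenario Ω E → ℝ := fun s => M.payoff (M.Yapp ℓ s.1)
  let D : Scenario Ω E → ℝ := fun s => M.levelMean N (ℓ + 1) (ℓ + 1) 2 (M.Yapp (ℓ + 1) s.1) s.2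
  have mc' : ∀ j, Measurable (c' j) := fun j => h.meas.innerML N ℓ j (h.meas.Yapp _)
  have mc₀ : ∀ j, Measurable (c₀ j) := fun j => h.meas.innerML N ℓ j (h.meas.Yapp _)
  have mp' : Measurable p' := h.meas.payoff_comp (h.meas.Yapp _)
  have mp₀ : Measurable p₀ := h.meas.payoff_comp (h.meas.Yapp _)
  have mD : Measurable D := h.meas.levelMean N _ _ 2 (h.meas.Yapp _)
  -- removing the additional top level, the antithetic combination at the finer outer approximation,
  -- and the change of the outer approximation
  let T₁ : Scenario Ω E → ℝ := fun s =>
    max (1 / 2 * (c' 0 s + c' 1 s) + D s) (p' s) - max (1 / 2 * (c' 0 s + c' 1 s)) (p' s)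
  let T₂ : Scenario Ω E → ℝ := fun s =>
    max (1 / 2 * (c' 0 s + c' 1 s)) (p' s) - 1 / 2 * (max (c' 0 s) (p' s) + max (c' 1 s) (p' s))
  let T₃ : Fin 3 → Scenario Ω E → ℝ := fun j s => max (c' j s) (p' s) - max (c₀ j s) (p₀ s)
  have mT₁ : Measurable T₁ := by fun_prop
  have mT₂ : Measurable T₂ := by fun_prop
  have mT₃ : ∀ j, Measurable (T₃ j) := fun j => by fun_prop
  have hdec : M.antitheticCorrection N (ℓ + 1)
      = T₁ + T₂ + ((1 / 2 : ℝ) • T₃ 0 + (1 / 2 : ℝ) • T₃ 1) := by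
    ext s
    simp only [Pi.add_apply, Pi.smul_apply, smul_eq_mul, T₁, T₂, T₃, c', c₀, p', p₀, D,
      antitheticCorrection, fineML]
    ring
  have b₁ : eLpNorm T₁ 2 (scenarioMeasure P ν) ≤ ENNReal.ofReal (K * 2 ^ (-(β₂ / 2) * ℓ)) := by
    have h1 : eLpNorm T₁ 2 (scenarioMeasure P ν) ≤ eLpNorm D 2 (scenarioMeasure P ν) := by
      refine eLpNorm_mono fun s => ?_
      have := abs_max_sub_max_le_add (1 / 2 * (c' 0 s + c' 1 s) + D s) (1 / 2 * (c' 0 s + c' 1 s))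
        (p' s) (p' s)
      simpa [T₁] using this
    refine h1.trans ((h.eLpNorm_levelMean_two_le N (ℓ + 1) (ℓ + 1) (ℓ + 1) 2).trans ?_)
    refine ENNReal.ofReal_le_ofReal (mul_le_mul_of_nonneg_left ?_ hK.le)
    refine Real.rpow_le_rpow_of_exponent_le (by norm_num) ?_
    push_cast
    linarith
  have b₂ : eLpNorm T₂ 2 (scenarioMeasure P ν)
      ≤ ENNReal.ofReal (B * 2 ^ (-((1 / 2 - τ) * (e / 2)) * ℓ)) := by
    refine eLpNorm_le_ofReal_of_lintegral_sq_le (by positivity) ?_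
    have mZ : Measurable fun ω => M.innerMean ν (M.Y ω) - M.payoff (M.Y ω) :=
      ((h.meas.innerMean ν).comp h.meas.Y).sub (h.meas.payoff.comp h.meas.Y)
    have hZ : ∀ y : ℝ, 0 < y → (scenarioMeasure P ν)
        {s | |M.innerMean ν (M.Y s.1) - M.payoff (M.Y s.1)| < y} ≤ ENNReal.ofReal (ρ * y) := by
      intro y hy
      have hset : MeasurableSet {ω | |M.innerMean ν (M.Y ω) - M.payoff (M.Y ω)| < y} :=
        measurableSet_lt (by fun_prop) measurable_const
      have h1 := (measurePreserving_fst (μ := P)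
        (ν := Measure.infinitePi fun _ : Fin 3 × ℕ × ℕ => ν)).measure_preimage
          hset.nullMeasurableSet
      exact (le_of_eq h1).trans (h.density y hy)
    have h1 := lintegral_antithetic_sq_le (μ := scenarioMeasure P ν) h.two_lt (mc' 0) (mc' 1) mp'
      (Z := fun s => M.innerMean ν (M.Y s.1) - M.payoff (M.Y s.1)) (mZ.comp measurable_fst) hρ hZ
      (s := C * 2 ^ (-(1 / 2 - τ) * ℓ)) (by positivity) (hCb ℓ (ℓ + 1) 0 (by omega))
      (hCb ℓ (ℓ + 1) 1 (by omega))
    refine h1.trans (ENNReal.ofReal_le_ofReal (le_of_eq ?_))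
    rw [← he, mul_pow, hB, Real.sq_sqrt (by positivity), ← mul_assoc 2 C,
      Real.mul_rpow (by positivity) (by positivity), ← Real.rpow_mul (by norm_num),
      ← Real.rpow_natCast _ 2, ← Real.rpow_mul (by norm_num), ← mul_assoc]
    congr 2
    push_cast
    ring
  have b₃ : ∀ j, eLpNorm (T₃ j) 2 (scenarioMeasure P ν)
      ≤ ENNReal.ofReal (5 * K * (2 ^ (-(βh₂ / 2) * ℓ) * S)) := by
    intro j
    have mcd : Measurable fun s => |c' j s - c₀ j s| := by fun_prop
    have mpd : Measurable fun s => |p' s - p₀ s| := by fun_prop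
    have mq : ∀ ℓ, Measurable fun ω => M.payoff (M.Y ω) - M.payoff (M.Yapp ℓ ω) := fun ℓ =>
      (h.meas.payoff.comp h.meas.Y).sub (h.meas.payoff.comp (h.meas.Yapp ℓ))
    have h1 : eLpNorm (T₃ j) 2 (scenarioMeasure P ν)
        ≤ eLpNorm ((fun s => |c' j s - c₀ j s|) + fun s => |p' s - p₀ s|) 2
          (scenarioMeasure P ν) := by
      refine eLpNorm_mono fun s => ?_
      rw [Pi.add_apply, Real.norm_eq_abs, Real.norm_eq_abs,
        abs_of_nonneg (by positivity : 0 ≤ |c' j s - c₀ j s| + |p' s - p₀ s|)]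
      exact abs_max_sub_max_le_add _ _ _ _
    refine h1.trans ((eLpNorm_add_le mcd.aestronglyMeasurable mpd.aestronglyMeasurable
      (by norm_num)).trans ?_)
    have e1 : eLpNorm (fun s => |c' j s - c₀ j s|) 2 (scenarioMeasure P ν)
        = eLpNorm (fun s => c' j s - c₀ j s) 2 (scenarioMeasure P ν) :=
      eLpNorm_norm fun s => c' j s - c₀ j s
    have e2 : eLpNorm (fun s => |p' s - p₀ s|) 2 (scenarioMeasure P ν)
        = eLpNorm (fun s => p' s - p₀ s) 2 (scenarioMeasure P ν) :=
      eLpNorm_norm fun s => p' s - p₀ s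
    rw [e1, e2]
    have e3 : (fun s => p' s - p₀ s)
        = (fun s : Scenario Ω E => M.payoff (M.Y s.1) - M.payoff (M.Yapp ℓ s.1))
          - fun s => M.payoff (M.Y s.1) - M.payoff (M.Yapp (ℓ + 1) s.1) := by
      ext s; simp [p', p₀]
    have mq' : ∀ ℓ, Measurable fun s : Scenario Ω E =>
        M.payoff (M.Y s.1) - M.payoff (M.Yapp ℓ s.1) := fun ℓ => (mq ℓ).comp measurable_fst
    have h2 : eLpNorm (fun s => p' s - p₀ s) 2 (scenarioMeasure P ν)
        ≤ ENNReal.ofReal (2 * K * 2 ^ (-(βh₂ / 2) * ℓ)) := by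
      rw [e3]
      refine (eLpNorm_sub_le (mq' ℓ).aestronglyMeasurable (mq' (ℓ + 1)).aestronglyMeasurable
        (by norm_num)).trans ?_
      rw [eLpNorm_scenario_fst (mq ℓ), eLpNorm_scenario_fst (mq (ℓ + 1))]
      refine (add_le_add (h.payoff_two ℓ) (h.payoff_two (ℓ + 1))).trans ?_
      rw [← ENNReal.ofReal_add (by positivity) (by positivity)]
      refine ENNReal.ofReal_le_ofReal ?_
      have : (2 : ℝ) ^ (-(βh₂ / 2) * ((ℓ + 1 : ℕ) : ℝ)) ≤ 2 ^ (-(βh₂ / 2) * ℓ) := by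
        refine Real.rpow_le_rpow_of_exponent_le (by norm_num) ?_
        push_cast
        linarith
      nlinarith
    refine (add_le_add (h.eLpNorm_innerML_shift_le hβh hNpos ℓ j) h2).trans ?_
    rw [← ENNReal.ofReal_add (by positivity) (by positivity)]
    refine ENNReal.ofReal_le_ofReal ?_
    have : 2 * K * 2 ^ (-(βh₂ / 2) * ℓ) * 1 ≤ 2 * K * 2 ^ (-(βh₂ / 2) * ℓ) * S := by gcongr
    rw [← hS]
    linarith
  have b₃' : ∀ j, eLpNorm ((1 / 2 : ℝ) • T₃ j) 2 (scenarioMeasure P ν)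
      ≤ ENNReal.ofReal (1 / 2 * (5 * K * (2 ^ (-(βh₂ / 2) * ℓ) * S))) := by
    intro j
    rw [eLpNorm_const_smul, Real.enorm_eq_ofReal (by norm_num), ENNReal.ofReal_mul (by norm_num)]
    exact mul_le_mul_right (b₃ j) _
  rw [hdec]
  have m3 : ∀ j, AEStronglyMeasurable ((1 / 2 : ℝ) • T₃ j) (scenarioMeasure P ν) := fun j =>
    ((mT₃ j).const_smul (1 / 2 : ℝ)).aestronglyMeasurable
  refine (eLpNorm_add_le (mT₁.add mT₂).aestronglyMeasurable ((m3 0).add (m3 1))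
    (by norm_num)).trans ?_
  refine (add_le_add (eLpNorm_add_le mT₁.aestronglyMeasurable mT₂.aestronglyMeasurable
    (by norm_num)) (eLpNorm_add_le (m3 0) (m3 1) (by norm_num))).trans ?_
  refine (add_le_add (add_le_add b₁ b₂) (add_le_add (b₃' 0) (b₃' 1))).trans ?_
  rw [← ENNReal.ofReal_add (by positivity) (by positivity),
    ← ENNReal.ofReal_add (by positivity) (by positivity),
    ← ENNReal.ofReal_add (by positivity) (by positivity)]
  refine ENNReal.ofReal_le_ofReal ?_
  have x1 : (0 : ℝ) ≤ 2 ^ (-(β₂ / 2) * ℓ) := by positivity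
  have x2 : (0 : ℝ) ≤ 2 ^ (-((1 / 2 - τ) * (e / 2)) * ℓ) := by positivity
  have x3 : (0 : ℝ) ≤ 2 ^ (-(βh₂ / 2) * ℓ) * S := by positivity
  generalize (2 : ℝ) ^ (-(β₂ / 2) * ℓ) = y1 at *
  generalize (2 : ℝ) ^ (-((1 / 2 - τ) * (e / 2)) * ℓ) = y2 at *
  generalize (2 : ℝ) ^ (-(βh₂ / 2) * ℓ) * S = y3 at *
  nlinarith [mul_nonneg hB0 x1, mul_nonneg hB0 x3, mul_nonneg hK.le x1, mul_nonneg hK.le x2]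

/-! ### Bias and telescoping -/

/-- The expectation of the maximum of inner estimator and payoff converges to `U₀`. -/
lemma tendsto_integral_max_innerML (h : M.GeometricRates P ν r τ ζ β₂ βh₂ K ρ) {N : ℕ → ℕ → ℕ}
    {c : ℝ} (hc : 0 < c) (hN : ∀ ℓ k : ℕ, k ≤ ℓ → c * max ((2 : ℝ) ^ ((ℓ : ℝ) - ζ * k)) 1 ≤ N ℓ k) :
    Filter.Tendsto (fun ℓ : ℕ => ∫ s, max (M.innerML N ℓ 0 (M.Yapp ℓ s.1) s.2)
      (M.payoff (M.Yapp ℓ s.1)) ∂(scenarioMeasure P ν)) Filter.atTop (nhds (M.U₀ P ν)) := by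
  obtain ⟨C, hC, hCb⟩ := h.exists_eLpNorm_margin_sub_le hc hN
  have hK := h.K_pos
  have hU₀ : M.U₀ P ν
      = ∫ s, max (M.innerMean ν (M.Y s.1)) (M.payoff (M.Y s.1)) ∂(scenarioMeasure P ν) := by
    have hU := condExp_prod_comap_fst h.meas.Y h.meas.X (h.memLp_X.integrable h.one_le_ofReal)
    have mg : Measurable fun ω => max (M.innerMean ν (M.Y ω)) (M.payoff (M.Y ω)) :=
      ((h.meas.innerMean ν).comp h.meas.Y).max (h.meas.payoff.comp h.meas.Y)
    have h1 : M.U₀ P ν = ∫ z, max (M.innerMean ν (M.Y z.1)) (M.payoff (M.Y z.1)) ∂(P.prod ν) := by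
      refine integral_congr_ae ?_
      filter_upwards [hU] with z hz
      have hz' : M.U₁ P ν z = M.innerMean ν (M.Y z.1) := hz
      rw [hz']
    rw [h1, integral_comp_of_measurePreserving (measurePreserving_fst (μ := P) (ν := ν)) mg]
    exact (integral_comp_of_measurePreserving (measurePreserving_fst (μ := P)
      (ν := Measure.infinitePi fun _ : Fin 3 × ℕ × ℕ => ν)) mg).symm
  have mq : ∀ ℓ, Measurable fun ω => M.payoff (M.Y ω) - M.payoff (M.Yapp ℓ ω) := fun ℓ =>
      (h.meas.payoff.comp h.meas.Y).sub (h.meas.payoff.comp (h.meas.Yapp ℓ))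
  have mq' : ∀ ℓ, Measurable fun s : Scenario Ω E =>
      M.payoff (M.Y s.1) - M.payoff (M.Yapp ℓ s.1) := fun ℓ => (mq ℓ).comp measurable_fst
  have hbound : ∀ ℓ : ℕ, |(∫ s, max (M.innerML N ℓ 0 (M.Yapp ℓ s.1) s.2)
      (M.payoff (M.Yapp ℓ s.1)) ∂(scenarioMeasure P ν)) - M.U₀ P ν|
        ≤ C * 2 ^ (-(1 / 2 - τ) * ℓ) + K * 2 ^ (-(1 / 2 : ℝ) * ℓ) := by
    intro ℓ
    have i1 := (h.memLp_max_innerML N ℓ 0).integrable (by norm_num)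
    have i2 : Integrable (fun s => max (M.innerMean ν (M.Y s.1)) (M.payoff (M.Y s.1)))
        (scenarioMeasure P ν) :=
      ((memLp_scenario_fst h.memLp_innerMean).sup
        (memLp_scenario_fst h.memLp_payoff)).integrable h.one_le_ofReal
    have mF : Measurable fun s : Scenario Ω E => max (M.innerML N ℓ 0 (M.Yapp ℓ s.1) s.2)
        (M.payoff (M.Yapp ℓ s.1)) - max (M.innerMean ν (M.Y s.1)) (M.payoff (M.Y s.1)) :=
      ((h.meas.innerML N ℓ 0 (h.meas.Yapp ℓ)).max (h.meas.payoff_comp (h.meas.Yapp ℓ))).sub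
        ((((h.meas.innerMean ν).comp h.meas.Y).comp measurable_fst).max
          (h.meas.payoff_comp h.meas.Y))
    rw [hU₀, ← integral_sub i1 i2]
    have hen := enorm_integral_le_eLpNorm (μ := scenarioMeasure P ν) mF h.one_le_ofReal
    let A : Scenario Ω E → ℝ := fun s => M.innerML N ℓ 0 (M.Yapp ℓ s.1) s.2
          - M.payoff (M.Yapp ℓ s.1) - (M.innerMean ν (M.Y s.1) - M.payoff (M.Y s.1))
    let Q : Scenario Ω E → ℝ := fun s => M.payoff (M.Y s.1) - M.payoff (M.Yapp ℓ s.1)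
    have mA : Measurable A :=
      ((h.meas.innerML N ℓ 0 (h.meas.Yapp ℓ)).sub (h.meas.payoff_comp (h.meas.Yapp ℓ))).sub
        ((((h.meas.innerMean ν).comp h.meas.Y).comp measurable_fst).sub
          (h.meas.payoff_comp h.meas.Y))
    have hmono : eLpNorm (fun s : Scenario Ω E => max (M.innerML N ℓ 0 (M.Yapp ℓ s.1) s.2)
        (M.payoff (M.Yapp ℓ s.1)) - max (M.innerMean ν (M.Y s.1)) (M.payoff (M.Y s.1)))
          (ENNReal.ofReal r) (scenarioMeasure P ν)
        ≤ eLpNorm ((fun s => |A s|) + fun s => |Q s|) (ENNReal.ofReal r)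
          (scenarioMeasure P ν) := by
      refine eLpNorm_mono fun s => ?_
      rw [Pi.add_apply, Real.norm_eq_abs, Real.norm_eq_abs,
        abs_of_nonneg (by positivity : 0 ≤ |A s| + |Q s|)]
      generalize hx : M.innerML N ℓ 0 (M.Yapp ℓ s.1) s.2 = x
      have e1 : max x (M.payoff (M.Yapp ℓ s.1))
            - max (M.innerMean ν (M.Y s.1)) (M.payoff (M.Y s.1))
          = (max (x - M.payoff (M.Yapp ℓ s.1)) 0
            - max (M.innerMean ν (M.Y s.1) - M.payoff (M.Y s.1)) 0) - Q s := by
        have h1 := max_sub_sub_right x (M.payoff (M.Yapp ℓ s.1)) (M.payoff (M.Yapp ℓ s.1))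
        have h2 := max_sub_sub_right (M.innerMean ν (M.Y s.1)) (M.payoff (M.Y s.1))
          (M.payoff (M.Y s.1))
        rw [sub_self] at h1 h2
        rw [h1, h2]
        simp only [Q]
        ring
      rw [e1]
      refine (abs_sub _ _).trans (add_le_add ?_ le_rfl)
      have := abs_max_sub_max_le_add (x - M.payoff (M.Yapp ℓ s.1))
        (M.innerMean ν (M.Y s.1) - M.payoff (M.Y s.1)) 0 0
      simpa [A, hx] using this
    have hfin := hen.trans (hmono.trans ((eLpNorm_add_le
      (mA.abs).aestronglyMeasurable ((mq' ℓ).abs).aestronglyMeasurable h.one_le_ofReal)))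
    have e1 : eLpNorm (fun s => |A s|) (ENNReal.ofReal r) (scenarioMeasure P ν)
        = eLpNorm A (ENNReal.ofReal r) (scenarioMeasure P ν) := eLpNorm_norm A
    have e2 : eLpNorm (fun s => |Q s|) (ENNReal.ofReal r) (scenarioMeasure P ν)
        = eLpNorm Q (ENNReal.ofReal r) (scenarioMeasure P ν) := eLpNorm_norm Q
    have e3 : eLpNorm Q (ENNReal.ofReal r) (scenarioMeasure P ν)
        = eLpNorm (fun ω => M.payoff (M.Y ω) - M.payoff (M.Yapp ℓ ω)) (ENNReal.ofReal r) P :=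
      eLpNorm_scenario_fst (mq ℓ) _
    rw [e1, e2, e3, Real.enorm_eq_ofReal_abs] at hfin
    have hfin' := hfin.trans (add_le_add (hCb ℓ ℓ 0 le_rfl) (h.payoff_r ℓ))
    rw [← ENNReal.ofReal_add (by positivity) (by positivity)] at hfin'
    exact (ENNReal.ofReal_le_ofReal_iff (by positivity)).1 hfin'
  have hgeo : ∀ σ : ℝ, 0 < σ → Filter.Tendsto (fun ℓ : ℕ => (2 : ℝ) ^ (-σ * ℓ)) Filter.atTop
      (nhds 0) := by
    intro σ hσ
    have h1 : (2 : ℝ) ^ (-σ) < 1 := Real.rpow_lt_one_of_one_lt_of_neg (by norm_num) (by linarith)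
    refine (tendsto_pow_atTop_nhds_zero_of_lt_one (by positivity) h1).congr fun ℓ => ?_
    rw [← Real.rpow_natCast, ← Real.rpow_mul (by norm_num)]
  have hlim : Filter.Tendsto (fun ℓ : ℕ => C * (2 : ℝ) ^ (-(1 / 2 - τ) * ℓ)
      + K * 2 ^ (-(1 / 2 : ℝ) * ℓ)) Filter.atTop (nhds 0) := by
    have := ((hgeo (1 / 2 - τ) (by linarith [h.tau_lt])).const_mul C).add
      ((hgeo (1 / 2) (by norm_num)).const_mul K)
    simpa only [mul_zero, add_zero] using this
  refine tendsto_iff_norm_sub_tendsto_zero.2 ?_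
  exact squeeze_zero (fun _ => norm_nonneg _) hbound hlim

end GeometricRates

/-- Integrals over scenarios of functions of the outer outcome and of an injectively reindexed
family of inner noises do not depend on the reindexing. -/
lemma integral_scenario_comp_injective {P : Measure Ω} [IsProbabilityMeasure P] {ν : Measure E}
    [IsProbabilityMeasure ν] {κ : Type*} {σ : κ → Fin 3 × ℕ × ℕ} (hσ : Function.Injective σ)
    {G : Ω × (κ → E) → ℝ} (hG : Measurable G) :
    ∫ s : Scenario Ω E, G (s.1, fun i => s.2 (σ i)) ∂(scenarioMeasure P ν)
      = ∫ s, G s ∂(P.prod (Measure.infinitePi fun _ : κ => ν)) := by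
  have h1 : MeasurePreserving (fun (w : Fin 3 × ℕ × ℕ → E) (i : κ) => w (σ i))
      (Measure.infinitePi fun _ => ν) (Measure.infinitePi fun _ : κ => ν) :=
    ⟨by fun_prop, Measure.map_infinitePi_infinitePi_of_inj (P := fun _ => ν) hσ⟩
  exact integral_comp_of_measurePreserving
    ((MeasurePreserving.id P).prod h1) hG

/-- The maximum of inner multilevel estimator and payoff at `Y_ℓ`, as a function of the outer
outcome and of a single stream of noises, indexed by inner level and number of the sample. -/
noncomputable def maxML (M : NestedModel d Ω E) (N : ℕ → ℕ → ℕ) (ℓ : ℕ)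
    (s : Ω × (ℕ × ℕ → E)) : ℝ :=
  max (∑ k ∈ Finset.range (ℓ + 1), (N ℓ k : ℝ)⁻¹ *
    ∑ n ∈ Finset.range (N ℓ k), M.DX k (M.Yapp ℓ s.1) (s.2 (k, n))) (M.payoff (M.Yapp ℓ s.1))

lemma IsMeasurable.maxML {M : NestedModel d Ω E} (hM : M.IsMeasurable) (N : ℕ → ℕ → ℕ)
    (ℓ : ℕ) : Measurable (M.maxML N ℓ) := by
  unfold NestedModel.maxML
  refine Measurable.max (Finset.measurable_sum _ fun k _ => Measurable.const_mul
    (Finset.measurable_sum _ fun n _ => ?_) _) ((hM.payoff.comp (hM.Yapp ℓ)).comp measurable_fst)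
  exact (hM.DX k).comp (((hM.Yapp ℓ).comp measurable_fst).prodMk
    ((measurable_pi_apply (k, n)).comp measurable_snd))

variable {P : Measure Ω} [IsProbabilityMeasure P] {ν : Measure E} [IsProbabilityMeasure ν]

lemma integral_max_innerML_eq {M : NestedModel d Ω E} (hM : M.IsMeasurable) (N : ℕ → ℕ → ℕ)
    (ℓ : ℕ) (j : Fin 3) :
    ∫ s, max (M.innerML N ℓ j (M.Yapp ℓ s.1) s.2) (M.payoff (M.Yapp ℓ s.1)) ∂(scenarioMeasure P ν)
      = ∫ s, M.maxML N ℓ s ∂(P.prod (Measure.infinitePi fun _ : ℕ × ℕ => ν)) := by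
  have hσ : Function.Injective fun p : ℕ × ℕ => (j, p.1, p.2) := by
    rintro ⟨a, b⟩ ⟨a', b'⟩ hab; simpa using hab
  exact integral_scenario_comp_injective hσ (hM.maxML N ℓ)

/-- Replacing the fine by the coarse inner estimator of the same level does not change the
expectation.  If the sample sizes double, this holds because the fine estimator, which draws from
three streams, has the law of a coarse one: its samples may be relabelled as one stream. -/
lemma integral_max_fineML_eq {M : NestedModel d Ω E} (hM : M.IsMeasurable) (N : ℕ → ℕ → ℕ)
    (hN : ∀ ℓ, ∀ k ≤ ℓ, 0 < N ℓ k)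
    (htel : ∀ ℓ, (∀ k ≤ ℓ, N (ℓ + 1) k = 2 * N ℓ k) ∨ M.TelescopesAt P ν N (ℓ + 1)) (ℓ : ℕ) :
    ∫ s, max (M.fineML N ℓ (M.Yapp ℓ s.1) s.2) (M.payoff (M.Yapp ℓ s.1)) ∂(scenarioMeasure P ν)
      = ∫ s, max (M.innerML N ℓ 0 (M.Yapp ℓ s.1) s.2) (M.payoff (M.Yapp ℓ s.1))
          ∂(scenarioMeasure P ν) := by
  cases ℓ with
  | zero =>
    rw [integral_max_innerML_eq hM N 0 0, ← integral_max_innerML_eq hM N 0 2]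
    simp [fineML, innerML]
  | succ ℓ =>
    rcases htel ℓ with h2 | h
    swap
    · exact h
    rw [integral_max_innerML_eq hM N (ℓ + 1) 0]
    -- the first half of the samples of each level `k ≤ ℓ` is taken from stream `0`, the second half
    -- from stream `1`, and all samples of level `ℓ + 1` from stream `2`
    let σ : ℕ × ℕ → Fin 3 × ℕ × ℕ := fun p =>
      if p.1 ≤ ℓ then (if p.2 < N ℓ p.1 then (0, p.1, p.2) else (1, p.1, p.2 - N ℓ p.1))
      else (2, p.1, p.2)
    have hσ : Function.Injective σ := by
      rintro ⟨a, b⟩ ⟨a', b'⟩ hab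
      simp only [σ] at hab
      split_ifs at hab
      all_goals
        simp only [Prod.mk.injEq] at hab ⊢
        obtain ⟨h0, rfl, h3⟩ := hab
        first
          | exact absurd h0 (by decide)
          | exact ⟨rfl, by omega⟩
    rw [← integral_scenario_comp_injective hσ (hM.maxML N (ℓ + 1))]
    refine integral_congr_ae (Filter.Eventually.of_forall fun s => ?_)
    simp only [maxML, fineML]
    congr 1
    rw [Finset.sum_range_succ]
    congr 1
    · rw [innerML, innerML, ← Finset.sum_add_distrib, Finset.mul_sum]
      refine Finset.sum_congr rfl fun k hk => ?_
      have hkℓ : k ≤ ℓ := by have := Finset.mem_range.1 hk; omega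
      have hNk : (N ℓ k : ℝ) ≠ 0 := by
        have := hN ℓ k hkℓ
        positivity
      rw [h2 k hkℓ, two_mul, Finset.sum_range_add]
      have e1 : ∀ n ∈ Finset.range (N ℓ k), M.DX k (M.Yapp (ℓ + 1) s.1) (s.2 (σ (k, n)))
          = M.DX k (M.Yapp (ℓ + 1) s.1) (s.2 (0, k, n)) := fun n hn => by
        have := Finset.mem_range.1 hn
        simp [σ, hkℓ, this]
      have e2 : ∀ n ∈ Finset.range (N ℓ k),
          M.DX k (M.Yapp (ℓ + 1) s.1) (s.2 (σ (k, N ℓ k + n)))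
            = M.DX k (M.Yapp (ℓ + 1) s.1) (s.2 (1, k, n)) := fun n _ => by
        simp [σ, hkℓ]
      rw [Finset.sum_congr rfl e1, Finset.sum_congr rfl e2, levelMean, levelMean]
      push_cast
      field_simp
      ring
    · simp [levelMean, σ]

end NestedModel

/-! ### Cost and error of the multilevel estimator -/

/-- A convergent sequence whose increments are dominated by those of a nonnegative sequence `G` is
at distance at most `G` from its limit. -/
lemma abs_sub_le_of_tendsto {e G : ℕ → ℝ} {a : ℝ} (he : Filter.Tendsto e Filter.atTop (nhds a))
    (hG : ∀ n, 0 ≤ G n) (h : ∀ n, |e (n + 1) - e n| ≤ G n - G (n + 1)) (L : ℕ) :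
    |e L - a| ≤ G L := by
  have h1 : ∀ n, L ≤ n → |e n - e L| ≤ G L := by
    intro n hn
    have h2 : |e n - e L| ≤ G L - G n := by
      induction n, hn using Nat.le_induction with
      | base => simp
      | succ n _ ih =>
        have := abs_add_le (e (n + 1) - e n) (e n - e L)
        rw [sub_add_sub_cancel] at this
        linarith [h n]
    linarith [hG n]
  rw [abs_sub_comm]
  exact le_of_tendsto ((he.sub_const (e L)).abs)
    (Filter.eventually_atTop.2 ⟨L, fun n hn => h1 n hn⟩)

namespace NestedModel

lemma mlmcCost_le {d : ℕ} {Ω E : Type*} (M : NestedModel d Ω E) (N : ℕ → ℕ → ℕ) {W : ℕ → ℝ}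
    (hW : ∀ ℓ ω, M.correctionCost N ℓ ω ≤ W ℓ) (L : ℕ) (m : ℕ → ℕ)
    (S : ℕ × ℕ → Scenario Ω E) :
    M.mlmcCost N L m S ≤ ∑ ℓ ∈ Finset.range (L + 1), m ℓ * W ℓ := by
  refine Finset.sum_le_sum fun ℓ _ => ?_
  refine (Finset.sum_le_sum fun i _ => hW ℓ (S (ℓ, i)).1).trans ?_
  simp

/-- Up to constants, the sum of the reciprocal sample sizes, which governs the variance, and the
cost of a correction of level `ℓ` in units of `2 ^ ℓ` are given by factors `u ℓ` and `v ℓ` whose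
product is at most `ℓ + 1`: for `ζ = 1` the logarithmic factor is in the cost, for `ζ > 1` in the
variance. -/
lemma exists_work_factors {d : ℕ} {Ω E : Type*} (M : NestedModel d Ω E) {ζ : ℝ} (hζ : 1 ≤ ζ)
    {N : ℕ → ℕ → ℕ} {c c' : ℝ} (hc : 0 < c) (hc' : 0 < c')
    (hN : ∀ ℓ k : ℕ, k ≤ ℓ → c * max ((2 : ℝ) ^ ((ℓ : ℝ) - ζ * k)) 1 ≤ N ℓ k)
    (hN' : ∀ ℓ k : ℕ, k ≤ ℓ → (N ℓ k : ℝ) ≤ c' * max ((2 : ℝ) ^ ((ℓ : ℝ) - ζ * k)) 1)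
    {a â : ℝ} (hX : ∀ (k : ℕ) (y : EuclideanSpace ℝ (Fin d)), (M.costX k y : ℝ) ≤ a * 2 ^ k)
    (hY : ∀ ℓ : ℕ, (M.costY ℓ : ℝ) ≤ â * 2 ^ ℓ) :
    ∃ u v : ℕ → ℝ, (∀ ℓ, 1 ≤ u ℓ) ∧ (∀ ℓ, 1 ≤ v ℓ) ∧ (∀ ℓ : ℕ, u ℓ * v ℓ ≤ ℓ + 1) ∧
      Monotone u ∧ ∃ C > (0 : ℝ),
        (∀ ℓ : ℕ, 1 + ∑ k ∈ Finset.range (ℓ + 1), (N ℓ k : ℝ)⁻¹ ≤ C * u ℓ) ∧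
        ∀ (ℓ : ℕ) (ω : Ω), M.correctionCost N ℓ ω ≤ C * v ℓ * 2 ^ ℓ := by
  have ha : 0 ≤ a := by simpa using (M.costX 0 0).2.trans (hX 0 0)
  have hâ : 0 ≤ â := by simpa using (M.costY 0).2.trans (hY 0)
  -- the two sums that have to be estimated, separately for `ζ = 1` and `ζ > 1`
  suffices hfac : ∃ u v : ℕ → ℝ, (∀ ℓ, 1 ≤ u ℓ) ∧ (∀ ℓ, 1 ≤ v ℓ) ∧
      (∀ ℓ : ℕ, u ℓ * v ℓ ≤ ℓ + 1) ∧ Monotone u ∧ Monotone v ∧ ∃ C > (0 : ℝ),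
        (∀ ℓ : ℕ, ∑ k ∈ Finset.range (ℓ + 1), (N ℓ k : ℝ)⁻¹ ≤ C * u ℓ) ∧
        ∀ ℓ : ℕ, ∑ k ∈ Finset.range (ℓ + 1), ((2 : ℝ) ^ (1 - ζ)) ^ k ≤ C * v ℓ by
    obtain ⟨u, v, hu, hv, huv, hum, hvm, C, hC, hCu, hCv⟩ := hfac
    refine ⟨u, v, hu, hv, huv, hum, 1 + C + 2 * â + c' * a + 4 * c' * a * (C + 2),
      by positivity, fun ℓ => ?_, fun ℓ ω => ?_⟩
    · have h1 := hCu ℓ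
      have h2 := hu ℓ
      have : 0 ≤ (2 * â + c' * a + 4 * c' * a * (C + 2)) * u ℓ := by positivity
      nlinarith
    · have hinner : ∀ (ℓ : ℕ) (y : EuclideanSpace ℝ (Fin d)),
          M.innerCost N ℓ y ≤ c' * a * (C + 2) * v ℓ * 2 ^ ℓ := by
        intro ℓ y
        have hvℓ := hv ℓ
        calc M.innerCost N ℓ y
            ≤ ∑ k ∈ Finset.range (ℓ + 1),
                c' * a * (2 ^ ℓ * ((2 : ℝ) ^ (1 - ζ)) ^ k + 2 ^ k) := by
              refine Finset.sum_le_sum fun k hk => ?_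
              have hkℓ : k ≤ ℓ := by have := Finset.mem_range.1 hk; omega
              calc (N ℓ k : ℝ) * M.costX k y
                  ≤ (c' * max ((2 : ℝ) ^ ((ℓ : ℝ) - ζ * k)) 1) * (a * 2 ^ k) :=
                    mul_le_mul (hN' ℓ k hkℓ) (hX k y) (M.costX k y).2 (by positivity)
                _ ≤ (c' * ((2 : ℝ) ^ ((ℓ : ℝ) - ζ * k) + 1)) * (a * 2 ^ k) := by
                    gcongr
                    exact max_le_add_of_nonneg (by positivity) (by norm_num)
                _ = c' * a * ((2 : ℝ) ^ ((ℓ : ℝ) - ζ * k) * 2 ^ k + 2 ^ k) := by ring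
                _ = c' * a * (2 ^ ℓ * ((2 : ℝ) ^ (1 - ζ)) ^ k + 2 ^ k) := by
                    have e : (2 : ℝ) ^ ((ℓ : ℝ) - ζ * k) * 2 ^ k
                        = 2 ^ ℓ * ((2 : ℝ) ^ (1 - ζ)) ^ k := by
                      rw [← Real.rpow_natCast (2 ^ (1 - ζ)) k, ← Real.rpow_mul (by norm_num),
                        ← Real.rpow_natCast 2 k, ← Real.rpow_natCast 2 ℓ,
                        ← Real.rpow_add (by norm_num), ← Real.rpow_add (by norm_num)]
                      congr 1; ring
                    rw [e]
          _ = c' * a * (2 ^ ℓ * ∑ k ∈ Finset.range (ℓ + 1), ((2 : ℝ) ^ (1 - ζ)) ^ k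
                + ∑ k ∈ Finset.range (ℓ + 1), (2 : ℝ) ^ k) := by
              rw [← Finset.mul_sum, Finset.sum_add_distrib, Finset.mul_sum]
          _ ≤ c' * a * (2 ^ ℓ * (C * v ℓ) + 2 * v ℓ * 2 ^ ℓ) := by
              gcongr
              · exact hCv ℓ
              · have h1 := geom_sum_le_of_one_lt (y := 2) (by norm_num) ℓ
                norm_num at h1
                refine h1.trans ?_
                gcongr
                linarith
          _ = _ := by ring
      cases ℓ with
      | zero =>
        have h1 := hv 0
        have h2 := hN' 0 0 le_rfl
        have h3 := hX 0 (M.Yapp 0 ω)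
        have h4 := hY 0
        simp only [Nat.cast_zero, mul_zero, sub_zero, Real.rpow_zero, max_self, mul_one,
          pow_zero] at h2 h3 h4
        have h5 : (N 0 0 : ℝ) * M.costX 0 (M.Yapp 0 ω) ≤ c' * a :=
          mul_le_mul h2 h3 (M.costX 0 _).2 hc'.le
        simp only [correctionCost, pow_zero, mul_one]
        have h6 : 0 ≤ 1 + C + â + 4 * c' * a * (C + 2) := by positivity
        have h7 : 0 ≤ (1 + C + 2 * â + c' * a + 4 * c' * a * (C + 2)) * (v 0 - 1) :=
          mul_nonneg (by positivity) (by linarith)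
        nlinarith
      | succ ℓ =>
        have hvv := hvm (Nat.le_succ ℓ)
        have hv1 := hv (ℓ + 1)
        have h2 := hN' (ℓ + 1) (ℓ + 1) le_rfl
        have hmax : max ((2 : ℝ) ^ (((ℓ + 1 : ℕ) : ℝ) - ζ * ((ℓ + 1 : ℕ) : ℝ))) 1 = 1 := by
          refine max_eq_right (Real.rpow_le_one_of_one_le_of_nonpos (by norm_num) ?_)
          have : (0 : ℝ) ≤ ((ℓ + 1 : ℕ) : ℝ) := by positivity
          nlinarith
        rw [hmax, mul_one] at h2
        have h5 : (N (ℓ + 1) (ℓ + 1) : ℝ) * M.costX (ℓ + 1) (M.Yapp (ℓ + 1) ω)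
            ≤ c' * (a * 2 ^ (ℓ + 1)) := mul_le_mul h2 (hX _ _) (M.costX _ _).2 hc'.le
        have hp : (2 : ℝ) ^ ℓ ≤ 2 ^ (ℓ + 1) := pow_le_pow_right₀ (by norm_num) (by omega)
        have h6 : ∀ y, M.innerCost N ℓ y ≤ c' * a * (C + 2) * v (ℓ + 1) * 2 ^ (ℓ + 1) := fun y =>
          (hinner ℓ y).trans (by gcongr)
        have h7 : (M.costY ℓ : ℝ) ≤ â * 2 ^ (ℓ + 1) := (hY ℓ).trans (by gcongr)
        have h8 := hY (ℓ + 1)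
        have h9 := h6 (M.Yapp (ℓ + 1) ω)
        have h10 := h6 (M.Yapp ℓ ω)
        simp only [correctionCost]
        calc (M.costY (ℓ + 1) : ℝ) + M.costY ℓ + (2 * M.innerCost N ℓ (M.Yapp (ℓ + 1) ω)
              + (N (ℓ + 1) (ℓ + 1) : ℝ) * M.costX (ℓ + 1) (M.Yapp (ℓ + 1) ω))
              + 2 * M.innerCost N ℓ (M.Yapp ℓ ω)
            ≤ (2 * â + c' * a) * 1 * 2 ^ (ℓ + 1)
              + 4 * c' * a * (C + 2) * v (ℓ + 1) * 2 ^ (ℓ + 1) := by linarith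
          _ ≤ (2 * â + c' * a) * v (ℓ + 1) * 2 ^ (ℓ + 1)
              + 4 * c' * a * (C + 2) * v (ℓ + 1) * 2 ^ (ℓ + 1) := by gcongr
          _ ≤ _ := by
              have : 0 ≤ (1 + C) * v (ℓ + 1) * 2 ^ (ℓ + 1) := by positivity
              linarith
  have hinv : ∀ ℓ k : ℕ, k ≤ ℓ → (N ℓ k : ℝ)⁻¹ ≤ c⁻¹ := fun ℓ k hk => by
    refine inv_anti₀ hc ((le_mul_of_one_le_right hc.le (le_max_right _ _)).trans (hN ℓ k hk))
  have hsumN : ∀ ℓ : ℕ, ∑ k ∈ Finset.range (ℓ + 1), (N ℓ k : ℝ)⁻¹ ≤ c⁻¹ * (ℓ + 1) := fun ℓ => by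
    calc ∑ k ∈ Finset.range (ℓ + 1), (N ℓ k : ℝ)⁻¹ ≤ ∑ k ∈ Finset.range (ℓ + 1), c⁻¹ :=
          Finset.sum_le_sum fun k hk => hinv ℓ k (by have := Finset.mem_range.1 hk; omega)
      _ = c⁻¹ * (ℓ + 1) := by
          rw [Finset.sum_const, Finset.card_range, nsmul_eq_mul]; push_cast; ring
  rcases hζ.eq_or_lt with rfl | hζ1
  · refine ⟨fun _ => 1, fun ℓ => ℓ + 1, fun _ => le_rfl, fun ℓ => by simp, fun ℓ => by simp,
      monotone_const, fun a b hab => by simpa using hab, c⁻¹ * 2 + 1, by positivity,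
      fun ℓ => ?_, fun ℓ => ?_⟩
    · calc ∑ k ∈ Finset.range (ℓ + 1), (N ℓ k : ℝ)⁻¹
          ≤ ∑ k ∈ Finset.range (ℓ + 1), c⁻¹ * (2 ^ ℓ)⁻¹ * 2 ^ k := by
            refine Finset.sum_le_sum fun k hk => ?_
            have hkℓ : k ≤ ℓ := by have := Finset.mem_range.1 hk; omega
            have h1 := (mul_le_mul_of_nonneg_left (le_max_left _ _) hc.le).trans (hN ℓ k hkℓ)
            refine (inv_anti₀ (by positivity) h1).trans (le_of_eq ?_)
            rw [one_mul, Real.rpow_sub (by norm_num), Real.rpow_natCast, Real.rpow_natCast]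
            field_simp
        _ = c⁻¹ * (2 ^ ℓ)⁻¹ * ∑ k ∈ Finset.range (ℓ + 1), (2 : ℝ) ^ k := by rw [Finset.mul_sum]
        _ ≤ c⁻¹ * (2 ^ ℓ)⁻¹ * (2 * 2 ^ ℓ) := by
            gcongr
            have h1 := geom_sum_le_of_one_lt (y := 2) (by norm_num) ℓ
            norm_num at h1
            exact h1
        _ = c⁻¹ * 2 := by field_simp
        _ ≤ _ := by linarith
    · have : 0 ≤ c⁻¹ * 2 * ((ℓ : ℝ) + 1) := by positivity
      simp only [sub_self, Real.rpow_zero, one_pow, Finset.sum_const, Finset.card_range,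
        nsmul_eq_mul]
      push_cast
      linarith
  · have h1 : (2 : ℝ) ^ (1 - ζ) < 1 :=
      Real.rpow_lt_one_of_one_lt_of_neg (by norm_num) (by linarith)
    have h2 : 0 < (1 - (2 : ℝ) ^ (1 - ζ))⁻¹ := inv_pos.2 (by linarith)
    refine ⟨fun ℓ => ℓ + 1, fun _ => 1, fun ℓ => by simp, fun _ => le_rfl, fun ℓ => by simp,
      fun a b hab => by simpa using hab, monotone_const, c⁻¹ + (1 - (2 : ℝ) ^ (1 - ζ))⁻¹,
      by positivity, fun ℓ => ?_, fun ℓ => ?_⟩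
    · refine (hsumN ℓ).trans ?_
      gcongr
      linarith
    · refine (geom_sum_le_inv_one_sub (by positivity) h1 _).trans ?_
      have : 0 < c⁻¹ := by positivity
      linarith

variable {d : ℕ} {Ω E : Type*} [MeasurableSpace Ω] [MeasurableSpace E]

variable {P : Measure Ω} [IsProbabilityMeasure P] {ν : Measure E} [IsProbabilityMeasure ν]

/-- Bias–variance decomposition of the root mean square error. -/
lemma mlmcRMSE_le {M : NestedModel d Ω E} (hM : M.IsMeasurable) {N : ℕ → ℕ → ℕ} {D : ℕ → ℝ}
    (hD0 : ∀ ℓ, 0 ≤ D ℓ)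
    (hD : ∀ ℓ, eLpNorm (M.antitheticCorrection N ℓ) 2 (scenarioMeasure P ν)
      ≤ ENNReal.ofReal (D ℓ)) (L : ℕ) {m : ℕ → ℕ} (hm : ∀ ℓ, 0 < m ℓ) {b v : ℝ} (hv : 0 ≤ v)
    (hb : |∑ ℓ ∈ Finset.range (L + 1), ∫ s, M.antitheticCorrection N ℓ s ∂(scenarioMeasure P ν)
      - M.U₀ P ν| ≤ b)
    (hV : ∑ ℓ ∈ Finset.range (L + 1), D ℓ ^ 2 / m ℓ ≤ v ^ 2) :
    M.mlmcRMSE P ν N L m ≤ ENNReal.ofReal (v + b) := by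
  have hb0 : 0 ≤ b := (abs_nonneg _).trans hb
  have hΔ := hM.antitheticCorrection N
  have hvar := lintegral_sum_sampleMean_sq_le (ν := scenarioMeasure P ν)
    (idx := fun p : ℕ × ℕ => p) Function.injective_id
    (h := fun ℓ => M.antitheticCorrection N ℓ) hΔ (N := m) (L + 1) fun k _ => hm k
  let F : (ℕ × ℕ → Scenario Ω E) → ℝ := fun S => ∑ ℓ ∈ Finset.range (L + 1),
    ((m ℓ : ℝ)⁻¹ * ∑ n ∈ Finset.range (m ℓ), M.antitheticCorrection N ℓ (S (ℓ, n))
      - ∫ s, M.antitheticCorrection N ℓ s ∂(scenarioMeasure P ν))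
  have hFm : Measurable F := by
    refine Finset.measurable_sum _ fun ℓ _ => (Measurable.const_mul
      (Finset.measurable_sum _ fun n _ => ?_) _).sub measurable_const
    exact (hΔ ℓ).comp (measurable_pi_apply (ℓ, n))
  have hF : eLpNorm F 2 (samplingMeasure P ν) ≤ ENNReal.ofReal v := by
    refine eLpNorm_le_ofReal_of_lintegral_sq_le hv (hvar.trans ?_)
    refine le_trans (Finset.sum_le_sum fun ℓ _ => ?_)
      ((ENNReal.ofReal_sum_of_nonneg fun ℓ _ => ?_).symm.le.trans (ENNReal.ofReal_le_ofReal hV))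
    · rw [← eLpNorm_two_sq, div_eq_inv_mul, ENNReal.ofReal_mul (by positivity),
        ENNReal.ofReal_pow (hD0 ℓ)]
      exact mul_le_mul_right (pow_le_pow_left₀ zero_le (hD ℓ) 2) _
    · positivity
  set μ := ∑ ℓ ∈ Finset.range (L + 1), ∫ s, M.antitheticCorrection N ℓ s ∂(scenarioMeasure P ν)
  have e : (fun S => M.mlmcEstimator N L m S - M.U₀ P ν) = F + fun _ => μ - M.U₀ P ν := by
    ext S
    simp only [mlmcEstimator, F, Pi.add_apply, Finset.sum_sub_distrib, μ]
    ring
  have : IsProbabilityMeasure (samplingMeasure P ν) := by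
    unfold samplingMeasure; infer_instance
  unfold mlmcRMSE
  rw [e]
  refine (eLpNorm_add_le hFm.aestronglyMeasurable aestronglyMeasurable_const
    (by norm_num)).trans ?_
  rw [ENNReal.ofReal_add hv hb0, eLpNorm_const _ (by norm_num) (IsProbabilityMeasure.ne_zero _)]
  refine add_le_add hF ?_
  simp only [measure_univ, ENNReal.one_rpow, mul_one]
  rw [Real.enorm_eq_ofReal_abs]
  exact ENNReal.ofReal_le_ofReal hb

/-- Telescoping: the expectation of the multilevel estimator is that of its finest level. -/
lemma GeometricRates.sum_integral_antitheticCorrection {M : NestedModel d Ω E}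
    {r τ ζ β₂ βh₂ K ρ : ℝ} (h : M.GeometricRates P ν r τ ζ β₂ βh₂ K ρ) {N : ℕ → ℕ → ℕ}
    (hN : ∀ ℓ, ∀ k ≤ ℓ, 0 < N ℓ k)
    (htel : ∀ ℓ, (∀ k ≤ ℓ, N (ℓ + 1) k = 2 * N ℓ k) ∨ M.TelescopesAt P ν N (ℓ + 1)) (L : ℕ) :
    ∑ ℓ ∈ Finset.range (L + 1), ∫ s, M.antitheticCorrection N ℓ s ∂(scenarioMeasure P ν)
      = ∫ s, max (M.innerML N L 0 (M.Yapp L s.1) s.2) (M.payoff (M.Yapp L s.1))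
          ∂(scenarioMeasure P ν) := by
  induction L with
  | zero =>
    rw [Finset.sum_range_one, ← integral_max_fineML_eq h.meas N hN htel 0]
    rfl
  | succ L ih =>
    rw [Finset.sum_range_succ, ih, ← integral_max_fineML_eq h.meas N hN htel (L + 1)]
    have i := fun j => (h.memLp_max_innerML N L j).integrable one_le_two
    have i' := (h.memLp_max_fineML N (L + 1)).integrable one_le_two
    have isum : Integrable (fun s => max (M.innerML N L 0 (M.Yapp L s.1) s.2)
        (M.payoff (M.Yapp L s.1)) + max (M.innerML N L 1 (M.Yapp L s.1) s.2)
        (M.payoff (M.Yapp L s.1))) (scenarioMeasure P ν) := (i 0).add (i 1)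
    have e : ∫ s, M.antitheticCorrection N (L + 1) s ∂(scenarioMeasure P ν)
        = (∫ s, max (M.fineML N (L + 1) (M.Yapp (L + 1) s.1) s.2) (M.payoff (M.Yapp (L + 1) s.1))
            ∂(scenarioMeasure P ν))
          - 1 / 2 * ((∫ s, max (M.innerML N L 0 (M.Yapp L s.1) s.2) (M.payoff (M.Yapp L s.1))
            ∂(scenarioMeasure P ν))
            + ∫ s, max (M.innerML N L 1 (M.Yapp L s.1) s.2) (M.payoff (M.Yapp L s.1))
            ∂(scenarioMeasure P ν)) := by
      rw [← integral_add (i 0) (i 1), ← integral_const_mul,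
        ← integral_sub i' (isum.const_mul _)]
      rfl
    rw [e, integral_max_innerML_eq h.meas N L 1, ← integral_max_innerML_eq h.meas N L 0]
    ring

/-- The bias is at most a sequence whose decrements dominate the `L^2` norms of the corrections. -/
lemma GeometricRates.abs_bias_le {M : NestedModel d Ω E}
    {r τ ζ β₂ βh₂ K ρ : ℝ} (h : M.GeometricRates P ν r τ ζ β₂ βh₂ K ρ) {N : ℕ → ℕ → ℕ}
    {c : ℝ} (hc : 0 < c) (hN : ∀ ℓ k : ℕ, k ≤ ℓ → c * max ((2 : ℝ) ^ ((ℓ : ℝ) - ζ * k)) 1 ≤ N ℓ k)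
    (htel : ∀ ℓ, (∀ k ≤ ℓ, N (ℓ + 1) k = 2 * N ℓ k) ∨ M.TelescopesAt P ν N (ℓ + 1))
    {D G : ℕ → ℝ} (hD : ∀ ℓ, eLpNorm (M.antitheticCorrection N ℓ) 2 (scenarioMeasure P ν)
      ≤ ENNReal.ofReal (D ℓ)) (hD0 : ∀ ℓ, 0 ≤ D ℓ) (hG : ∀ ℓ, 0 ≤ G ℓ)
    (hDG : ∀ ℓ, D (ℓ + 1) ≤ G ℓ - G (ℓ + 1)) (L : ℕ) :
    |∑ ℓ ∈ Finset.range (L + 1), ∫ s, M.antitheticCorrection N ℓ s ∂(scenarioMeasure P ν)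
      - M.U₀ P ν| ≤ G L := by
  have hNpos : ∀ ℓ, ∀ k ≤ ℓ, 0 < N ℓ k := fun ℓ k hk => by
    have h1 : 0 < c * max ((2 : ℝ) ^ ((ℓ : ℝ) - ζ * k)) 1 := by positivity
    exact_mod_cast h1.trans_le (hN ℓ k hk)
  have hlim := h.tendsto_integral_max_innerML hc hN
  simp only [← h.sum_integral_antitheticCorrection hNpos htel] at hlim
  refine abs_sub_le_of_tendsto hlim hG (fun n => ?_) L
  rw [Finset.sum_range_succ _ (n + 1), add_sub_cancel_left]
  refine le_trans ?_ (hDG n)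
  have h1 := (enorm_integral_le_eLpNorm (μ := scenarioMeasure P ν)
    (h.meas.antitheticCorrection N (n + 1)) (p := 2) one_le_two).trans (hD (n + 1))
  rw [Real.enorm_eq_ofReal_abs] at h1
  exact (ENNReal.ofReal_le_ofReal_iff (hD0 _)).1 h1

end NestedModel

namespace NestedModel

variable {d : ℕ} {Ω E : Type*} [MeasurableSpace Ω] [MeasurableSpace E]
  {P : Measure Ω} [IsProbabilityMeasure P] {ν : Measure E} [IsProbabilityMeasure ν]

/-- The root mean square error is at most `ε` if the bias is at most `ε / 2` and the variance at
most `ε ^ 2 / 4`. -/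
lemma GeometricRates.mlmcRMSE_le_ofReal {M : NestedModel d Ω E}
    {r τ ζ β₂ βh₂ K ρ : ℝ} (h : M.GeometricRates P ν r τ ζ β₂ βh₂ K ρ) {N : ℕ → ℕ → ℕ}
    {c : ℝ} (hc : 0 < c) (hN : ∀ ℓ k : ℕ, k ≤ ℓ → c * max ((2 : ℝ) ^ ((ℓ : ℝ) - ζ * k)) 1 ≤ N ℓ k)
    (htel : ∀ ℓ, (∀ k ≤ ℓ, N (ℓ + 1) k = 2 * N ℓ k) ∨ M.TelescopesAt P ν N (ℓ + 1))
    {D G : ℕ → ℝ} (hD : ∀ ℓ, eLpNorm (M.antitheticCorrection N ℓ) 2 (scenarioMeasure P ν)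
      ≤ ENNReal.ofReal (D ℓ)) (hD0 : ∀ ℓ, 0 ≤ D ℓ) (hG : ∀ ℓ, 0 ≤ G ℓ)
    (hDG : ∀ ℓ, D (ℓ + 1) ≤ G ℓ - G (ℓ + 1)) {ε : ℝ} (hε : 0 < ε) {L : ℕ} {m : ℕ → ℕ}
    (hm : ∀ ℓ, 0 < m ℓ) (hGε : G L ≤ ε / 2)
    (hV : ∑ ℓ ∈ Finset.range (L + 1), D ℓ ^ 2 / m ℓ ≤ ε ^ 2 / 4) :
    M.mlmcRMSE P ν N L m ≤ ENNReal.ofReal ε := by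
  have h1 := mlmcRMSE_le h.meas hD0 hD L hm (v := ε / 2) (b := ε / 2) (by positivity)
    ((h.abs_bias_le hc hN htel hD hD0 hG hDG L).trans hGε) (hV.trans (by nlinarith))
  rwa [add_halves] at h1

end NestedModel

theorem mainTheorem1 {d : ℕ} {Ω E : Type*} [MeasurableSpace Ω] [MeasurableSpace E]
    (P : Measure Ω) [IsProbabilityMeasure P] (ν : Measure E) [IsProbabilityMeasure ν]
    (M : NestedModel d Ω E) (hM : M.IsMeasurable)
    (hcorr : M.IsCorrectionAt P ν M.Y) (hcorrApp : ∀ ℓ, M.IsCorrectionAt P ν (M.Yapp ℓ))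
    (q : ℝ) (hq : 2 < q) (β βh lam : ℝ → ℝ)
    (hmom : M.MomentDensity P ν q)
    (hexact : M.ExactOuterRates P ν q β lam)
    (happrox : M.ApproxOuterRates P ν q β lam)
    (houter : M.OuterRates P ν q βh)
    (hlam : lam 2 = 0)
    (ζ : ℝ) (hζ : 1 ≤ ζ) (hζβ : ζ ≤ β q)
    (N : ℕ → ℕ → ℕ) (hN : InnerSizes ζ N)
    (htel : ∀ ℓ, (∀ k ≤ ℓ, N (ℓ + 1) k = 2 * N ℓ k) ∨ M.TelescopesAt P ν N (ℓ + 1)) :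
    ∃ C > (0 : ℝ), ∀ ε : ℝ, 0 < ε → ε < Real.exp (-1) →
      ∃ (L : ℕ) (m : ℕ → ℕ), (∀ ℓ ≤ L, 0 < m ℓ) ∧
        M.mlmcRMSE P ν N L m ≤ ENNReal.ofReal ε ∧
        ∀ S, M.mlmcCost N L m S
          ≤ C * ε⁻¹ ^ 2 * (if 1 < β 2 ∧ 1 < βh 2 then 1 else |Real.log ε| ^ 3) := by
  -- The antithetic part of a correction has `L^2` norm of order `2 ^ (-(1 / 2 - τ) * f * ℓ)` with
  -- `f > 1`, and `τ` is so small that the exponent remains larger than `1 / 2`.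
  set r : ℝ := min q 3 with hr
  have hr2 : 2 < r := lt_min hq (by norm_num)
  set f : ℝ := 3 * r / (r + 1) / 2 with hf
  have hf1 : 1 < f := by
    rw [hf, div_div, one_lt_div (by linarith)]
    linarith
  set τ : ℝ := (1 - 1 / f) / 4 with hτ
  have hf1' : 1 / f < 1 := (div_lt_one (by linarith)).2 hf1
  have hf0' : 0 < 1 / f := by positivity
  obtain ⟨K, ρ, h⟩ := NestedModel.exists_geometricRates P ν M hM hcorrApp hq hmom hexact happrox
    houter hlam hζβ hr2 (min_le_right _ _) (min_le_left _ _) (τ := τ) (by rw [hτ]; linarith)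
    (by rw [hτ]; linarith)
  have hκ : (1 / 2 - τ) * f = (f + 1) / 4 := by
    rw [hτ]
    field_simp
    ring
  obtain ⟨c, hc, c', hc', hNcc⟩ := hN
  have hNc := fun ℓ k hk => (hNcc ℓ k hk).1
  obtain ⟨a₀, -, -, hcostX, -⟩ := happrox.2
  obtain ⟨â₀, hcostY⟩ := houter.1
  have hβ := (hexact.1 2 (by norm_num) hq.le).1
  have hβh := (houter.2 2 (by norm_num) hq.le).1
  obtain ⟨u, v, hu, hv, huv, hum, C₃, hC₃, hS, hcost⟩ :=
    M.exists_work_factors hζ hc hc' hNc (fun ℓ k hk => (hNcc ℓ k hk).2) hcostX hcostY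
  obtain ⟨C, hC, hΔ⟩ := h.exists_eLpNorm_antitheticCorrection_le (by linarith) (by linarith) hc hNc
  rw [← hf, hκ] at hΔ
  -- bounds of the `L²` norms of all corrections
  let D : ℕ → ℝ := fun
    | 0 => (eLpNorm (M.antitheticCorrection N 0) 2 (NestedModel.scenarioMeasure P ν)).toReal
    | ℓ + 1 => C * (2 ^ (-(β 2 / 2) * ℓ) + 2 ^ (-((f + 1) / 4) * ℓ)
        + 2 ^ (-(βh 2 / 2) * ℓ) * √(1 + ∑ k ∈ Finset.range (ℓ + 1), (N ℓ k : ℝ)⁻¹))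
  have hD0 : ∀ ℓ, 0 ≤ D ℓ
    | 0 => ENNReal.toReal_nonneg
    | ℓ + 1 => by positivity
  have hD : ∀ ℓ, eLpNorm (M.antitheticCorrection N ℓ) 2 (NestedModel.scenarioMeasure P ν)
      ≤ ENNReal.ofReal (D ℓ)
    | 0 => (ENNReal.ofReal_toReal (h.memLp_antitheticCorrection N 0).2.ne).ge
    | ℓ + 1 => hΔ ℓ
  have hrpow : ∀ (y : ℝ) (ℓ : ℕ), (2 : ℝ) ^ (y * ℓ) = (2 ^ y) ^ ℓ := fun y ℓ => by
    rw [Real.rpow_mul (by norm_num), Real.rpow_natCast]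
  by_cases hcase : 1 < β 2 ∧ 1 < βh 2
  · simp only [hcase, and_self, if_true, mul_one]
    set μ : ℝ := min (min (β 2 / 2) ((f + 1) / 4)) (βh 2 / 2) with hμ
    have hμ1 : 1 / 2 < μ :=
      lt_min (lt_min (by linarith [hcase.1]) (by linarith)) (by linarith [hcase.2])
    set x : ℝ := (μ + 1 / 2) / 2 with hx
    have hx1 : 1 / 2 < x := by linarith
    have hxμ : x < μ := by linarith
    -- linear factors are absorbed by the gaps `μ - x` and `x - 1 / 2`
    have hlin : ∀ σ : ℝ, 0 < σ → ∃ K' > (0 : ℝ), ∀ ℓ : ℕ, (ℓ : ℝ) + 1 ≤ K' * 2 ^ (σ * ℓ) := by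
      intro σ hσ
      obtain ⟨K', hK', hb⟩ := exists_max_rpow_le 1 hσ
      refine ⟨2 * K', by positivity, fun ℓ => ?_⟩
      have h1 := hb ℓ
      rw [Real.rpow_one] at h1
      linarith [le_max_left (ℓ : ℝ) 1, le_max_right (ℓ : ℝ) 1]
    obtain ⟨K₁, hK₁, hlin₁⟩ := hlin (μ - x) (by linarith)
    obtain ⟨K₂, hK₂, hlin₂⟩ := hlin (x - 1 / 2) (by linarith)
    have hu' : ∀ ℓ : ℕ, u ℓ ≤ ℓ + 1 := fun ℓ => by nlinarith [huv ℓ, hu ℓ, hv ℓ]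
    have hv' : ∀ ℓ : ℕ, v ℓ ≤ ℓ + 1 := fun ℓ => by nlinarith [huv ℓ, hu ℓ, hv ℓ]
    have htu : ((2 : ℝ) ^ (-((x - 1 / 2) / 2))) ^ 2 * (2 ^ x) ^ 2 = 2 ^ (x + 1 / 2) := by
      simp only [← Real.rpow_natCast, ← Real.rpow_mul (zero_le_two (α := ℝ)),
        ← Real.rpow_add (zero_lt_two (α := ℝ))]
      congr 1
      push_cast
      ring
    obtain ⟨G, hG, hDG, C', hC', hlev⟩ := exists_levels_of_norm_le_geometric
      (A := C * (2 + C₃ * K₁)) (B := C₃ * K₂) (u := 2 ^ x) (t := 2 ^ (-((x - 1 / 2) / 2)))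
      (D := D) (W := fun ℓ => C₃ * v ℓ * 2 ^ ℓ)
      (by positivity) (by positivity) (Real.one_lt_rpow (by norm_num) (by linarith))
      (by positivity) (Real.rpow_lt_one_of_one_lt_of_neg (by norm_num) (by linarith))
      (by rw [htu]; exact Real.one_lt_rpow (by norm_num) (by linarith)) hD0
      (fun ℓ => by
        have hle : ∀ y, μ ≤ y → (2 : ℝ) ^ (-y * ℓ) ≤ 2 ^ (-μ * ℓ) := fun y hy =>
          Real.rpow_le_rpow_of_exponent_le one_le_two
            (mul_le_mul_of_nonneg_right (by linarith) (by positivity))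
        have hle' : (2 : ℝ) ^ (-μ * ℓ) ≤ 2 ^ (-x * ℓ) :=
          Real.rpow_le_rpow_of_exponent_le one_le_two
            (mul_le_mul_of_nonneg_right (by linarith) (by positivity))
        have hsum : √(1 + ∑ k ∈ Finset.range (ℓ + 1), (N ℓ k : ℝ)⁻¹)
            ≤ C₃ * (K₁ * 2 ^ ((μ - x) * ℓ)) := by
          refine le_trans ?_ ((hS ℓ).trans ?_)
          · have h1 : 0 ≤ ∑ k ∈ Finset.range (ℓ + 1), (N ℓ k : ℝ)⁻¹ := by positivity
            exact Real.sqrt_le_iff.2 ⟨by linarith, by nlinarith⟩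
          · gcongr
            exact (hu' ℓ).trans (hlin₁ ℓ)
        calc C * (2 ^ (-(β 2 / 2) * ℓ) + 2 ^ (-((f + 1) / 4) * ℓ)
              + 2 ^ (-(βh 2 / 2) * ℓ) * √(1 + ∑ k ∈ Finset.range (ℓ + 1), (N ℓ k : ℝ)⁻¹))
            ≤ C * (2 ^ (-x * ℓ) + 2 ^ (-x * ℓ)
              + 2 ^ (-μ * ℓ) * (C₃ * (K₁ * 2 ^ ((μ - x) * ℓ)))) := by
              gcongr ?_ * (?_ + ?_ + ?_ * ?_)
              · exact (hle _ ((min_le_left _ _).trans (min_le_left _ _))).trans hle'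
              · exact (hle _ ((min_le_left _ _).trans (min_le_right _ _))).trans hle'
              · exact hle _ (min_le_right _ _)
          _ = C * (2 * 2 ^ (-x * ℓ) + C₃ * K₁ * (2 ^ (-μ * ℓ) * 2 ^ ((μ - x) * ℓ))) := by ring
          _ = C * (2 + C₃ * K₁) * (2 ^ x)⁻¹ ^ ℓ := by
              rw [← Real.rpow_add zero_lt_two, ← Real.rpow_neg zero_le_two, ← hrpow]
              rw [show -μ * (ℓ : ℝ) + (μ - x) * ℓ = -x * ℓ by ring]
              ring)
      (fun ℓ => by
        rw [htu]
        calc C₃ * v ℓ * 2 ^ ℓ ≤ C₃ * (K₂ * 2 ^ ((x - 1 / 2) * ℓ)) * 2 ^ ℓ := by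
              gcongr
              exact (hv' ℓ).trans (hlin₂ ℓ)
          _ = C₃ * K₂ * (2 ^ (x + 1 / 2)) ^ ℓ := by
              rw [← hrpow (x + 1 / 2), show (x + 1 / 2) * (ℓ : ℝ) = (x - 1 / 2) * ℓ + ℓ by ring,
                Real.rpow_add zero_lt_two, Real.rpow_natCast]
              ring)
    refine ⟨C', hC', fun ε hε hε1 => ?_⟩
    obtain ⟨L, m, hm, hGε, hV, hW⟩ :=
      hlev ε hε (hε1.trans (Real.exp_lt_one_iff.2 (by norm_num)))
    exact ⟨L, m, fun ℓ _ => hm ℓ,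
      h.mlmcRMSE_le_ofReal hc hNc htel hD hD0 hG hDG hε hm hGε hV,
      fun S => (M.mlmcCost_le N hcost L m S).trans hW⟩
  · simp only [hcase, if_false]
    obtain ⟨G, hG, hDG, C', hC', hlev⟩ := exists_levels_of_norm_le_linear
      (A := C * (2 + √C₃)) (B := C₃) (D := D) (W := fun ℓ => C₃ * v ℓ * 2 ^ ℓ)
      (by positivity) hC₃ hu hv huv hum hD0
      (fun ℓ => by
        have hle : ∀ y : ℝ, 1 / 2 ≤ y → (2 : ℝ) ^ (-y * ℓ) ≤ (√2)⁻¹ ^ ℓ := fun y hy => by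
          rw [Real.sqrt_eq_rpow, ← Real.rpow_neg zero_le_two, ← hrpow]
          exact Real.rpow_le_rpow_of_exponent_le one_le_two
            (mul_le_mul_of_nonneg_right (by linarith) (by positivity))
        have hu1 : 1 ≤ √(u ℓ) := Real.one_le_sqrt.2 (hu ℓ)
        calc C * (2 ^ (-(β 2 / 2) * ℓ) + 2 ^ (-((f + 1) / 4) * ℓ)
              + 2 ^ (-(βh 2 / 2) * ℓ) * √(1 + ∑ k ∈ Finset.range (ℓ + 1), (N ℓ k : ℝ)⁻¹))
            ≤ C * ((√2)⁻¹ ^ ℓ + (√2)⁻¹ ^ ℓ + (√2)⁻¹ ^ ℓ * (√C₃ * √(u ℓ))) := by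
              gcongr ?_ * (?_ + ?_ + ?_ * ?_)
              · exact hle _ (by linarith)
              · exact hle _ (by linarith)
              · exact hle _ (by linarith)
              · rw [← Real.sqrt_mul hC₃.le]
                exact Real.sqrt_le_sqrt (hS ℓ)
          _ = C * (2 * 1 + √C₃ * √(u ℓ)) * (√2)⁻¹ ^ ℓ := by ring
          _ ≤ C * (2 * √(u ℓ) + √C₃ * √(u ℓ)) * (√2)⁻¹ ^ ℓ := by gcongr
          _ = _ := by ring)
      (fun ℓ => le_rfl)
    refine ⟨C', hC', fun ε hε hε1 => ?_⟩
    obtain ⟨L, m, hm, hGε, hV, hW⟩ := hlev ε hε hε1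
    exact ⟨L, m, fun ℓ _ => hm ℓ,
      h.mlmcRMSE_le_ofReal hc hNc htel hD hD0 hG hDG hε hm hGε hV,
      fun S => (M.mlmcCost_le N hcost L m S).trans hW⟩
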